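/- **Theorem 1.4 (Long-time behavior in $\mathbb R^-$).** Let $\alpha,\beta,\gamma\in\mathbb R$ with $\alpha\gamma<0$, and consider on $\mathbb R^-=(-\infty,0)$ the system $$iu_t+u_{xx}=\alpha uv+\beta u|u|^2,\qquad v_t+v_{xxx}+vv_x=\gamma(|u|^2)_x,$$ with $u$ complex-valued and $v$ real-valued, initial data $u(x,0)=u_0(x)$, $v(x,0)=v_0(x)$, and homogeneous boundary conditions $u(0,t)=v(0,t)=v_x(0,t)=0$. Let $(u,v)$ be a global regular solution, that is, $u\in C([0,\infty);H^2(\mathbb R^-))$, $v\in C([0,\infty);H^3(\mathbb R^-))$, the time derivatives $u_t,v_t$ exist in $L^2(\mathbb R^-)$ for every $t>0$, the equations hold a.e. in $x$ for every $t>0$, and the initial and boundary conditions hold. Assume $\||x|^{1/2}u_0\|+\||x|^{1/2}v_0\|<\infty$, where $\|\cdot\|$ is the norm of $L^2(\mathbb R^-)$. Put $$\mathcal Q_0^-=\int_{-\infty}^0\Big(\frac{\alpha}{\gamma}v_0^2+2\,\mathrm{Im}\,(u_0\,\overline{\partial_xu_0})\Big)dx,$$ $$\mathcal E_0^-=\int_{-\infty}^0\Big(\alpha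 v_0|u_0|^2-\frac{\alpha}{6\gamma}v_0^3+\frac{\beta}{2}|u_0|^4+\frac{\alpha}{2\gamma}(\partial_xv_0)^2+|\partial_xu_0|^2\Big)dx .$$ Then $S(t):=\sup_{s\in[0,t]}\big(\||x|^{1/2}u(\cdot,s)\|^2+\||x|^{1/2}v(\cdot,s)\|^2\big)$ is finite for every $t\ge0$, and: (a) if $\mathcal Q_0^->0$, then $\||x|^{1/2}u(\cdot,t)\|^2\ge \mathcal Q_0^-\,t+\||x|^{1/2}u_0\|^2$ for all $t\ge 0$; (b) if $\mathcal Q_0^->8\mathcal E_0^-$, $\beta\ge2|\alpha\gamma|$ and $\||x|u_0\|<\infty$, then for every $\varepsilon>0$ $$\lim_{t\to+\infty}\frac{S(t)}{t^{1-\varepsilon}}=+\infty .$$ -/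

import Mathlib

open MeasureTheory Set Filter Topology
open scoped ENNReal ContDiff

namespace NLSKdV

noncomputable section

/-- Lebesgue measure on the left half-line `ℝ⁻ = (-∞, 0)`. -/
def leftMeasure : Measure ℝ := (volume : Measure ℝ).restrict (Iio 0)

section Sobolev

variable {E : Type*} [NormedAddCommGroup E] [NormedSpace ℝ E]

/-- `g` is the weak (distributional) derivative of `f` on `ℝ⁻`. -/
def HasWeakDeriv (f g : ℝ → E) : Prop :=
  LocallyIntegrableOn f (Iio 0) ∧ LocallyIntegrableOn g (Iio 0) ∧
    ∀ φ : ℝ → ℝ, ContDiff ℝ ∞ φ → HasCompactSupport φ → tsupport φ ⊆ Iio 0 →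
      ∫ x, deriv φ x • f x ∂leftMeasure = -∫ x, φ x • g x ∂leftMeasure

open Classical in
/-- A weak derivative of `f` on `ℝ⁻` (unique up to null sets), and `0` if there is none. -/
def wderiv (f : ℝ → E) : ℝ → E :=
  if h : ∃ g, HasWeakDeriv f g then h.choose else 0

/-- `wderiv f` is a weak derivative of `f` as soon as `f` has one. -/
theorem HasWeakDeriv.wderiv_spec {f g : ℝ → E} (h : HasWeakDeriv f g) :
    HasWeakDeriv f (wderiv f) := by
  have hex : ∃ g, HasWeakDeriv f g := ⟨g, h⟩
  rw [wderiv, dif_pos hex]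
  exact hex.choose_spec

/-- The Sobolev space `H^k(ℝ⁻)`: the weak derivatives of order `≤ k` exist and lie in `L²(ℝ⁻)`. -/
def MemH (k : ℕ) (f : ℝ → E) : Prop :=
  (∀ j ≤ k, MemLp (wderiv^[j] f) 2 leftMeasure) ∧
    ∀ j < k, HasWeakDeriv (wderiv^[j] f) (wderiv^[j + 1] f)

/-- The norm of `H^k(ℝ⁻)`. -/
def hNorm (k : ℕ) (f : ℝ → E) : ℝ≥0∞ :=
  ∑ j ∈ Finset.range (k + 1), eLpNorm (wderiv^[j] f) 2 leftMeasure

/-- The boundary value at `x = 0` of (the representative continuous on `(-∞, 0]` of) `f` is `c`. -/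
def HasTrace (f : ℝ → E) (c : E) : Prop :=
  ∃ g : ℝ → E, ContinuousOn g (Iic 0) ∧ f =ᵐ[leftMeasure] g ∧ g 0 = c

/-- The weighted norm `‖ |x|^a f ‖` in `L²(ℝ⁻)`, with values in `[0, ∞]`. -/
def weightedNorm (a : ℝ) (f : ℝ → E) : ℝ≥0∞ :=
  eLpNorm (fun x => |x| ^ a • f x) 2 leftMeasure

/-- `t ↦ w t` belongs to `C([0, ∞); H^k(ℝ⁻))`. -/
def ContinuousInH (k : ℕ) (w : ℝ → ℝ → E) : Prop :=
  (∀ t, 0 ≤ t → MemH k (w t)) ∧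
    ∀ t, 0 ≤ t → Tendsto (fun s => hNorm k (w s - w t)) (𝓝[Ici 0] t) (𝓝 0)

/-- `w'` is the derivative of `s ↦ w s` at time `t`, in `L²(ℝ⁻)`. -/
def HasTimeDeriv (w : ℝ → ℝ → E) (w' : ℝ → E) (t : ℝ) : Prop :=
  Tendsto (fun s => eLpNorm ((s - t)⁻¹ • (w s - w t) - w') 2 leftMeasure) (𝓝[≠] t) (𝓝 0)

end Sobolev

/-- The momentum `∫ (α/γ v² + 2 Im (u ū_x)) dx` over `ℝ⁻`. -/
def moment (α γ : ℝ) (u : ℝ → ℂ) (v : ℝ → ℝ) : ℝ :=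
  ∫ x, (α / γ * v x ^ 2 + 2 * (u x * (starRingEnd ℂ) (wderiv u x)).im) ∂leftMeasure

/-- The energy `∫ (α v|u|² - α/(6γ) v³ + β/2 |u|⁴ + α/(2γ) v_x² + |u_x|²) dx` over `ℝ⁻`. -/
def energy (α β γ : ℝ) (u : ℝ → ℂ) (v : ℝ → ℝ) : ℝ :=
  ∫ x, (α * v x * ‖u x‖ ^ 2 - α / (6 * γ) * v x ^ 3 + β / 2 * ‖u x‖ ^ 4
    + α / (2 * γ) * wderiv v x ^ 2 + ‖wderiv u x‖ ^ 2) ∂leftMeasure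

/-- `(u, v)` (functions of time, then space) is a global regular solution of the
Schrödinger-Korteweg-de Vries system on `ℝ⁻` with homogeneous boundary conditions and
initial data `(u₀, v₀)`. -/
structure IsGlobalRegularSolution (α β γ : ℝ) (u₀ : ℝ → ℂ) (v₀ : ℝ → ℝ)
    (u : ℝ → ℝ → ℂ) (v : ℝ → ℝ → ℝ) : Prop where
  u_cont : ContinuousInH 2 u
  v_cont : ContinuousInH 3 v
  /-- `i u_t + u_xx = α u v + β u |u|²` -/
  schrodinger : ∀ t, 0 < t → ∃ ut : ℝ → ℂ, HasTimeDeriv u ut t ∧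
    ∀ᵐ x ∂leftMeasure, Complex.I * ut x + (wderiv^[2] (u t)) x
      = α * u t x * v t x + β * u t x * (‖u t x‖ : ℂ) ^ 2
  /-- `v_t + v_xxx + v v_x = γ (|u|²)_x` -/
  kdv : ∀ t, 0 < t → ∃ vt : ℝ → ℝ, HasTimeDeriv v vt t ∧
    ∀ᵐ x ∂leftMeasure, vt x + (wderiv^[3] (v t)) x + v t x * wderiv (v t) x
      = γ * wderiv (fun y => ‖u t y‖ ^ 2) x
  /-- `u(0, t) = 0`, `v(0, t) = 0`, `v_x(0, t) = 0` -/
  u_boundary : ∀ t, 0 ≤ t → HasTrace (u t) 0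
  v_boundary : ∀ t, 0 ≤ t → HasTrace (v t) 0
  vx_boundary : ∀ t, 0 ≤ t → HasTrace (wderiv (v t)) 0
  u_initial : u 0 =ᵐ[leftMeasure] u₀
  v_initial : v 0 =ᵐ[leftMeasure] v₀

/-- `sup` over `s ∈ [0, t]` of `‖|x|^{1/2} u(s)‖² + ‖|x|^{1/2} v(s)‖²`. -/
def weightedSup (u : ℝ → ℝ → ℂ) (v : ℝ → ℝ → ℝ) (t : ℝ) : ℝ≥0∞ :=
  ⨆ s ∈ Icc (0 : ℝ) t, (weightedNorm (1 / 2) (u s) ^ 2 + weightedNorm (1 / 2) (v s) ^ 2)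

end

end NLSKdV

/-!
The argument rests on four integral identities. Write `u = a + i b`, `r = |u|²` and
`J = Im (ū u_x) = a b_x - b a_x`.

* Mass: `r_t = -2 J_x`, hence `d/dt ∫ w r = 2 ∫ w' J` for a weight `w` (`hasDerivAt_mass`).
* Momentum: the coupling terms in the laws of `∫ J` and `∫ v²` (`hasDerivAt_current`,
  `hasDerivAt_kdvMass`) cancel in `Q = (α/γ) ∫ v² - 2 ∫ J`, and only the boundary term
  `Q' = 2 |u_x(0)|² ≥ 0` remains (`momentum_le`).
* Energy: `E' = α/(2γ) v_xx(0)² ≤ 0` as `αγ < 0` (`hasDerivAt_energy`, `energy_le`).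
* Virial: the weighted combination `∫ |x| J - α/(2γ) ∫ |x| v²` has derivative `-∫ X`, where `X`
  contains no coupling other than `α v r` (`hasDerivAt_virial`).

For (a), `d/dt ∫ |x| r = -2 ∫ J = Q - (α/γ) ∫ v² ≥ Q(0)`, because `α/γ < 0` and `Q` is nondecreasing
(`firstMoment_eq`).

For (b), the condition `β ≥ 2 |αγ|` makes the quadratic form in `(r, v)` in the difference of `X` and
twice the energy density semidefinite, and yields `-∫ X ≥ (Q - 8 E)/4 - (1/4) d/dt ∫ |x| r`
(`virial_density_le`, `virial_integral_le`). Since `d/dt ∫ x² r = -4 ∫ |x| J`, integrating twice in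
time and using `∫ x² r ≥ 0` bounds `(Q - 8 E) t² / 2` by a linear function of `t` plus a constant times
`t S(t)` (`virial_inequality`). So `S(t)` grows at least linearly.

The bounds on the weighted norms come from these laws with the weights `|x|`, `x²` replaced by bounded
approximations `cutoff e`, `sqCutoff e`, followed by `e → 0`; for `v`, a Gronwall estimate uniform in
`e` (`exists_kdvFirstMoment_bound`) is used.

The identities have to be justified for solutions whose time derivative exists in `L²` only. The
real and imaginary parts are replaced by absolutely continuous representatives (`HasACDeriv`,
`exists_realSolution`), for which integration by parts on the half-line is elementary
(`HasACDeriv.integral_eq`). The difference quotient of a density such as `J` or `|u_x|²` involves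
difference quotients of space derivatives, which need not converge; up to the space derivative of a
function vanishing at `x = 0`, it is a product of factors converging in `L²`
(`hasDerivAt_integral_of_density`).
-/

namespace NLSKdV

/-! ### Integration on the half-line -/

theorem ae_leftMeasure_iff {p : ℝ → Prop} :
    (∀ᵐ x ∂leftMeasure, p x) ↔ ∀ᵐ x, x < 0 → p x := by
  rw [leftMeasure, ae_restrict_iff' measurableSet_Iio]; rfl

theorem ae_leftMeasure_of_forall {p : ℝ → Prop} (h : ∀ x < 0, p x) : ∀ᵐ x ∂leftMeasure, p x :=
  ae_leftMeasure_iff.2 (Eventually.of_forall h)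

theorem ae_lt_zero : ∀ᵐ x ∂leftMeasure, x < 0 := ae_leftMeasure_of_forall fun _ h => h

theorem integrableOn_Iic_of_integrable {f : ℝ → ℝ} (h : Integrable f leftMeasure) :
    IntegrableOn f (Iic 0) := by
  rw [integrableOn_Iic_iff_integrableOn_Iio]
  exact h

theorem integral_leftMeasure_eq_Iic (f : ℝ → ℝ) :
    ∫ x, f x ∂leftMeasure = ∫ x in Iic 0, f x := by
  rw [integral_Iic_eq_integral_Iio]; rfl

theorem intervalIntegrable_of_memLp {f : ℝ → ℝ} {p : ℝ≥0∞} (hp : 1 ≤ p)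
    (h : MemLp f p leftMeasure) {a : ℝ} (ha : a ≤ 0) : IntervalIntegrable f volume a 0 := by
  rw [intervalIntegrable_iff_integrableOn_Ico_of_le ha]
  have h1 : MemLp f p (volume.restrict (Ico a 0)) :=
    h.mono_measure (Measure.restrict_mono (fun x hx => hx.2) le_rfl)
  exact h1.integrable hp

theorem locallyIntegrableOn_of_memLp {E : Type*} [NormedAddCommGroup E] {f : ℝ → E} {p : ℝ≥0∞}
    (hp : 1 ≤ p) (h : MemLp f p leftMeasure) : LocallyIntegrableOn f (Iio 0) := by
  refine (locallyIntegrableOn_iff isOpen_Iio.isLocallyClosed).2 fun k hk hkc => ?_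
  have h1 : MemLp f p (volume.restrict k) := h.mono_measure (Measure.restrict_mono hk le_rfl)
  have : IsFiniteMeasure (volume.restrict k) := ⟨by
    simpa using hkc.measure_lt_top⟩
  exact h1.integrable hp

/-- A locally integrable function is integrable against a test function. -/
theorem integrable_smul_of_test {E : Type*} [NormedAddCommGroup E] [NormedSpace ℝ E] {f : ℝ → E}
    (hf : LocallyIntegrableOn f (Iio 0)) {φ : ℝ → ℝ} (hφ : Continuous φ)
    (hc : HasCompactSupport φ) (hs : tsupport φ ⊆ Iio 0) :
    Integrable (fun x => φ x • f x) leftMeasure := by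
  have h1 : IntegrableOn f (tsupport φ) :=
    (locallyIntegrableOn_iff isOpen_Iio.isLocallyClosed).1 hf _ hs hc
  have h2 : IntegrableOn (fun x => φ x • f x) (tsupport φ) :=
    h1.continuousOn_smul hφ.continuousOn hc
  have h3 : Integrable (fun x => φ x • f x) := by
    rw [← integrableOn_iff_integrable_of_support_subset (s := tsupport φ)]
    · exact h2
    · intro x hx
      apply subset_tsupport
      intro h0
      exact hx (by simp [h0])
  exact h3.restrict

/-! ### Absolutely continuous functions on the half-line -/

/-- `F` is absolutely continuous on the compact intervals `[a, 0]`, and `f` is its derivative almost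
everywhere on `ℝ⁻`. Such an `F` is the precise representative of a function of class `H¹`; unlike
`HasWeakDeriv`, this notion is stable under products and remembers the value at `0`. -/
structure HasACDeriv (F f : ℝ → ℝ) : Prop where
  ac : ∀ a ≤ 0, AbsolutelyContinuousOnInterval F a 0
  deriv : ∀ᵐ x ∂leftMeasure, HasDerivAt F (f x) x

namespace HasACDeriv

variable {F G f g : ℝ → ℝ}

theorem congr_deriv (h : HasACDeriv F f) (hfg : f =ᵐ[leftMeasure] g) : HasACDeriv F g where
  ac := h.ac
  deriv := by filter_upwards [h.deriv, hfg] with x h1 h2 using h2 ▸ h1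

theorem add (hF : HasACDeriv F f) (hG : HasACDeriv G g) :
    HasACDeriv (fun x => F x + G x) (fun x => f x + g x) where
  ac a ha := (hF.ac a ha).fun_add (hG.ac a ha)
  deriv := by filter_upwards [hF.deriv, hG.deriv] with x h1 h2 using h1.add h2

theorem sub (hF : HasACDeriv F f) (hG : HasACDeriv G g) :
    HasACDeriv (fun x => F x - G x) (fun x => f x - g x) where
  ac a ha := (hF.ac a ha).fun_sub (hG.ac a ha)
  deriv := by filter_upwards [hF.deriv, hG.deriv] with x h1 h2 using h1.sub h2

theorem const_mul (c : ℝ) (hF : HasACDeriv F f) :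
    HasACDeriv (fun x => c * F x) (fun x => c * f x) where
  ac a ha := (hF.ac a ha).const_mul c
  deriv := by filter_upwards [hF.deriv] with x h1 using h1.const_mul c

theorem mul (hF : HasACDeriv F f) (hG : HasACDeriv G g) :
    HasACDeriv (fun x => F x * G x) (fun x => f x * G x + F x * g x) where
  ac a ha := (hF.ac a ha).fun_mul (hG.ac a ha)
  deriv := by filter_upwards [hF.deriv, hG.deriv] with x h1 h2 using h1.mul h2

theorem of_hasDerivAt (h : ∀ x ≤ 0, HasDerivAt F (f x) x) (hf : ContinuousOn f (Iic 0)) :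
    HasACDeriv F f where
  ac a ha := by
    obtain ⟨C, hC⟩ := (isCompact_Icc (a := a) (b := (0 : ℝ))).exists_bound_of_continuousOn
      (hf.mono fun x hx => hx.2)
    rw [← Set.uIcc_of_le ha] at hC
    have hC0 : 0 ≤ C := (norm_nonneg _).trans (hC 0 right_mem_uIcc)
    refine LipschitzOnWith.absolutelyContinuousOnInterval (K := ⟨C, hC0⟩) ?_
    refine (convex_uIcc a 0).lipschitzOnWith_of_nnnorm_hasDerivWithin_le (f' := f)
      (fun x hx => (h x ?_).hasDerivWithinAt) fun x hx => ?_
    · rw [Set.uIcc_of_le ha] at hx; exact hx.2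
    · exact hC x hx
  deriv := ae_leftMeasure_of_forall fun x hx => h x hx.le

theorem const (c : ℝ) : HasACDeriv (fun _ => c) (fun _ => 0) :=
  of_hasDerivAt (fun x _ => hasDerivAt_const x c) continuousOn_const

theorem continuousOn (h : HasACDeriv F f) : ContinuousOn F (Iic 0) := by
  intro x hx
  have h1 := (h.ac (x - 1) (by have : x ≤ 0 := hx; linarith)).continuousOn
  rw [Set.uIcc_of_le (by have : x ≤ 0 := hx; linarith)] at h1
  refine (h1 x ⟨by linarith, hx⟩).mono_of_mem_nhdsWithin ?_
  filter_upwards [self_mem_nhdsWithin,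
    mem_nhdsWithin_of_mem_nhds (Ioi_mem_nhds (show x - 1 < x by linarith))] with y hy hy'
  exact ⟨le_of_lt hy', hy⟩

theorem ae_eq_deriv (h : HasACDeriv F f) : f =ᵐ[leftMeasure] _root_.deriv F := by
  filter_upwards [h.deriv] with x hx using hx.deriv.symm

theorem intervalIntegral_eq (h : HasACDeriv F f) {a : ℝ} (ha : a ≤ 0) :
    ∫ x in a..0, f x = F 0 - F a := by
  rw [← (h.ac a ha).integral_deriv_eq_sub]
  refine intervalIntegral.integral_congr_ae ?_
  have h0 : ∀ᵐ x : ℝ, x ≠ 0 := by simp [ae_iff, measure_singleton]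
  filter_upwards [ae_leftMeasure_iff.1 h.ae_eq_deriv, h0] with x hx hx0 hxI
  rw [Set.uIoc_of_le ha] at hxI
  exact hx (lt_of_le_of_ne hxI.2 hx0)

/-- An integrable absolutely continuous function with integrable derivative tends to `0` at `-∞`, so
that the integral of its derivative is its boundary value. All integrations by parts go through
this. -/
theorem integral_eq (h : HasACDeriv F f) (hF : Integrable F leftMeasure)
    (hf : Integrable f leftMeasure) : ∫ x, f x ∂leftMeasure = F 0 := by
  have h1 := intervalIntegral_tendsto_integral_Iic 0 (integrableOn_Iic_of_integrable hf) tendsto_id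
  rw [← integral_leftMeasure_eq_Iic] at h1
  have h2 : Tendsto F atBot (𝓝 (F 0 - ∫ x, f x ∂leftMeasure)) := by
    refine (h1.const_sub (F 0)).congr' ?_
    filter_upwards [eventually_le_atBot (0 : ℝ)] with a ha
    simp only [id, h.intervalIntegral_eq ha]; ring
  have h3 : F 0 - ∫ x, f x ∂leftMeasure = 0 := by
    by_contra hne
    set L := F 0 - ∫ x, f x ∂leftMeasure with hL
    have hpos : 0 < |L| / 2 := by positivity
    have h4 : ∀ᶠ x in atBot, |L| / 2 < |F x| :=
      h2.abs.eventually (Ioi_mem_nhds (by linarith))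
    obtain ⟨a, ha⟩ := (h4.and (eventually_le_atBot (0 : ℝ))).exists_forall_of_atBot
    have h5 : IntegrableOn F (Iic a) := (integrableOn_Iic_of_integrable hF).mono_set
      (Iic_subset_Iic.2 (ha a le_rfl).2)
    have h6 : IntegrableOn (fun _ : ℝ => |L| / 2) (Iic a) := by
      refine Integrable.mono' h5.norm aestronglyMeasurable_const ?_
      filter_upwards [ae_restrict_mem measurableSet_Iic] with x hx
      rw [Real.norm_of_nonneg hpos.le]
      exact (ha x hx).1.le
    rw [integrableOn_const_iff] at h6
    rcases h6 with h6 | h6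
    · exact hpos.ne' (enorm_eq_zero.1 h6)
    · simp at h6
  linarith

theorem aestronglyMeasurable (h : HasACDeriv F f) : AEStronglyMeasurable F leftMeasure :=
  (h.continuousOn.mono Iio_subset_Iic_self).aestronglyMeasurable measurableSet_Iio

/-- One-dimensional Sobolev inequality. -/
theorem sq_le (h : HasACDeriv F f) (hF : MemLp F 2 leftMeasure) (hf : MemLp f 2 leftMeasure)
    {x : ℝ} (hx : x ≤ 0) : F x ^ 2 ≤ ∫ y, (F y ^ 2 + f y ^ 2) ∂leftMeasure := by
  have hFf : Integrable (fun y => f y * F y) leftMeasure := hf.integrable_mul hF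
  have hFf' : Integrable (fun y => f y * F y + F y * f y) leftMeasure :=
    hFf.add (hF.integrable_mul hf)
  have hFF : Integrable (fun y => F y * F y) leftMeasure := hF.integrable_mul hF
  have h1 := (h.mul h).integral_eq hFF hFf'
  have h2 := (h.mul h).intervalIntegral_eq hx
  rw [integral_leftMeasure_eq_Iic] at h1
  have hI := integrableOn_Iic_of_integrable hFf'
  have h3 := intervalIntegral.integral_Iic_sub_Iic (hI.mono_set (Iic_subset_Iic.2 hx)) hI
  have hsq : Integrable (fun y => F y ^ 2 + f y ^ 2) leftMeasure :=
    hF.integrable_sq.add hf.integrable_sq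
  have hsq' := integrableOn_Iic_of_integrable hsq
  rw [integral_leftMeasure_eq_Iic]
  calc F x ^ 2 = ∫ y in Iic x, (f y * F y + F y * f y) := by rw [h2, h1] at h3; linarith
    _ ≤ ∫ y in Iic x, (F y ^ 2 + f y ^ 2) := by
        refine integral_mono (hI.mono_set (Iic_subset_Iic.2 hx))
          (hsq'.mono_set (Iic_subset_Iic.2 hx)) fun y => ?_
        nlinarith [sq_nonneg (F y - f y)]
    _ ≤ _ := setIntegral_mono_set hsq' (Eventually.of_forall fun y => by positivity)
        (Iic_subset_Iic.2 hx).eventuallyLE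

end HasACDeriv

theorem ofReal_integral_sq {f : ℝ → ℝ} (hf : MemLp f 2 leftMeasure) :
    ENNReal.ofReal (∫ x, f x ^ 2 ∂leftMeasure) = eLpNorm f 2 leftMeasure ^ 2 := by
  rw [ofReal_integral_eq_lintegral_ofReal hf.integrable_sq
    (Eventually.of_forall fun x => sq_nonneg _),
    eLpNorm_eq_lintegral_rpow_enorm_toReal (by simp) (by simp), ← ENNReal.rpow_natCast,
    ← ENNReal.rpow_mul]
  simp only [ENNReal.toReal_ofNat, Nat.cast_ofNat, one_div]
  norm_num
  refine lintegral_congr fun x => ?_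
  rw [← ofReal_norm, ← ENNReal.ofReal_pow (norm_nonneg _)]
  simp

/-- Sobolev embedding `H¹ ⊆ L^∞` with its norm inequality. -/
theorem HasACDeriv.eLpNorm_top_le {F f : ℝ → ℝ} (h : HasACDeriv F f)
    (hF : MemLp F 2 leftMeasure) (hf : MemLp f 2 leftMeasure) :
    eLpNorm F ∞ leftMeasure ≤ eLpNorm F 2 leftMeasure + eLpNorm f 2 leftMeasure := by
  rw [eLpNorm_exponent_top]
  refine eLpNormEssSup_le_of_ae_enorm_bound (ae_leftMeasure_of_forall fun x hx => ?_)
  have h1 := h.sq_le hF hf hx.le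
  have h2 : ‖F x‖ₑ ^ 2 ≤ (eLpNorm F 2 leftMeasure + eLpNorm f 2 leftMeasure) ^ 2 := by
    calc ‖F x‖ₑ ^ 2 = ENNReal.ofReal (F x ^ 2) := by
          rw [← ofReal_norm, ← ENNReal.ofReal_pow (norm_nonneg _)]; simp
      _ ≤ ENNReal.ofReal (∫ y, (F y ^ 2 + f y ^ 2) ∂leftMeasure) := ENNReal.ofReal_le_ofReal h1
      _ = eLpNorm F 2 leftMeasure ^ 2 + eLpNorm f 2 leftMeasure ^ 2 := by
          rw [integral_add hF.integrable_sq hf.integrable_sq, ENNReal.ofReal_add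
            (integral_nonneg fun _ => sq_nonneg _) (integral_nonneg fun _ => sq_nonneg _),
            ofReal_integral_sq hF, ofReal_integral_sq hf]
      _ ≤ _ := by
          rw [add_sq]
          gcongr
          exact le_self_add
  exact (ENNReal.pow_le_pow_left_iff (by norm_num)).1 h2

theorem HasACDeriv.memLp_top {F f : ℝ → ℝ} (h : HasACDeriv F f)
    (hF : MemLp F 2 leftMeasure) (hf : MemLp f 2 leftMeasure) : MemLp F ∞ leftMeasure :=
  ⟨hF.1, (h.eLpNorm_top_le hF hf).trans_lt (ENNReal.add_lt_top.2 ⟨hF.2, hf.2⟩)⟩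

/-! ### Weak derivatives and absolutely continuous representatives -/

theorem locallyIntegrableOn_congr_ae {E : Type*} [NormedAddCommGroup E] {f f' : ℝ → E}
    (h : LocallyIntegrableOn f (Iio 0))
    (hf : f =ᵐ[leftMeasure] f') : LocallyIntegrableOn f' (Iio 0) := by
  rw [locallyIntegrableOn_iff isOpen_Iio.isLocallyClosed] at h ⊢
  exact fun k hk hkc => (h k hk hkc).congr_fun_ae (ae_mono (Measure.restrict_mono hk le_rfl) hf)

section WeakDeriv

variable {E : Type*} [NormedAddCommGroup E] [NormedSpace ℝ E] {f f' g g' : ℝ → E}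

theorem HasWeakDeriv.congr (h : HasWeakDeriv f g) (hf : f =ᵐ[leftMeasure] f')
    (hg : g =ᵐ[leftMeasure] g') : HasWeakDeriv f' g' := by
  refine ⟨locallyIntegrableOn_congr_ae h.1 hf, locallyIntegrableOn_congr_ae h.2.1 hg,
    fun φ h1 h2 h3 => ?_⟩
  have h4 : ∫ x, deriv φ x • f' x ∂leftMeasure = ∫ x, deriv φ x • f x ∂leftMeasure :=
    integral_congr_ae (by filter_upwards [hf] with x hx using by rw [hx])
  have h5 : ∫ x, φ x • g' x ∂leftMeasure = ∫ x, φ x • g x ∂leftMeasure :=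
    integral_congr_ae (by filter_upwards [hg] with x hx using by rw [hx])
  rw [h4, h5, h.2.2 φ h1 h2 h3]

theorem tsupport_deriv_subset_Iio {φ : ℝ → ℝ} (h : tsupport φ ⊆ Iio 0) :
    tsupport (deriv φ) ⊆ Iio 0 :=
  (closure_minimal (support_deriv_subset (f := φ)) (isClosed_tsupport _)).trans h

theorem HasWeakDeriv.sub (h : HasWeakDeriv f g) (h' : HasWeakDeriv f' g') :
    HasWeakDeriv (f - f') (g - g') := by
  refine ⟨h.1.sub h'.1, h.2.1.sub h'.2.1, fun φ h1 h2 h3 => ?_⟩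
  have hd : Continuous (deriv φ) := (contDiff_infty_iff_deriv.1 h1).2.continuous
  have hds := tsupport_deriv_subset_Iio h3
  simp only [Pi.sub_apply, smul_sub]
  rw [integral_sub (integrable_smul_of_test h.1 hd h2.deriv hds)
      (integrable_smul_of_test h'.1 hd h2.deriv hds),
    integral_sub (integrable_smul_of_test h.2.1 h1.continuous h2 h3)
      (integrable_smul_of_test h'.2.1 h1.continuous h2 h3), h.2.2 φ h1 h2 h3, h'.2.2 φ h1 h2 h3]
  abel

theorem HasWeakDeriv.clm_comp {F : Type*} [NormedAddCommGroup F] [NormedSpace ℝ F]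
    [CompleteSpace E] [CompleteSpace F] (L : E →L[ℝ] F) (h : HasWeakDeriv f g) :
    HasWeakDeriv (fun x => L (f x)) (fun x => L (g x)) := by
  have hL : ∀ {k : ℝ → E}, LocallyIntegrableOn k (Iio 0) →
      LocallyIntegrableOn (fun x => L (k x)) (Iio 0) := by
    intro k hk
    rw [locallyIntegrableOn_iff isOpen_Iio.isLocallyClosed] at hk ⊢
    exact fun s hs hsc => L.integrable_comp (hk s hs hsc)
  refine ⟨hL h.1, hL h.2.1, fun φ h1 h2 h3 => ?_⟩
  have hd : Continuous (deriv φ) := (contDiff_infty_iff_deriv.1 h1).2.continuous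
  have hds := tsupport_deriv_subset_Iio h3
  simp only [← map_smul]
  rw [L.integral_comp_comm (integrable_smul_of_test h.1 hd h2.deriv hds),
    L.integral_comp_comm (integrable_smul_of_test h.2.1 h1.continuous h2 h3),
    h.2.2 φ h1 h2 h3, map_neg]

theorem ae_eq_zero_of_integral_test [CompleteSpace E] (hf : LocallyIntegrableOn f (Iio 0))
    (h : ∀ φ : ℝ → ℝ, ContDiff ℝ ∞ φ → HasCompactSupport φ → tsupport φ ⊆ Iio 0 →
      ∫ x, φ x • f x ∂leftMeasure = 0) : f =ᵐ[leftMeasure] 0 := by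
  refine ae_leftMeasure_iff.2 (isOpen_Iio.ae_eq_zero_of_integral_contDiff_smul_eq_zero hf
    fun φ h1 h2 h3 => ?_)
  rw [← h φ h1 h2 h3, leftMeasure, setIntegral_eq_integral_of_forall_compl_eq_zero]
  intro x hx
  have : φ x = 0 := by
    by_contra h0
    exact hx (h3 (subset_tsupport φ h0))
  simp [this]

theorem HasWeakDeriv.ae_unique [CompleteSpace E] (h : HasWeakDeriv f g)
    (h' : HasWeakDeriv f g') : g =ᵐ[leftMeasure] g' := by
  have := ae_eq_zero_of_integral_test (h.2.1.sub h'.2.1) fun φ h1 h2 h3 => by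
    simp only [Pi.sub_apply, smul_sub]
    rw [integral_sub (integrable_smul_of_test h.2.1 h1.continuous h2 h3)
      (integrable_smul_of_test h'.2.1 h1.continuous h2 h3), ← neg_inj, neg_sub, neg_zero]
    have e1 := h.2.2 φ h1 h2 h3
    have e2 := h'.2.2 φ h1 h2 h3
    rw [e1, neg_inj] at e2
    rw [e2, sub_self]
  filter_upwards [this] with x hx
  exact sub_eq_zero.1 hx

theorem HasWeakDeriv.wderiv_ae_eq [CompleteSpace E] (h : HasWeakDeriv f g) :
    wderiv f =ᵐ[leftMeasure] g :=
  h.wderiv_spec.ae_unique h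

theorem MemH.wderiv_iterate_sub [CompleteSpace E] {k : ℕ} (hf : MemH k f) (hg : MemH k g) :
    ∀ j ≤ k, wderiv^[j] (f - g) =ᵐ[leftMeasure] wderiv^[j] f - wderiv^[j] g := by
  intro j
  induction j with
  | zero => intro _; rfl
  | succ j ih =>
    intro hj
    have h1 := (hf.2 j hj).sub (hg.2 j hj)
    have h2 := h1.congr (ih (by omega)).symm (ae_eq_refl _)
    have h3 := h2.wderiv_ae_eq
    rw [Function.iterate_succ_apply']
    exact h3

/-- du Bois-Reymond: a function whose weak derivative vanishes is constant. -/
theorem ae_const_of_integral_deriv_test {f : ℝ → ℝ} (hf : LocallyIntegrableOn f (Iio 0))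
    (h : ∀ φ : ℝ → ℝ, ContDiff ℝ ∞ φ → HasCompactSupport φ → tsupport φ ⊆ Iio 0 →
      ∫ x, deriv φ x • f x ∂leftMeasure = 0) : ∃ c, f =ᵐ[leftMeasure] fun _ => c := by
  let B : ContDiffBump (-2 : ℝ) := ⟨1 / 2, 1, by norm_num, by norm_num⟩
  set η : ℝ → ℝ := B.normed volume with hη
  have hη1 : ContDiff ℝ ∞ η := B.contDiff_normed
  have hη2 : HasCompactSupport η := B.hasCompactSupport_normed
  have hη3 : tsupport η ⊆ Iio 0 := by
    rw [hη, B.tsupport_normed_eq]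
    intro x hx
    have hx' : |x - -2| ≤ 1 := by simpa [Real.dist_eq, B] using hx
    have := (abs_le.1 hx').2
    show x < 0
    linarith
  have hη4 : ∫ x, η x = 1 := B.integral_normed
  set c := ∫ x, η x • f x ∂leftMeasure with hc
  refine ⟨c, ?_⟩
  have key := ae_eq_zero_of_integral_test (f := fun x => f x - c)
    (hf.sub (continuousOn_const.locallyIntegrableOn measurableSet_Iio)) fun ψ h1 h2 h3 => ?_
  · filter_upwards [key] with x hx
    exact sub_eq_zero.1 hx
  -- the primitive of `ψ - (∫ ψ) η` is again a test function
  set m := ∫ x, ψ x with hm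
  set ρ : ℝ → ℝ := fun x => ψ x - m * η x with hρ
  have hρ1 : ContDiff ℝ ∞ ρ := h1.sub (contDiff_const.mul hη1)
  have hρ2 : HasCompactSupport ρ := h2.sub hη2.mul_left
  have hρ3 : tsupport ρ ⊆ Iio 0 := by
    refine (tsupport_sub ψ (fun x => m * η x)).trans (union_subset h3 ?_)
    exact (closure_mono (Function.support_mul_subset_right (fun _ => m) η)).trans hη3
  have hρi : Integrable ρ := hρ1.continuous.integrable_of_hasCompactSupport hρ2
  have hψi : Integrable ψ := h1.continuous.integrable_of_hasCompactSupport h2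
  have hηi : Integrable η := hη1.continuous.integrable_of_hasCompactSupport hη2
  have hρ0 : ∫ x, ρ x = 0 := by
    rw [hρ, integral_sub hψi (hηi.const_mul m), integral_const_mul, hη4, hm]; ring
  have hvan : ∀ x, 0 ≤ x → ρ x = 0 := fun x hx => by
    by_contra h0
    exact absurd (hρ3 (subset_tsupport ρ h0)) (not_lt.2 hx)
  set φ : ℝ → ℝ := fun x => ∫ y in (0 : ℝ)..x, ρ y with hφ
  have hφd : ∀ x, HasDerivAt φ (ρ x) x := fun x =>
    intervalIntegral.integral_hasDerivAt_right (hρ1.continuous.intervalIntegrable _ _)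
      hρ1.continuous.stronglyMeasurable.stronglyMeasurableAtFilter hρ1.continuous.continuousAt
  have hφ' : deriv φ = ρ := funext fun x => (hφd x).deriv
  have hφ1 : ContDiff ℝ ∞ φ := contDiff_infty_iff_deriv.2
    ⟨fun x => (hφd x).differentiableAt, hφ' ▸ hρ1⟩
  have hsub : ∃ a b : ℝ, b < 0 ∧ tsupport ρ ⊆ Icc a b := by
    rcases (tsupport ρ).eq_empty_or_nonempty with he | hne
    · exact ⟨-2, -1, by norm_num, by rw [he]; exact empty_subset _⟩
    · obtain ⟨b, hb, hb'⟩ := hρ2.isCompact.exists_isGreatest hne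
      obtain ⟨a, ha, ha'⟩ := hρ2.isCompact.exists_isLeast hne
      exact ⟨a, b, hρ3 hb, fun x hx => ⟨ha' hx, hb' hx⟩⟩
  obtain ⟨a, b, hb, hab⟩ := hsub
  have hout : ∀ x, x ∉ Icc a b → φ x = 0 := by
    intro x hx
    have hz : ∀ y, y ∉ Icc a b → ρ y = 0 := fun y hy => by
      by_contra h0
      exact hy (hab (subset_tsupport ρ h0))
    rcases lt_or_ge x a with hxa | hxa
    · rcases le_total 0 x with hx0 | hx0
      · refine intervalIntegral.integral_zero_ae (Eventually.of_forall fun y hy => hvan y ?_)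
        rw [Set.uIoc_of_le hx0] at hy
        exact hy.1.le
      · rw [hφ]
        simp only
        rw [intervalIntegral.integral_symm, intervalIntegral.integral_of_le hx0,
          setIntegral_eq_integral_of_forall_compl_eq_zero, hρ0, neg_zero]
        intro y hy
        by_cases hy0 : 0 < y
        · exact hvan y hy0.le
        · have : y ≤ x := by
            by_contra h'
            exact hy ⟨not_le.1 h', not_lt.1 hy0⟩
          exact hz y fun h' => absurd h'.1 (not_le.2 (this.trans_lt hxa))
    · have hxb : b < x := by
        by_contra h'
        exact hx ⟨hxa, not_lt.1 h'⟩
      refine intervalIntegral.integral_zero_ae (Eventually.of_forall fun y hy => ?_)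
      refine hz y fun h' => ?_
      rcases le_total 0 x with hx0 | hx0
      · rw [Set.uIoc_of_le hx0] at hy
        linarith [hy.1, h'.2]
      · rw [Set.uIoc_of_ge hx0] at hy
        linarith [hy.1, h'.2]
  have hts : tsupport φ ⊆ Icc a b := closure_minimal
    (fun x hx => by
      by_contra h'
      exact hx (hout x h')) isClosed_Icc
  have h5 := h φ hφ1 (isCompact_Icc.of_isClosed_subset (isClosed_tsupport φ) hts)
    (hts.trans fun x hx => hx.2.trans_lt hb)
  have i1 := integrable_smul_of_test hf h1.continuous h2 h3
  have i2 := integrable_smul_of_test hf hη1.continuous hη2 hη3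
  have e1 : ∫ x, deriv φ x • f x ∂leftMeasure = (∫ x, ψ x • f x ∂leftMeasure) - m * c := by
    rw [hc, ← integral_const_mul, ← integral_sub i1 (i2.const_mul m)]
    refine integral_congr_ae (Eventually.of_forall fun x => ?_)
    simp only [hφ', hρ, smul_eq_mul]; ring
  have e2 : ∫ x, ψ x ∂leftMeasure = m := by
    rw [hm, leftMeasure, setIntegral_eq_integral_of_forall_compl_eq_zero]
    intro x hx
    by_contra h0
    exact hx (h3 (subset_tsupport ψ h0))
  have hψl : Integrable ψ leftMeasure := hψi.restrict
  calc ∫ x, ψ x • (f x - c) ∂leftMeasure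
      = (∫ x, ψ x • f x ∂leftMeasure) - ∫ x, ψ x * c ∂leftMeasure := by
        rw [← integral_sub i1 (hψl.mul_const c)]
        refine integral_congr_ae (Eventually.of_forall fun x => ?_)
        simp only [smul_eq_mul]; ring
    _ = 0 := by rw [integral_mul_const, e2, ← e1, h5]

end WeakDeriv

variable {F f g : ℝ → ℝ}

theorem HasACDeriv.hasWeakDeriv (h : HasACDeriv F f) (hf : LocallyIntegrableOn f (Iio 0)) :
    HasWeakDeriv F f := by
  have hF : LocallyIntegrableOn F (Iio 0) :=
    (h.continuousOn.mono Iio_subset_Iic_self).locallyIntegrableOn measurableSet_Iio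
  refine ⟨hF, hf, fun φ h1 h2 h3 => ?_⟩
  have hd : Continuous (_root_.deriv φ) := (contDiff_infty_iff_deriv.1 h1).2.continuous
  have hds := tsupport_deriv_subset_Iio h3
  have hφ : HasACDeriv φ (_root_.deriv φ) := .of_hasDerivAt
    (fun x _ => ((contDiff_infty_iff_deriv.1 h1).1 x).hasDerivAt) hd.continuousOn
  have i1 := integrable_smul_of_test hF hd h2.deriv hds
  have i2 := integrable_smul_of_test hf h1.continuous h2 h3
  have h4 := (hφ.mul h).integral_eq (integrable_smul_of_test hF h1.continuous h2 h3) (i1.add i2)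
  have h5 : φ 0 = 0 := by
    by_contra h0
    exact lt_irrefl (0 : ℝ) (h3 (subset_tsupport φ h0))
  rw [h5, zero_mul] at h4
  rw [eq_neg_iff_add_eq_zero, ← integral_add i1 i2]
  exact h4

/-- Lebesgue's differentiation theorem for the primitive based at `0`. -/
theorem hasACDeriv_primitive (hf : MemLp f 2 leftMeasure) :
    HasACDeriv (fun x => ∫ y in (0 : ℝ)..x, f y) f where
  ac a ha := (intervalIntegrable_of_memLp (by norm_num) hf ha
    ).absolutelyContinuousOnInterval_intervalIntegral right_mem_uIcc
  deriv := by
    have h : ∀ n : ℕ, ∀ᵐ x : ℝ, x ∈ uIcc (-(n : ℝ)) 0 → ∀ c ∈ uIcc (-(n : ℝ)) 0,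
        HasDerivAt (fun x => ∫ y in c..x, f y) (f x) x := fun n =>
      (intervalIntegrable_of_memLp (by norm_num) hf (by simp)).ae_hasDerivAt_integral
    rw [ae_leftMeasure_iff]
    filter_upwards [ae_all_iff.2 h] with x hx hx0
    obtain ⟨n, hn⟩ := exists_nat_ge (-x)
    refine hx n ?_ 0 right_mem_uIcc
    rw [Set.uIcc_of_le (by simp)]
    exact ⟨by linarith, hx0.le⟩

/-- A function with a square integrable weak derivative has an absolutely continuous
representative. -/
theorem HasWeakDeriv.exists_hasACDeriv (h : HasWeakDeriv f g) (hg : MemLp g 2 leftMeasure) :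
    ∃ F, HasACDeriv F g ∧ f =ᵐ[leftMeasure] F := by
  have h1 := hasACDeriv_primitive hg
  have h2 := h1.hasWeakDeriv h.2.1
  have h3 := h.sub h2
  obtain ⟨c, hc⟩ := ae_const_of_integral_deriv_test h3.1 fun φ p1 p2 p3 => by
    rw [h3.2.2 φ p1 p2 p3]; simp
  refine ⟨_, ((HasACDeriv.const c).add h1).congr_deriv (by simp), ?_⟩
  filter_upwards [hc] with x hx
  simp only [Pi.sub_apply] at hx
  linarith

/-- The trace at `0` is the value at `0` of any representative continuous up to the boundary. -/
theorem HasTrace.eq_of_continuousOn {E : Type*} [NormedAddCommGroup E] {f F : ℝ → E} {c : E}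
    (h : HasTrace f c) (hF : ContinuousOn F (Iic 0)) (hfF : f =ᵐ[leftMeasure] F) : F 0 = c := by
  obtain ⟨g, hg, hfg, rfl⟩ := h
  have h1 : F =ᵐ[volume.restrict (Iio 0)] g := hfF.symm.trans hfg
  have h2 : EqOn F g (Iio 0) := Measure.eqOn_open_of_ae_eq h1 isOpen_Iio
    (hF.mono Iio_subset_Iic_self) (hg.mono Iio_subset_Iic_self)
  have h3 : EqOn F g (closure (Iio 0)) := by
    refine h2.of_subset_closure ?_ ?_ subset_closure le_rfl <;> rwa [closure_Iio]
  rw [closure_Iio] at h3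
  exact h3 (mem_Iic.2 le_rfl)

/-! ### Convergence in `L^p` on the half-line -/

/-- `F s` converges to `f` in `L^p(ℝ⁻)` along `l`. -/
structure LpTendsto (p : ℝ≥0∞) (l : Filter ℝ) (F : ℝ → ℝ → ℝ) (f : ℝ → ℝ) : Prop where
  eventually_memLp : ∀ᶠ s in l, MemLp (F s) p leftMeasure
  memLp : MemLp f p leftMeasure
  tendsto : Tendsto (fun s => eLpNorm (F s - f) p leftMeasure) l (𝓝 0)

namespace LpTendsto

variable {p q r : ℝ≥0∞} {l l' : Filter ℝ} {F G : ℝ → ℝ → ℝ} {f g : ℝ → ℝ}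

theorem mono_left (h : LpTendsto p l F f) (hl : l' ≤ l) : LpTendsto p l' F f :=
  ⟨h.1.filter_mono hl, h.2, h.3.mono_left hl⟩

theorem const (h : MemLp f p leftMeasure) : LpTendsto p l (fun _ x => f x) f :=
  ⟨Eventually.of_forall fun _ => h, h, by
    have : (fun x => f x) - f = 0 := sub_self f
    simp only [this, eLpNorm_zero]; exact tendsto_const_nhds⟩

theorem add [hp : Fact (1 ≤ p)] (hF : LpTendsto p l F f) (hG : LpTendsto p l G g) :
    LpTendsto p l (fun s x => F s x + G s x) (fun x => f x + g x) := by
  refine ⟨?_, hF.2.add hG.2, ?_⟩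
  · filter_upwards [hF.1, hG.1] with s h1 h2 using h1.add h2
  · have h0 := hF.3.add hG.3
    rw [add_zero] at h0
    refine tendsto_of_tendsto_of_tendsto_of_le_of_le' tendsto_const_nhds h0
      (Eventually.of_forall fun _ => zero_le) ?_
    filter_upwards [hF.1, hG.1] with s h1 h2
    have : (fun x => F s x + G s x) - (fun x => f x + g x) = (F s - f) + (G s - g) := by
      ext x; simp only [Pi.sub_apply, Pi.add_apply]; ring
    rw [this]
    exact eLpNorm_add_le (h1.1.sub hF.2.1) (h2.1.sub hG.2.1) hp.1

theorem const_mul (c : ℝ) (hF : LpTendsto p l F f) :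
    LpTendsto p l (fun s x => c * F s x) (fun x => c * f x) := by
  refine ⟨?_, hF.2.const_mul c, ?_⟩
  · filter_upwards [hF.1] with s h1 using h1.const_mul c
  · have h0 := ENNReal.Tendsto.const_mul (a := ‖c‖ₑ) hF.3 (Or.inr enorm_ne_top)
    rw [mul_zero] at h0
    refine h0.congr fun s => ?_
    have : (fun x => c * F s x) - (fun x => c * f x) = c • (F s - f) := by
      ext x; simp only [Pi.sub_apply, Pi.smul_apply, smul_eq_mul]; ring
    rw [this, eLpNorm_const_smul]

theorem neg (hF : LpTendsto p l F f) : LpTendsto p l (fun s x => -F s x) (fun x => -f x) := by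
  simpa only [neg_one_mul] using hF.const_mul (-1)

theorem sub [Fact (1 ≤ p)] (hF : LpTendsto p l F f) (hG : LpTendsto p l G g) :
    LpTendsto p l (fun s x => F s x - G s x) (fun x => f x - g x) := by
  simpa only [← sub_eq_add_neg] using hF.add hG.neg

/-- Hölder's inequality makes products continuous. -/
theorem mul (hr : 1 ≤ r) [ENNReal.HolderTriple p q r] (hF : LpTendsto p l F f)
    (hG : LpTendsto q l G g) : LpTendsto r l (fun s x => F s x * G s x) (fun x => f x * g x) := by
  refine ⟨?_, hG.2.mul' hF.2, ?_⟩
  · filter_upwards [hF.1, hG.1] with s h1 h2 using h2.mul' h1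
  · have key : ∀ {φ ψ : ℝ → ℝ}, MemLp φ p leftMeasure → MemLp ψ q leftMeasure →
        eLpNorm (φ * ψ) r leftMeasure ≤ eLpNorm φ p leftMeasure * eLpNorm ψ q leftMeasure :=
      fun h1 h2 => by
        have := eLpNorm_smul_le_mul_eLpNorm (p := p) (q := q) (r := r) h2.1 h1.1
        rwa [smul_eq_mul] at this
    have h1 := ENNReal.Tendsto.mul hF.3 (Or.inr ENNReal.zero_ne_top) hG.3
      (Or.inr ENNReal.zero_ne_top)
    have h2 := ENNReal.Tendsto.const_mul (a := eLpNorm f p leftMeasure) hG.3 (Or.inr hF.2.2.ne)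
    have h3 := ENNReal.Tendsto.mul_const (b := eLpNorm g q leftMeasure) hF.3 (Or.inr hG.2.2.ne)
    have h0 := (h1.add h2).add h3
    simp only [mul_zero, zero_mul, add_zero] at h0
    refine tendsto_of_tendsto_of_tendsto_of_le_of_le' tendsto_const_nhds h0
      (Eventually.of_forall fun _ => zero_le) ?_
    filter_upwards [hF.1, hG.1] with s m1 m2
    have e : (fun x => F s x * G s x) - (fun x => f x * g x)
        = (F s - f) * (G s - g) + f * (G s - g) + (F s - f) * g := by
      ext x; simp only [Pi.sub_apply, Pi.add_apply, Pi.mul_apply]; ring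
    have n1 := m1.sub hF.2
    have n2 := m2.sub hG.2
    rw [e]
    refine (eLpNorm_add_le ((n1.1.mul n2.1).add (hF.2.1.mul n2.1)) (n1.1.mul hG.2.1) hr).trans ?_
    gcongr
    · refine (eLpNorm_add_le (n1.1.mul n2.1) (hF.2.1.mul n2.1) hr).trans ?_
      exact add_le_add (key n1 n2) (key hF.2 n2)
    · exact key n1 hG.2

theorem top_mul_top (hF : LpTendsto ∞ l F f) (hG : LpTendsto ∞ l G g) :
    LpTendsto ∞ l (fun s x => F s x * G s x) (fun x => f x * g x) := hF.mul (by simp) hG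

theorem top_mul_two (hF : LpTendsto ∞ l F f) (hG : LpTendsto 2 l G g) :
    LpTendsto 2 l (fun s x => F s x * G s x) (fun x => f x * g x) := hF.mul (by norm_num) hG

theorem two_mul_top (hF : LpTendsto 2 l F f) (hG : LpTendsto ∞ l G g) :
    LpTendsto 2 l (fun s x => F s x * G s x) (fun x => f x * g x) := hF.mul (by norm_num) hG

theorem two_mul_two (hF : LpTendsto 2 l F f) (hG : LpTendsto 2 l G g) :
    LpTendsto 1 l (fun s x => F s x * G s x) (fun x => f x * g x) := hF.mul le_rfl hG

theorem top_mul_one (hF : LpTendsto ∞ l F f) (hG : LpTendsto 1 l G g) :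
    LpTendsto 1 l (fun s x => F s x * G s x) (fun x => f x * g x) := hF.mul le_rfl hG

theorem integrable (h : LpTendsto 1 l F f) : Integrable f leftMeasure :=
  memLp_one_iff_integrable.1 h.2

theorem eventually_integrable (h : LpTendsto 1 l F f) :
    ∀ᶠ s in l, Integrable (F s) leftMeasure :=
  h.1.mono fun _ => memLp_one_iff_integrable.1

theorem tendsto_integral (h : LpTendsto 1 l F f) :
    Tendsto (fun s => ∫ x, F s x ∂leftMeasure) l (𝓝 (∫ x, f x ∂leftMeasure)) := by
  refine tendsto_integral_of_L1 f h.integrable.1 h.eventually_integrable ?_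
  refine h.3.congr fun s => ?_
  rw [eLpNorm_one_eq_lintegral_enorm]
  rfl

theorem hasDerivAt_integral {H : ℝ → ℝ → ℝ} {h : ℝ → ℝ} {Φ : ℝ → ℝ} {t : ℝ}
    (hH : LpTendsto 1 (𝓝[≠] t) H h)
    (hΦ : ∀ᶠ s in 𝓝[≠] t, (s - t)⁻¹ * (Φ s - Φ t) = ∫ x, H s x ∂leftMeasure) :
    HasDerivAt Φ (∫ x, h x ∂leftMeasure) t := by
  rw [hasDerivAt_iff_tendsto_slope]
  refine hH.tendsto_integral.congr' ?_
  filter_upwards [hΦ] with s hs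
  rw [← hs, slope_def_field]
  ring

end LpTendsto

theorem HasACDeriv.lpTendsto_top {l : Filter ℝ} {F F' : ℝ → ℝ → ℝ} {f f' : ℝ → ℝ}
    (hF : ∀ᶠ s in l, HasACDeriv (F s) (F' s)) (hf : HasACDeriv f f')
    (h : LpTendsto 2 l F f) (h' : LpTendsto 2 l F' f') : LpTendsto ∞ l F f := by
  refine ⟨?_, hf.memLp_top h.2 h'.2, ?_⟩
  · filter_upwards [hF, h.1, h'.1] with s h1 h2 h3 using h1.memLp_top h2 h3
  · have h0 := h.3.add h'.3
    rw [add_zero] at h0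
    refine tendsto_of_tendsto_of_tendsto_of_le_of_le' tendsto_const_nhds h0
      (Eventually.of_forall fun _ => zero_le) ?_
    filter_upwards [hF, h.1, h'.1] with s h1 h2 h3
    exact (h1.sub hf).eLpNorm_top_le (h2.sub h.2) (h3.sub h'.2)

/-- Integration by parts: integrands that differ by a derivative have integrals that differ by a
boundary value. -/
theorem HasACDeriv.integral_eq_add {D d X Y : ℝ → ℝ} (hD : HasACDeriv D d)
    (hDi : Integrable D leftMeasure) (hX : Integrable X leftMeasure)
    (hY : Integrable Y leftMeasure) (h : ∀ x, X x = Y x + d x) :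
    ∫ x, X x ∂leftMeasure = ∫ x, Y x ∂leftMeasure + D 0 := by
  have hd : Integrable d leftMeasure := (hX.sub hY).congr
    (Eventually.of_forall fun x => by simp [h x])
  rw [← hD.integral_eq hDi hd, ← integral_add hY hd]
  exact integral_congr_ae (Eventually.of_forall h)

/-- Differentiation of `s ↦ ∫ f s` when the difference quotient of the density converges in `L¹`
only up to the derivative of a function vanishing at the boundary. -/
theorem hasDerivAt_integral_of_density {t : ℝ} {f H D d : ℝ → ℝ → ℝ} {h e : ℝ → ℝ}
    (hf : LpTendsto 1 (𝓝[≠] t) f (f t)) (hH : LpTendsto 1 (𝓝[≠] t) H h)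
    (hD : ∀ᶠ s in 𝓝[≠] t, HasACDeriv (D s) (d s)) (hDi : LpTendsto 1 (𝓝[≠] t) D e)
    (hD0 : ∀ᶠ s in 𝓝[≠] t, D s 0 = 0)
    (heq : ∀ s x, (s - t)⁻¹ * (f s x - f t x) = H s x + (s - t)⁻¹ * d s x) :
    HasDerivAt (fun s => ∫ x, f s x ∂leftMeasure) (∫ x, h x ∂leftMeasure) t := by
  refine hH.hasDerivAt_integral ?_
  filter_upwards [hf.eventually_integrable, hH.eventually_integrable, hD,
    hDi.eventually_integrable, hD0] with s h1 h2 h3 h4 h5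
  have h6 : Integrable (fun x => (s - t)⁻¹ * (f s x - f t x)) leftMeasure :=
    (h1.sub hf.integrable).const_mul _
  rw [← integral_sub h1 hf.integrable, ← integral_const_mul,
    (h3.const_mul (s - t)⁻¹).integral_eq_add (h4.const_mul _) h6 h2 (heq s)]
  simp [h5]

/-! ### The system in real coordinates -/

/-- `w` is a continuous curve in `H¹(ℝ⁻)`, made of absolutely continuous representatives, with
space derivative `w'`. -/
structure H1Curve (w w' : ℝ → ℝ → ℝ) : Prop where
  ac : ∀ t, 0 ≤ t → HasACDeriv (w t) (w' t)
  cont : ∀ t, 0 ≤ t → LpTendsto 2 (𝓝[Ici 0] t) w (w t)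
  cont_deriv : ∀ t, 0 ≤ t → LpTendsto 2 (𝓝[Ici 0] t) w' (w' t)

theorem H1Curve.cont_top {w w' : ℝ → ℝ → ℝ} (h : H1Curve w w') (t : ℝ) (ht : 0 ≤ t) :
    LpTendsto ∞ (𝓝[Ici 0] t) w (w t) := by
  refine HasACDeriv.lpTendsto_top ?_ (h.ac t ht) (h.cont t ht) (h.cont_deriv t ht)
  filter_upwards [self_mem_nhdsWithin] with s hs using h.ac s hs

/-- The system for `u = a + i b` and `v`, with `a₁ = a_x`, `a₂ = a_xx`, and so on, in terms of
absolutely continuous representatives. -/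
structure RealSolution (α β γ : ℝ) (a a₁ a₂ b b₁ b₂ v v₁ v₂ v₃ : ℝ → ℝ → ℝ) : Prop where
  ha : H1Curve a a₁
  ha₁ : H1Curve a₁ a₂
  hb : H1Curve b b₁
  hb₁ : H1Curve b₁ b₂
  hv : H1Curve v v₁
  hv₁ : H1Curve v₁ v₂
  hv₂ : H1Curve v₂ v₃
  a_zero : ∀ t, 0 ≤ t → a t 0 = 0
  b_zero : ∀ t, 0 ≤ t → b t 0 = 0
  v_zero : ∀ t, 0 ≤ t → v t 0 = 0
  v₁_zero : ∀ t, 0 ≤ t → v₁ t 0 = 0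
  a_time : ∀ t, 0 < t → LpTendsto 2 (𝓝[≠] t) (fun s x => (s - t)⁻¹ * (a s x - a t x))
    (fun x => α * (v t x * b t x) + β * ((a t x * a t x + b t x * b t x) * b t x) - b₂ t x)
  b_time : ∀ t, 0 < t → LpTendsto 2 (𝓝[≠] t) (fun s x => (s - t)⁻¹ * (b s x - b t x))
    (fun x => a₂ t x - α * (v t x * a t x) - β * ((a t x * a t x + b t x * b t x) * a t x))
  v_time : ∀ t, 0 < t → LpTendsto 2 (𝓝[≠] t) (fun s x => (s - t)⁻¹ * (v s x - v t x))
    (fun x => 2 * γ * (a t x * a₁ t x + b t x * b₁ t x) - v₃ t x - v t x * v₁ t x)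

/-- Convergence of a solution together with its space derivatives; the components that lie in `H¹`
converge uniformly as well. The two exponents are recorded so that the convergence of a polynomial
in the components follows by a syntax-directed application of Hölder's inequality. -/
structure SolutionTendsto (l : Filter ℝ) (a a₁ a₂ b b₁ b₂ v v₁ v₂ v₃ : ℝ → ℝ → ℝ)
    (a' a₁' a₂' b' b₁' b₂' v' v₁' v₂' v₃' : ℝ → ℝ) : Prop where
  a_two : LpTendsto 2 l a a'
  a_top : LpTendsto ∞ l a a'
  a₁_two : LpTendsto 2 l a₁ a₁'
  a₁_top : LpTendsto ∞ l a₁ a₁'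
  a₂_two : LpTendsto 2 l a₂ a₂'
  b_two : LpTendsto 2 l b b'
  b_top : LpTendsto ∞ l b b'
  b₁_two : LpTendsto 2 l b₁ b₁'
  b₁_top : LpTendsto ∞ l b₁ b₁'
  b₂_two : LpTendsto 2 l b₂ b₂'
  v_two : LpTendsto 2 l v v'
  v_top : LpTendsto ∞ l v v'
  v₁_two : LpTendsto 2 l v₁ v₁'
  v₁_top : LpTendsto ∞ l v₁ v₁'
  v₂_two : LpTendsto 2 l v₂ v₂'
  v₂_top : LpTendsto ∞ l v₂ v₂'
  v₃_two : LpTendsto 2 l v₃ v₃'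

/-- A weight `w` on `ℝ⁻` that is bounded together with its derivatives `w₁ = w'` and `w₂ = w''`. -/
structure IsWeight (w w₁ w₂ : ℝ → ℝ) : Prop where
  ac : HasACDeriv w w₁
  ac₁ : HasACDeriv w₁ w₂
  bdd : MemLp w ∞ leftMeasure
  bdd₁ : MemLp w₁ ∞ leftMeasure
  bdd₂ : MemLp w₂ ∞ leftMeasure

theorem isWeight_one : IsWeight (fun _ => 1) (fun _ => 0) (fun _ => 0) :=
  ⟨.const 1, .const 0, memLp_top_const 1, memLp_top_const 0, memLp_top_const 0⟩

namespace RealSolution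

variable {α β γ : ℝ} {a a₁ a₂ b b₁ b₂ v v₁ v₂ v₃ : ℝ → ℝ → ℝ} {w w₁ w₂ : ℝ → ℝ} {t : ℝ}

theorem tendsto (h : RealSolution α β γ a a₁ a₂ b b₁ b₂ v v₁ v₂ v₃) (ht : 0 ≤ t) :
    SolutionTendsto (𝓝[Ici 0] t) a a₁ a₂ b b₁ b₂ v v₁ v₂ v₃
      (a t) (a₁ t) (a₂ t) (b t) (b₁ t) (b₂ t) (v t) (v₁ t) (v₂ t) (v₃ t) :=
  ⟨h.ha.cont t ht, h.ha.cont_top t ht, h.ha₁.cont t ht, h.ha₁.cont_top t ht, h.ha₁.cont_deriv t ht,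
    h.hb.cont t ht, h.hb.cont_top t ht, h.hb₁.cont t ht, h.hb₁.cont_top t ht, h.hb₁.cont_deriv t ht,
    h.hv.cont t ht, h.hv.cont_top t ht, h.hv₁.cont t ht, h.hv₁.cont_top t ht,
    h.hv₂.cont t ht, h.hv₂.cont_top t ht, h.hv₂.cont_deriv t ht⟩

theorem punctured_le (ht : 0 < t) : 𝓝[≠] t ≤ 𝓝[Ici 0] t := by
  rw [nhdsWithin_eq_nhds.2 (Ici_mem_nhds ht)]
  exact nhdsWithin_le_nhds

theorem tendsto_punctured (h : RealSolution α β γ a a₁ a₂ b b₁ b₂ v v₁ v₂ v₃) (ht : 0 < t) :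
    SolutionTendsto (𝓝[≠] t) a a₁ a₂ b b₁ b₂ v v₁ v₂ v₃
      (a t) (a₁ t) (a₂ t) (b t) (b₁ t) (b₂ t) (v t) (v₁ t) (v₂ t) (v₃ t) := by
  have hl := punctured_le ht
  obtain ⟨q1, q2, q3, q4, q5, q6, q7, q8, q9, q10, q11, q12, q13, q14, q15, q16, q17⟩ :=
    h.tendsto ht.le
  exact ⟨q1.mono_left hl, q2.mono_left hl, q3.mono_left hl, q4.mono_left hl, q5.mono_left hl,
    q6.mono_left hl, q7.mono_left hl, q8.mono_left hl, q9.mono_left hl, q10.mono_left hl,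
    q11.mono_left hl, q12.mono_left hl, q13.mono_left hl, q14.mono_left hl, q15.mono_left hl,
    q16.mono_left hl, q17.mono_left hl⟩

theorem tendsto_const (h : RealSolution α β γ a a₁ a₂ b b₁ b₂ v v₁ v₂ v₃) (ht : 0 ≤ t)
    (l : Filter ℝ) :
    SolutionTendsto l (fun _ => a t) (fun _ => a₁ t) (fun _ => a₂ t) (fun _ => b t) (fun _ => b₁ t)
      (fun _ => b₂ t) (fun _ => v t) (fun _ => v₁ t) (fun _ => v₂ t) (fun _ => v₃ t)
      (a t) (a₁ t) (a₂ t) (b t) (b₁ t) (b₂ t) (v t) (v₁ t) (v₂ t) (v₃ t) := by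
  obtain ⟨q1, q2, q3, q4, q5, q6, q7, q8, q9, q10, q11, q12, q13, q14, q15, q16, q17⟩ :=
    h.tendsto ht
  exact ⟨.const q1.2, .const q2.2, .const q3.2, .const q4.2, .const q5.2, .const q6.2, .const q7.2,
    .const q8.2, .const q9.2, .const q10.2, .const q11.2, .const q12.2, .const q13.2,
    .const q14.2, .const q15.2, .const q16.2, .const q17.2⟩

theorem eventually_nonneg (ht : 0 < t) : ∀ᶠ s in 𝓝[≠] t, 0 ≤ s := by
  filter_upwards [mem_nhdsWithin_of_mem_nhds (Ioi_mem_nhds ht)] with s hs using le_of_lt hs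

/-! ### Continuity in time -/

theorem tendsto_mass (h : RealSolution α β γ a a₁ a₂ b b₁ b₂ v v₁ v₂ v₃)
    (hw : MemLp w ∞ leftMeasure) (ht : 0 ≤ t) :
    LpTendsto 1 (𝓝[Ici 0] t) (fun s x => w x * (a s x * a s x + b s x * b s x))
      (fun x => w x * (a t x * a t x + b t x * b t x)) := by
  obtain ⟨q1, q2, q3, q4, q5, q6, q7, q8, q9, q10, q11, q12, q13, q14, q15, q16, q17⟩ :=
    h.tendsto ht
  have k1 : LpTendsto ∞ (𝓝[Ici 0] t) (fun _ x => w x) w := .const hw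
  solve_by_elim (maxDepth := 200) only [LpTendsto.add, LpTendsto.two_mul_two,
    LpTendsto.top_mul_one, *]

theorem tendsto_kdvMass (h : RealSolution α β γ a a₁ a₂ b b₁ b₂ v v₁ v₂ v₃)
    (hw : MemLp w ∞ leftMeasure) (ht : 0 ≤ t) :
    LpTendsto 1 (𝓝[Ici 0] t) (fun s x => w x * (v s x * v s x))
      (fun x => w x * (v t x * v t x)) := by
  obtain ⟨q1, q2, q3, q4, q5, q6, q7, q8, q9, q10, q11, q12, q13, q14, q15, q16, q17⟩ :=
    h.tendsto ht
  have k1 : LpTendsto ∞ (𝓝[Ici 0] t) (fun _ x => w x) w := .const hw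
  solve_by_elim (maxDepth := 200) only [LpTendsto.two_mul_two, LpTendsto.top_mul_one, *]

theorem tendsto_current (h : RealSolution α β γ a a₁ a₂ b b₁ b₂ v v₁ v₂ v₃)
    (hw : MemLp w ∞ leftMeasure) (ht : 0 ≤ t) :
    LpTendsto 1 (𝓝[Ici 0] t) (fun s x => w x * (a s x * b₁ s x - b s x * a₁ s x))
      (fun x => w x * (a t x * b₁ t x - b t x * a₁ t x)) := by
  obtain ⟨q1, q2, q3, q4, q5, q6, q7, q8, q9, q10, q11, q12, q13, q14, q15, q16, q17⟩ :=
    h.tendsto ht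
  have k1 : LpTendsto ∞ (𝓝[Ici 0] t) (fun _ x => w x) w := .const hw
  solve_by_elim (maxDepth := 200) only [LpTendsto.sub, LpTendsto.two_mul_two,
    LpTendsto.top_mul_one, *]

theorem tendsto_energy (h : RealSolution α β γ a a₁ a₂ b b₁ b₂ v v₁ v₂ v₃) (ht : 0 ≤ t) :
    LpTendsto 1 (𝓝[Ici 0] t)
      (fun s x => α * (v s x * (a s x * a s x + b s x * b s x))
        - α / (6 * γ) * (v s x * (v s x * v s x))
        + β / 2 * ((a s x * a s x + b s x * b s x) * (a s x * a s x + b s x * b s x))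
        + α / (2 * γ) * (v₁ s x * v₁ s x) + (a₁ s x * a₁ s x + b₁ s x * b₁ s x))
      (fun x => α * (v t x * (a t x * a t x + b t x * b t x))
        - α / (6 * γ) * (v t x * (v t x * v t x))
        + β / 2 * ((a t x * a t x + b t x * b t x) * (a t x * a t x + b t x * b t x))
        + α / (2 * γ) * (v₁ t x * v₁ t x) + (a₁ t x * a₁ t x + b₁ t x * b₁ t x)) := by
  obtain ⟨q1, q2, q3, q4, q5, q6, q7, q8, q9, q10, q11, q12, q13, q14, q15, q16, q17⟩ :=
    h.tendsto ht
  solve_by_elim (maxDepth := 200) only [LpTendsto.add, LpTendsto.sub, LpTendsto.const_mul,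
    LpTendsto.two_mul_two, LpTendsto.top_mul_two, *]

/-! ### The evolution of the weighted functionals -/

/-- Balance law of the weighted mass of `u`; its flux is the momentum density
`Im (ū u_x) = a b₁ - b a₁`. -/
theorem hasDerivAt_mass (h : RealSolution α β γ a a₁ a₂ b b₁ b₂ v v₁ v₂ v₃)
    (hw : IsWeight w w₁ w₂) (ht : 0 < t) :
    HasDerivAt (fun s => ∫ x, w x * (a s x * a s x + b s x * b s x) ∂leftMeasure)
      (2 * ∫ x, w₁ x * (a t x * b₁ t x - b t x * a₁ t x) ∂leftMeasure) t := by
  have hf := (h.tendsto_mass hw.bdd ht.le).mono_left (punctured_le ht)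
  have hc := h.tendsto_current hw.bdd₁ ht.le
  have hDi := (h.tendsto_current hw.bdd ht.le).const_mul (-2)
  obtain ⟨q1, q2, q3, q4, q5, q6, q7, q8, q9, q10, q11, q12, q13, q14, q15, q16, q17⟩ :=
    h.tendsto_punctured ht
  obtain ⟨p1, p2, p3, p4, p5, p6, p7, p8, p9, p10, p11, p12, p13, p14, p15, p16, p17⟩ :=
    h.tendsto_const ht.le (𝓝[≠] t)
  have k1 : LpTendsto ∞ (𝓝[≠] t) (fun _ x => w x) w := .const hw.bdd
  have ta := h.a_time t ht
  have tb := h.b_time t ht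
  have hH : LpTendsto 1 (𝓝[≠] t)
      (fun s x => (s - t)⁻¹ * (a s x - a t x) * (w x * (a s x + a t x))
        + (s - t)⁻¹ * (b s x - b t x) * (w x * (b s x + b t x)))
      (fun x => (α * (v t x * b t x) + β * ((a t x * a t x + b t x * b t x) * b t x) - b₂ t x)
          * (w x * (a t x + a t x))
        + (a₂ t x - α * (v t x * a t x) - β * ((a t x * a t x + b t x * b t x) * a t x))
          * (w x * (b t x + b t x))) := by
    solve_by_elim (maxDepth := 200) only [LpTendsto.add, LpTendsto.two_mul_two,
      LpTendsto.top_mul_two, *]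
  have hd := hasDerivAt_integral_of_density (D := fun _ _ => 0) hf hH
    (Eventually.of_forall fun _ => .const 0) (e := fun _ => 0)
    (.const (MemLp.zero' (p := 1))) (Eventually.of_forall fun _ => rfl) (fun s x => by ring)
  have hD := (hw.ac.mul (((h.ha.ac t ht.le).mul (h.hb₁.ac t ht.le)).sub
    ((h.hb.ac t ht.le).mul (h.ha₁.ac t ht.le)))).const_mul (-2)
  rw [hD.integral_eq_add hDi.integrable hH.integrable (hc.const_mul 2).integrable
    (fun x => by ring), integral_const_mul] at hd
  simpa only [h.a_zero t ht.le, h.b_zero t ht.le, zero_mul, sub_zero, mul_zero, add_zero] using hd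

/-- Balance law of the weighted mass of `v`. -/
theorem hasDerivAt_kdvMass (h : RealSolution α β γ a a₁ a₂ b b₁ b₂ v v₁ v₂ v₃)
    (hw : IsWeight w w₁ w₂) (ht : 0 < t) :
    Integrable (fun x => 4 * γ * (w x * v t x * (a t x * a₁ t x + b t x * b₁ t x))
        - 3 * (w₁ x * (v₁ t x * v₁ t x))
        - 2 * (w₂ x * (v t x * v₁ t x)) + 2 / 3 * (w₁ x * v t x * (v t x * v t x))) leftMeasure ∧
    HasDerivAt (fun s => ∫ x, w x * (v s x * v s x) ∂leftMeasure)
      (∫ x, (4 * γ * (w x * v t x * (a t x * a₁ t x + b t x * b₁ t x))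
        - 3 * (w₁ x * (v₁ t x * v₁ t x)) - 2 * (w₂ x * (v t x * v₁ t x)) + 2 / 3 * (w₁ x * v t x * (v t x * v t x)))
        ∂leftMeasure) t := by
  have hf := (h.tendsto_kdvMass hw.bdd ht.le).mono_left (punctured_le ht)
  obtain ⟨q1, q2, q3, q4, q5, q6, q7, q8, q9, q10, q11, q12, q13, q14, q15, q16, q17⟩ :=
    h.tendsto_punctured ht
  obtain ⟨p1, p2, p3, p4, p5, p6, p7, p8, p9, p10, p11, p12, p13, p14, p15, p16, p17⟩ :=
    h.tendsto_const ht.le (𝓝[≠] t)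
  have k1 : LpTendsto ∞ (𝓝[≠] t) (fun _ x => w x) w := .const hw.bdd
  have k2 : LpTendsto ∞ (𝓝[≠] t) (fun _ x => w₁ x) w₁ := .const hw.bdd₁
  have k3 : LpTendsto ∞ (𝓝[≠] t) (fun _ x => w₂ x) w₂ := .const hw.bdd₂
  have tv := h.v_time t ht
  have hH : LpTendsto 1 (𝓝[≠] t)
      (fun s x => (s - t)⁻¹ * (v s x - v t x) * (w x * (v s x + v t x)))
      (fun x => (2 * γ * (a t x * a₁ t x + b t x * b₁ t x) - v₃ t x - v t x * v₁ t x)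
          * (w x * (v t x + v t x))) := by
    solve_by_elim (maxDepth := 200) only [LpTendsto.add, LpTendsto.two_mul_two,
      LpTendsto.top_mul_two, *]
  have hd := hasDerivAt_integral_of_density (D := fun _ _ => 0) hf hH
    (Eventually.of_forall fun _ => .const 0) (e := fun _ => 0)
    (.const (MemLp.zero' (p := 1))) (Eventually.of_forall fun _ => rfl) (fun s x => by ring)
  have hY : LpTendsto 1 (𝓝[≠] t)
      (fun _ x => 4 * γ * (w x * v t x * (a t x * a₁ t x + b t x * b₁ t x))
        - 3 * (w₁ x * (v₁ t x * v₁ t x))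
        - 2 * (w₂ x * (v t x * v₁ t x)) + 2 / 3 * (w₁ x * v t x * (v t x * v t x)))
      (fun x => 4 * γ * (w x * v t x * (a t x * a₁ t x + b t x * b₁ t x))
        - 3 * (w₁ x * (v₁ t x * v₁ t x))
        - 2 * (w₂ x * (v t x * v₁ t x)) + 2 / 3 * (w₁ x * v t x * (v t x * v t x))) := by
    solve_by_elim (maxDepth := 200) only [LpTendsto.add, LpTendsto.sub, LpTendsto.const_mul,
      LpTendsto.two_mul_two, LpTendsto.top_mul_one, LpTendsto.top_mul_two, LpTendsto.top_mul_top, *]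
  have hDi : LpTendsto 1 (𝓝[≠] t)
      (fun _ x => w x * (v₁ t x * v₁ t x - 2 * (v t x * v₂ t x) - 2 / 3 * (v t x * (v t x * v t x)))
        + 2 * (w₁ x * (v t x * v₁ t x)))
      (fun x => w x * (v₁ t x * v₁ t x - 2 * (v t x * v₂ t x) - 2 / 3 * (v t x * (v t x * v t x)))
        + 2 * (w₁ x * (v t x * v₁ t x))) := by
    solve_by_elim (maxDepth := 200) only [LpTendsto.add, LpTendsto.sub, LpTendsto.const_mul,
      LpTendsto.two_mul_two, LpTendsto.top_mul_one, LpTendsto.top_mul_two, *]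
  have dv := h.hv.ac t ht.le
  have dv₁ := h.hv₁.ac t ht.le
  have dv₂ := h.hv₂.ac t ht.le
  have hD := (hw.ac.mul (((dv₁.mul dv₁).sub ((dv.mul dv₂).const_mul 2)).sub
    ((dv.mul (dv.mul dv)).const_mul (2 / 3)))).add ((hw.ac₁.mul (dv.mul dv₁)).const_mul 2)
  rw [hD.integral_eq_add hDi.integrable hH.integrable hY.integrable (fun x => by ring)] at hd
  refine ⟨hY.integrable, ?_⟩
  simpa only [h.v_zero t ht.le, h.v₁_zero t ht.le, zero_mul, sub_zero, mul_zero, add_zero] using hd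

/-- Balance law of the weighted momentum of `u`. The term with `w v (|u|²)_x` is the exchange with the
mass of `v`. -/
theorem hasDerivAt_current (h : RealSolution α β γ a a₁ a₂ b b₁ b₂ v v₁ v₂ v₃)
    (hw : IsWeight w w₁ w₂) (ht : 0 < t) :
    Integrable (fun x => 2 * (w₁ x * (a₁ t x * a₁ t x + b₁ t x * b₁ t x))
        + w₂ x * (a t x * a₁ t x + b t x * b₁ t x)
        + α * (w₁ x * v t x * (a t x * a t x + b t x * b t x))
        + 2 * α * (w x * v t x * (a t x * a₁ t x + b t x * b₁ t x))
        + β / 2 * (w₁ x * ((a t x * a t x + b t x * b t x) * (a t x * a t x + b t x * b t x))))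
        leftMeasure ∧
    HasDerivAt (fun s => ∫ x, w x * (a s x * b₁ s x - b s x * a₁ s x) ∂leftMeasure)
      (∫ x, (2 * (w₁ x * (a₁ t x * a₁ t x + b₁ t x * b₁ t x))
        + w₂ x * (a t x * a₁ t x + b t x * b₁ t x)
        + α * (w₁ x * v t x * (a t x * a t x + b t x * b t x))
        + 2 * α * (w x * v t x * (a t x * a₁ t x + b t x * b₁ t x))
        + β / 2 * (w₁ x * ((a t x * a t x + b t x * b t x) * (a t x * a t x + b t x * b t x))))
        ∂leftMeasure
        - w 0 * (a₁ t 0 ^ 2 + b₁ t 0 ^ 2)) t := by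
  have hf := (h.tendsto_current hw.bdd ht.le).mono_left (punctured_le ht)
  obtain ⟨q1, q2, q3, q4, q5, q6, q7, q8, q9, q10, q11, q12, q13, q14, q15, q16, q17⟩ :=
    h.tendsto_punctured ht
  obtain ⟨p1, p2, p3, p4, p5, p6, p7, p8, p9, p10, p11, p12, p13, p14, p15, p16, p17⟩ :=
    h.tendsto_const ht.le (𝓝[≠] t)
  have k1 : LpTendsto ∞ (𝓝[≠] t) (fun _ x => w x) w := .const hw.bdd
  have k2 : LpTendsto ∞ (𝓝[≠] t) (fun _ x => w₁ x) w₁ := .const hw.bdd₁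
  have k3 : LpTendsto ∞ (𝓝[≠] t) (fun _ x => w₂ x) w₂ := .const hw.bdd₂
  have ta := h.a_time t ht
  have tb := h.b_time t ht
  have hH : LpTendsto 1 (𝓝[≠] t)
      (fun s x => (s - t)⁻¹ * (a s x - a t x) * (w x * (b₁ s x + b₁ t x) + w₁ x * b t x)
        - (s - t)⁻¹ * (b s x - b t x) * (w x * (a₁ s x + a₁ t x) + w₁ x * a t x))
      (fun x => (α * (v t x * b t x) + β * ((a t x * a t x + b t x * b t x) * b t x) - b₂ t x)
          * (w x * (b₁ t x + b₁ t x) + w₁ x * b t x)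
        - (a₂ t x - α * (v t x * a t x) - β * ((a t x * a t x + b t x * b t x) * a t x))
          * (w x * (a₁ t x + a₁ t x) + w₁ x * a t x)) := by
    solve_by_elim (maxDepth := 200) only [LpTendsto.add, LpTendsto.sub, LpTendsto.two_mul_two,
      LpTendsto.top_mul_two, *]
  -- `(s - t)⁻¹ (b₁ s - b₁ t)` need not converge; the product rule for `w (a Δb - b Δa)` moves the
  -- space derivative to the other factors
  have hDi : LpTendsto 1 (𝓝[≠] t)
      (fun s x => w x * (a t x * (b s x - b t x) - b t x * (a s x - a t x)))
      (fun x => w x * (a t x * (b t x - b t x) - b t x * (a t x - a t x))) := by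
    solve_by_elim (maxDepth := 200) only [LpTendsto.sub, LpTendsto.two_mul_two,
      LpTendsto.top_mul_one, *]
  have da := h.ha.ac t ht.le
  have db := h.hb.ac t ht.le
  have hd := hasDerivAt_integral_of_density hf hH ((eventually_nonneg ht).mono fun s hs =>
      hw.ac.mul ((da.mul ((h.hb.ac s hs).sub db)).sub (db.mul ((h.ha.ac s hs).sub da)))) hDi
    (Eventually.of_forall fun s => by simp only [h.a_zero t ht.le, h.b_zero t ht.le]; ring)
    (fun s x => by ring)
  have hY : LpTendsto 1 (𝓝[≠] t)
      (fun _ x => 2 * (w₁ x * (a₁ t x * a₁ t x + b₁ t x * b₁ t x))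
        + w₂ x * (a t x * a₁ t x + b t x * b₁ t x)
        + α * (w₁ x * v t x * (a t x * a t x + b t x * b t x))
        + 2 * α * (w x * v t x * (a t x * a₁ t x + b t x * b₁ t x))
        + β / 2 * (w₁ x * ((a t x * a t x + b t x * b t x) * (a t x * a t x + b t x * b t x))))
      (fun x => 2 * (w₁ x * (a₁ t x * a₁ t x + b₁ t x * b₁ t x))
        + w₂ x * (a t x * a₁ t x + b t x * b₁ t x)
        + α * (w₁ x * v t x * (a t x * a t x + b t x * b t x))
        + 2 * α * (w x * v t x * (a t x * a₁ t x + b t x * b₁ t x))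
        + β / 2 * (w₁ x * ((a t x * a t x + b t x * b t x)
          * (a t x * a t x + b t x * b t x)))) := by
    solve_by_elim (maxDepth := 200) only [LpTendsto.add, LpTendsto.const_mul,
      LpTendsto.two_mul_two, LpTendsto.top_mul_one, LpTendsto.top_mul_two, LpTendsto.top_mul_top, *]
  have hDi' : LpTendsto 1 (𝓝[≠] t)
      (fun _ x => β / 2 * (w x * ((a t x * a t x + b t x * b t x)
          * (a t x * a t x + b t x * b t x)))
        - w x * (a₁ t x * a₁ t x + b₁ t x * b₁ t x) - w₁ x * (a t x * a₁ t x + b t x * b₁ t x))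
      (fun x => β / 2 * (w x * ((a t x * a t x + b t x * b t x) * (a t x * a t x + b t x * b t x)))
        - w x * (a₁ t x * a₁ t x + b₁ t x * b₁ t x)
        - w₁ x * (a t x * a₁ t x + b t x * b₁ t x)) := by
    solve_by_elim (maxDepth := 200) only [LpTendsto.add, LpTendsto.sub, LpTendsto.const_mul,
      LpTendsto.two_mul_two, LpTendsto.top_mul_one, LpTendsto.top_mul_two, *]
  have da₁ := h.ha₁.ac t ht.le
  have db₁ := h.hb₁.ac t ht.le
  have dr := (da.mul da).add (db.mul db)
  have hD := (((hw.ac.mul (dr.mul dr)).const_mul (β / 2)).sub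
    (hw.ac.mul ((da₁.mul da₁).add (db₁.mul db₁)))).sub
    (hw.ac₁.mul ((da.mul da₁).add (db.mul db₁)))
  rw [hD.integral_eq_add hDi'.integrable hH.integrable hY.integrable (fun x => by ring)] at hd
  refine ⟨hY.integrable, ?_⟩
  convert hd using 1
  simp only [h.a_zero t ht.le, h.b_zero t ht.le]
  ring

/-- Energy balance: the energy is lost through the boundary only. -/
theorem hasDerivAt_energy (h : RealSolution α β γ a a₁ a₂ b b₁ b₂ v v₁ v₂ v₃) (hγ : γ ≠ 0)
    (ht : 0 < t) :
    HasDerivAt (fun s => ∫ x, (α * (v s x * (a s x * a s x + b s x * b s x))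
        - α / (6 * γ) * (v s x * (v s x * v s x))
        + β / 2 * ((a s x * a s x + b s x * b s x) * (a s x * a s x + b s x * b s x))
        + α / (2 * γ) * (v₁ s x * v₁ s x) + (a₁ s x * a₁ s x + b₁ s x * b₁ s x)) ∂leftMeasure)
      (α / (2 * γ) * v₂ t 0 ^ 2) t := by
  have hf := (h.tendsto_energy ht.le).mono_left (punctured_le ht)
  obtain ⟨q1, q2, q3, q4, q5, q6, q7, q8, q9, q10, q11, q12, q13, q14, q15, q16, q17⟩ :=
    h.tendsto_punctured ht
  obtain ⟨p1, p2, p3, p4, p5, p6, p7, p8, p9, p10, p11, p12, p13, p14, p15, p16, p17⟩ :=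
    h.tendsto_const ht.le (𝓝[≠] t)
  have ta := h.a_time t ht
  have tb := h.b_time t ht
  have tv := h.v_time t ht
  have hH1 : LpTendsto 1 (𝓝[≠] t)
      (fun s x => (s - t)⁻¹ * (a s x - a t x) * (α * (v t x * (a s x + a t x))
          + β / 2 * ((a s x + a t x) * ((a s x * a s x + b s x * b s x)
            + (a t x * a t x + b t x * b t x))) - (a₂ s x + a₂ t x)))
      (fun x => (α * (v t x * b t x) + β * ((a t x * a t x + b t x * b t x) * b t x) - b₂ t x)
          * (α * (v t x * (a t x + a t x))
          + β / 2 * ((a t x + a t x) * ((a t x * a t x + b t x * b t x)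
            + (a t x * a t x + b t x * b t x))) - (a₂ t x + a₂ t x))) := by
    solve_by_elim (maxDepth := 200) only [LpTendsto.add, LpTendsto.sub, LpTendsto.const_mul,
      LpTendsto.two_mul_two, LpTendsto.top_mul_two, *]
  have hH2 : LpTendsto 1 (𝓝[≠] t)
      (fun s x => (s - t)⁻¹ * (b s x - b t x) * (α * (v t x * (b s x + b t x))
          + β / 2 * ((b s x + b t x) * ((a s x * a s x + b s x * b s x)
            + (a t x * a t x + b t x * b t x))) - (b₂ s x + b₂ t x)))
      (fun x => (a₂ t x - α * (v t x * a t x) - β * ((a t x * a t x + b t x * b t x) * a t x))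
          * (α * (v t x * (b t x + b t x))
          + β / 2 * ((b t x + b t x) * ((a t x * a t x + b t x * b t x)
            + (a t x * a t x + b t x * b t x))) - (b₂ t x + b₂ t x))) := by
    solve_by_elim (maxDepth := 200) only [LpTendsto.add, LpTendsto.sub, LpTendsto.const_mul,
      LpTendsto.two_mul_two, LpTendsto.top_mul_two, *]
  have hH3 : LpTendsto 1 (𝓝[≠] t)
      (fun s x => (s - t)⁻¹ * (v s x - v t x) * (α * (a s x * a s x + b s x * b s x)
          - α / (6 * γ) * (v s x * v s x + v s x * v t x + v t x * v t x)
          - α / (2 * γ) * (v₂ s x + v₂ t x)))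
      (fun x => (2 * γ * (a t x * a₁ t x + b t x * b₁ t x) - v₃ t x - v t x * v₁ t x)
          * (α * (a t x * a t x + b t x * b t x)
          - α / (6 * γ) * (v t x * v t x + v t x * v t x + v t x * v t x)
          - α / (2 * γ) * (v₂ t x + v₂ t x))) := by
    solve_by_elim (maxDepth := 200) only [LpTendsto.add, LpTendsto.sub, LpTendsto.const_mul,
      LpTendsto.two_mul_two, LpTendsto.top_mul_two, *]
  have hH := (hH1.add hH2).add hH3
  -- the increments of `v₁²` and `|u_x|²` are, up to these derivatives, increments of `v`, `a`, `b`
  -- times second derivatives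
  have hDi : LpTendsto 1 (𝓝[≠] t)
      (fun s x => α / (2 * γ) * ((v s x - v t x) * (v₁ s x + v₁ t x))
        + (a s x - a t x) * (a₁ s x + a₁ t x) + (b s x - b t x) * (b₁ s x + b₁ t x))
      (fun x => α / (2 * γ) * ((v t x - v t x) * (v₁ t x + v₁ t x))
        + (a t x - a t x) * (a₁ t x + a₁ t x) + (b t x - b t x) * (b₁ t x + b₁ t x)) := by
    solve_by_elim (maxDepth := 200) only [LpTendsto.add, LpTendsto.sub, LpTendsto.const_mul,
      LpTendsto.two_mul_two, *]
  have da := h.ha.ac t ht.le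
  have db := h.hb.ac t ht.le
  have da₁ := h.ha₁.ac t ht.le
  have db₁ := h.hb₁.ac t ht.le
  have dv := h.hv.ac t ht.le
  have dv₁ := h.hv₁.ac t ht.le
  have dv₂ := h.hv₂.ac t ht.le
  have hd := hasDerivAt_integral_of_density hf hH ((eventually_nonneg ht).mono fun s hs =>
      (((((h.hv.ac s hs).sub dv).mul ((h.hv₁.ac s hs).add dv₁)).const_mul (α / (2 * γ))).add
        (((h.ha.ac s hs).sub da).mul ((h.ha₁.ac s hs).add da₁))).add
        (((h.hb.ac s hs).sub db).mul ((h.hb₁.ac s hs).add db₁))) hDi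
    ((eventually_nonneg ht).mono fun s hs => by
      simp only [h.a_zero t ht.le, h.b_zero t ht.le, h.v_zero t ht.le, h.a_zero s hs, h.b_zero s hs,
        h.v_zero s hs]
      ring)
    (fun s x => by field_simp; ring)
  -- the flux of the Korteweg-de Vries equation, `v_t = -g_x`
  have dg := (dv₂.add ((dv.mul dv).const_mul (1 / 2))).sub (((da.mul da).add (db.mul db)).const_mul γ)
  have hDi' : LpTendsto 1 (𝓝[≠] t)
      (fun _ x => α / (2 * γ) * ((v₂ t x + 1 / 2 * (v t x * v t x)
          - γ * (a t x * a t x + b t x * b t x))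
        * (v₂ t x + 1 / 2 * (v t x * v t x) - γ * (a t x * a t x + b t x * b t x))))
      (fun x => α / (2 * γ) * ((v₂ t x + 1 / 2 * (v t x * v t x)
          - γ * (a t x * a t x + b t x * b t x))
        * (v₂ t x + 1 / 2 * (v t x * v t x) - γ * (a t x * a t x + b t x * b t x)))) := by
    solve_by_elim (maxDepth := 200) only [LpTendsto.add, LpTendsto.sub, LpTendsto.const_mul,
      LpTendsto.two_mul_two, LpTendsto.top_mul_two, *]
  rw [((dg.mul dg).const_mul (α / (2 * γ))).integral_eq_add hDi'.integrable hH.integrable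
    (Y := fun _ => 0) (integrable_zero _ _ _) (fun x => by field_simp; ring)] at hd
  convert hd using 1
  simp only [h.a_zero t ht.le, h.b_zero t ht.le, h.v_zero t ht.le, integral_zero]
  ring

end RealSolution
/-! ### From regular solutions to real coordinates -/

theorem LpTendsto.congr {p : ℝ≥0∞} {l : Filter ℝ} {F G : ℝ → ℝ → ℝ} {f g : ℝ → ℝ}
    (h : LpTendsto p l F f) (hF : ∀ᶠ s in l, F s =ᵐ[leftMeasure] G s)
    (hf : f =ᵐ[leftMeasure] g) : LpTendsto p l G g := by
  refine ⟨?_, h.2.ae_eq hf, h.3.congr' ?_⟩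
  · filter_upwards [h.1, hF] with s h1 h2 using h1.ae_eq h2
  · filter_upwards [hF] with s hs using eLpNorm_congr_ae (hs.sub hf)

section Curves

variable {E : Type*} [NormedAddCommGroup E] [NormedSpace ℝ E]
  {w : ℝ → ℝ → E} {k : ℕ} (L : E →L[ℝ] ℝ)

theorem ContinuousInH.lpTendsto [CompleteSpace E] (hw : ContinuousInH k w)
    (hL : ∀ x, ‖L x‖ ≤ ‖x‖) {j : ℕ} (hj : j ≤ k) {t : ℝ} (ht : 0 ≤ t) :
    LpTendsto 2 (𝓝[Ici 0] t) (fun s x => L (wderiv^[j] (w s) x))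
      (fun x => L (wderiv^[j] (w t) x)) := by
  have hm : ∀ s, 0 ≤ s → MemLp (fun x => L (wderiv^[j] (w s) x)) 2 leftMeasure :=
    fun s hs => L.comp_memLp' ((hw.1 s hs).1 j hj)
  refine ⟨by filter_upwards [self_mem_nhdsWithin] with s hs using hm s hs, hm t ht, ?_⟩
  refine tendsto_of_tendsto_of_tendsto_of_le_of_le' tendsto_const_nhds (hw.2 t ht)
    (Eventually.of_forall fun _ => zero_le) ?_
  filter_upwards [self_mem_nhdsWithin] with s hs
  calc _ ≤ eLpNorm (wderiv^[j] (w s) - wderiv^[j] (w t)) 2 leftMeasure := by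
        refine eLpNorm_mono fun x => ?_
        simp only [Pi.sub_apply, ← map_sub]
        exact hL _
    _ = eLpNorm (wderiv^[j] (w s - w t)) 2 leftMeasure :=
        eLpNorm_congr_ae ((hw.1 s hs).wderiv_iterate_sub (hw.1 t ht) j hj).symm
    _ ≤ hNorm k (w s - w t) :=
        Finset.single_le_sum (f := fun j => eLpNorm (wderiv^[j] (w s - w t)) 2 leftMeasure)
          (fun _ _ => zero_le) (Finset.mem_range.2 (by omega))

/-- The components of a continuous curve in `H^k` have representatives forming a chain of continuous
curves in `H¹`. -/
theorem ContinuousInH.exists_h1Curve [CompleteSpace E] (hw : ContinuousInH k w)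
    (hL : ∀ x, ‖L x‖ ≤ ‖x‖) :
    ∃ W : ℕ → ℝ → ℝ → ℝ, (∀ j < k, H1Curve (W j) (W (j + 1))) ∧
      ∀ j ≤ k, ∀ t, 0 ≤ t → (fun x => L (wderiv^[j] (w t) x)) =ᵐ[leftMeasure] W j t := by
  have h1 : ∀ (j : ℕ) (t : ℝ), ∃ F : ℝ → ℝ, 0 ≤ t → j ≤ k →
      (fun x => L (wderiv^[j] (w t) x)) =ᵐ[leftMeasure] F ∧
      (j < k → HasACDeriv F (fun x => L (wderiv^[j + 1] (w t) x))) := by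
    intro j t
    by_cases h : 0 ≤ t ∧ j < k
    · obtain ⟨F, hF1, hF2⟩ := (((hw.1 t h.1).2 j h.2).clm_comp L).exists_hasACDeriv
        (L.comp_memLp' ((hw.1 t h.1).1 (j + 1) h.2))
      exact ⟨F, fun _ _ => ⟨hF2, fun _ => hF1⟩⟩
    · exact ⟨fun x => L (wderiv^[j] (w t) x), fun ht _ =>
        ⟨ae_eq_refl _, fun hj => absurd ⟨ht, hj⟩ h⟩⟩
  choose W hW using h1
  have hlp : ∀ j ≤ k, ∀ t, 0 ≤ t → LpTendsto 2 (𝓝[Ici 0] t) (W j) (W j t) := by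
    intro j hj t ht
    refine (hw.lpTendsto L hL hj ht).congr ?_ (hW j t ht hj).1
    filter_upwards [self_mem_nhdsWithin] with s hs using (hW j s hs hj).1
  refine ⟨W, fun j hj => ⟨fun t ht => ?_, hlp j hj.le, hlp (j + 1) hj⟩,
    fun j hj t ht => (hW j t ht hj).1⟩
  exact ((hW j t ht hj.le).2 hj).congr_deriv (hW (j + 1) t ht hj).1

theorem HasTrace.clm_comp {f : ℝ → E} {c : E} (h : HasTrace f c) :
    HasTrace (fun x => L (f x)) (L c) := by
  obtain ⟨g, hg, hfg, rfl⟩ := h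
  refine ⟨fun x => L (g x), L.continuous.comp_continuousOn hg, ?_, rfl⟩
  filter_upwards [hfg] with x hx using by rw [hx]

theorem HasTimeDeriv.lpTendsto {w' : ℝ → E} {t : ℝ} (h : HasTimeDeriv w w' t) (ht : 0 < t)
    (hL : ∀ x, ‖L x‖ ≤ ‖x‖) {W : ℝ → ℝ → ℝ} {g : ℝ → ℝ}
    (hW : ∀ s, 0 ≤ s → (fun x => L (w s x)) =ᵐ[leftMeasure] W s)
    (hWm : ∀ s, 0 ≤ s → MemLp (W s) 2 leftMeasure)
    (hg : MemLp g 2 leftMeasure) (hwg : (fun x => L (w' x)) =ᵐ[leftMeasure] g) :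
    LpTendsto 2 (𝓝[≠] t) (fun s x => (s - t)⁻¹ * (W s x - W t x)) g := by
  have hs0 : ∀ᶠ s in 𝓝[≠] t, 0 ≤ s := by
    filter_upwards [mem_nhdsWithin_of_mem_nhds (Ioi_mem_nhds ht)] with s hs using le_of_lt hs
  refine ⟨?_, hg, ?_⟩
  · filter_upwards [hs0] with s hs
    exact ((hWm s hs).sub (hWm t ht.le)).const_mul _
  · refine tendsto_of_tendsto_of_tendsto_of_le_of_le' tendsto_const_nhds h
      (Eventually.of_forall fun _ => zero_le) ?_
    filter_upwards [hs0] with s hs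
    refine eLpNorm_mono_ae ?_
    filter_upwards [hW s hs, hW t ht.le, hwg] with x h1 h2 h3
    have : (s - t)⁻¹ * (W s x - W t x) - g x = L (((s - t)⁻¹ • (w s - w t) - w') x) := by
      rw [← h1, ← h2, ← h3]
      simp
    rw [Pi.sub_apply, this]
    exact hL _

end Curves

theorem norm_sq_eq_of_re_im {z : ℂ} {p q : ℝ} (hp : z.re = p) (hq : z.im = q) :
    ‖z‖ ^ 2 = p * p + q * q := by
  rw [Complex.sq_norm, Complex.normSq_apply, hp, hq]

/-- The real and imaginary parts of a regular solution have representatives that solve the system in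
real coordinates. -/
theorem IsGlobalRegularSolution.exists_realSolution {α β γ : ℝ} {u₀ : ℝ → ℂ} {v₀ : ℝ → ℝ}
    {u : ℝ → ℝ → ℂ} {v : ℝ → ℝ → ℝ} (h : IsGlobalRegularSolution α β γ u₀ v₀ u v) :
    ∃ a a₁ a₂ b b₁ b₂ V V₁ V₂ V₃ : ℝ → ℝ → ℝ,
      RealSolution α β γ a a₁ a₂ b b₁ b₂ V V₁ V₂ V₃ ∧
      ∀ t, 0 ≤ t → ∀ᵐ x ∂leftMeasure, ((u t x).re = a t x ∧ (u t x).im = b t x ∧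
        (wderiv (u t) x).re = a₁ t x ∧ (wderiv (u t) x).im = b₁ t x) ∧
        v t x = V t x ∧ wderiv (v t) x = V₁ t x := by
  have nre : ∀ z : ℂ, ‖Complex.reCLM z‖ ≤ ‖z‖ := fun z => Complex.abs_re_le_norm z
  have nim : ∀ z : ℂ, ‖Complex.imCLM z‖ ≤ ‖z‖ := fun z => Complex.abs_im_le_norm z
  have nid : ∀ z : ℝ, ‖ContinuousLinearMap.id ℝ ℝ z‖ ≤ ‖z‖ := fun z => le_rfl
  obtain ⟨A, hA, eA⟩ := h.u_cont.exists_h1Curve Complex.reCLM nre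
  obtain ⟨B, hB, eB⟩ := h.u_cont.exists_h1Curve Complex.imCLM nim
  obtain ⟨V, hV, eV⟩ := h.v_cont.exists_h1Curve (ContinuousLinearMap.id ℝ ℝ) nid
  have a0 := hA 0 (by norm_num)
  have a1 := hA 1 (by norm_num)
  have b0 := hB 0 (by norm_num)
  have b1 := hB 1 (by norm_num)
  have v0 := hV 0 (by norm_num)
  have v1 := hV 1 (by norm_num)
  have v2 := hV 2 (by norm_num)
  have mem : ∀ {W W' : ℝ → ℝ → ℝ}, H1Curve W W' → ∀ s, 0 ≤ s → MemLp (W s) 2 leftMeasure :=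
    fun hc s hs => (hc.cont s hs).2
  have key : ∀ t, 0 ≤ t → ∀ l : Filter ℝ,
      MemLp (fun x => α * (V 0 t x * B 0 t x)
        + β * ((A 0 t x * A 0 t x + B 0 t x * B 0 t x) * B 0 t x) - B 2 t x) 2 leftMeasure ∧
      MemLp (fun x => A 2 t x - α * (V 0 t x * A 0 t x)
        - β * ((A 0 t x * A 0 t x + B 0 t x * B 0 t x) * A 0 t x)) 2 leftMeasure ∧
      MemLp (fun x => 2 * γ * (A 0 t x * A 1 t x + B 0 t x * B 1 t x) - V 3 t x
        - V 0 t x * V 1 t x) 2 leftMeasure ∧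
      MemLp (fun x => A 1 t x * A 0 t x + A 0 t x * A 1 t x
        + (B 1 t x * B 0 t x + B 0 t x * B 1 t x)) 2 leftMeasure := by
    intro t ht l
    have q1 := LpTendsto.const (l := l) (a0.cont t ht).2
    have q2 := LpTendsto.const (l := l) (a0.cont_top t ht).2
    have q3 := LpTendsto.const (l := l) (b0.cont t ht).2
    have q4 := LpTendsto.const (l := l) (b0.cont_top t ht).2
    have q5 := LpTendsto.const (l := l) (v0.cont_top t ht).2
    have q6 := LpTendsto.const (l := l) (a1.cont t ht).2
    have q7 := LpTendsto.const (l := l) (b1.cont t ht).2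
    have q8 := LpTendsto.const (l := l) (v1.cont t ht).2
    have q9 := LpTendsto.const (l := l) (a1.cont_deriv t ht).2
    have q10 := LpTendsto.const (l := l) (b1.cont_deriv t ht).2
    have q11 := LpTendsto.const (l := l) (v2.cont_deriv t ht).2
    exact ⟨((((q5.top_mul_two q3).const_mul α).add
        ((((q2.top_mul_top q2).add (q4.top_mul_top q4)).top_mul_two q3).const_mul β)).sub q10).2,
      ((q9.sub ((q5.top_mul_two q1).const_mul α)).sub
        ((((q2.top_mul_top q2).add (q4.top_mul_top q4)).top_mul_two q1).const_mul β)).2,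
      (((((q2.top_mul_two q6).add (q4.top_mul_two q7)).const_mul (2 * γ)).sub q11).sub
        (q5.top_mul_two q8)).2,
      (((q6.two_mul_top q2).add (q2.top_mul_two q6)).add
        ((q7.two_mul_top q4).add (q4.top_mul_two q7))).2⟩
  refine ⟨A 0, A 1, A 2, B 0, B 1, B 2, V 0, V 1, V 2, V 3,
    ⟨a0, a1, b0, b1, v0, v1, v2, ?_, ?_, ?_, ?_, ?_, ?_, ?_⟩, ?_⟩
  · intro t ht
    simpa using ((h.u_boundary t ht).clm_comp Complex.reCLM).eq_of_continuousOn
      (a0.ac t ht).continuousOn (eA 0 (by norm_num) t ht)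
  · intro t ht
    simpa using ((h.u_boundary t ht).clm_comp Complex.imCLM).eq_of_continuousOn
      (b0.ac t ht).continuousOn (eB 0 (by norm_num) t ht)
  · intro t ht
    exact (h.v_boundary t ht).eq_of_continuousOn (v0.ac t ht).continuousOn
      (eV 0 (by norm_num) t ht)
  · intro t ht
    exact (h.vx_boundary t ht).eq_of_continuousOn (v1.ac t ht).continuousOn
      (eV 1 (by norm_num) t ht)
  · intro t ht
    obtain ⟨ut, hut, heq⟩ := h.schrodinger t ht
    refine hut.lpTendsto Complex.reCLM ht nre (eA 0 (by norm_num)) (mem a0) (key t ht.le ⊥).1 ?_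
    filter_upwards [heq, eA 0 (by norm_num) t ht.le, eB 0 (by norm_num) t ht.le,
      eB 2 (by norm_num) t ht.le, eV 0 (by norm_num) t ht.le] with x h1 h2 h3 h4 h5
    simp only [Function.iterate_zero, id, Complex.reCLM_apply, Complex.imCLM_apply,
      ContinuousLinearMap.id_apply] at h2 h3 h4 h5
    rw [← Complex.ofReal_pow, norm_sq_eq_of_re_im h2 h3, h5] at h1
    have h6 := congrArg Complex.im h1
    simp only [Complex.add_im, Complex.mul_im, Complex.mul_re, Complex.I_re, Complex.I_im,
      Complex.ofReal_re, Complex.ofReal_im, h2, h3, h4] at h6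
    simp only [Complex.reCLM_apply]
    linarith
  · intro t ht
    obtain ⟨ut, hut, heq⟩ := h.schrodinger t ht
    refine hut.lpTendsto Complex.imCLM ht nim (eB 0 (by norm_num)) (mem b0) (key t ht.le ⊥).2.1 ?_
    filter_upwards [heq, eA 0 (by norm_num) t ht.le, eB 0 (by norm_num) t ht.le,
      eA 2 (by norm_num) t ht.le, eV 0 (by norm_num) t ht.le] with x h1 h2 h3 h4 h5
    simp only [Function.iterate_zero, id, Complex.reCLM_apply, Complex.imCLM_apply,
      ContinuousLinearMap.id_apply] at h2 h3 h4 h5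
    rw [← Complex.ofReal_pow, norm_sq_eq_of_re_im h2 h3, h5] at h1
    have h6 := congrArg Complex.re h1
    simp only [Complex.add_re, Complex.mul_im, Complex.mul_re, Complex.I_re, Complex.I_im,
      Complex.ofReal_re, Complex.ofReal_im, h2, h3, h4] at h6
    simp only [Complex.imCLM_apply]
    linarith
  · intro t ht
    obtain ⟨vt, hvt, heq⟩ := h.kdv t ht
    obtain ⟨-, -, k3, k4⟩ := key t ht.le ⊥
    have hr : HasWeakDeriv (fun y => ‖u t y‖ ^ 2) (fun x => A 1 t x * A 0 t x + A 0 t x * A 1 t x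
        + (B 1 t x * B 0 t x + B 0 t x * B 1 t x)) := by
      refine HasWeakDeriv.congr ((((a0.ac t ht.le).mul (a0.ac t ht.le)).add
        ((b0.ac t ht.le).mul (b0.ac t ht.le))).hasWeakDeriv
          (locallyIntegrableOn_of_memLp (by norm_num) k4)) ?_ (ae_eq_refl _)
      filter_upwards [eA 0 (by norm_num) t ht.le, eB 0 (by norm_num) t ht.le] with x h2 h3
      exact (norm_sq_eq_of_re_im h2 h3).symm
    refine hvt.lpTendsto (ContinuousLinearMap.id ℝ ℝ) ht nid (eV 0 (by norm_num)) (mem v0) k3 ?_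
    filter_upwards [heq, eV 0 (by norm_num) t ht.le, eV 1 (by norm_num) t ht.le,
      eV 3 (by norm_num) t ht.le, hr.wderiv_ae_eq] with x h1 h2 h3 h4 h5
    have h2' : v t x = V 0 t x := h2
    have h3' : wderiv (v t) x = V 1 t x := h3
    have h4' : (wderiv^[3] (v t)) x = V 3 t x := h4
    rw [h2', h3', h4', h5] at h1
    simp only [ContinuousLinearMap.id_apply]
    linarith
  · intro t ht
    filter_upwards [eA 0 (by norm_num) t ht, eB 0 (by norm_num) t ht, eA 1 (by norm_num) t ht,
      eB 1 (by norm_num) t ht, eV 0 (by norm_num) t ht, eV 1 (by norm_num) t ht]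
      with x h1 h2 h3 h4 h5 h6
    exact ⟨⟨h1, h2, h3, h4⟩, h5, h6⟩

/-! ### Bounded approximations of the weights `|x|` and `x²` -/

/-- Bounded weight approximating `|x|` on `ℝ⁻` as `e → 0`. It is minus half of the derivative of
`sqCutoff e`. -/
noncomputable def cutoff (e x : ℝ) : ℝ := -x / (1 - e * x) ^ 3

/-- The derivative of `cutoff e`. -/
noncomputable def cutoffDeriv (e x : ℝ) : ℝ := -(1 + 2 * (e * x)) / (1 - e * x) ^ 4

/-- The second derivative of `cutoff e`. -/
noncomputable def cutoffDeriv₂ (e x : ℝ) : ℝ := -(6 * e * (1 + e * x)) / (1 - e * x) ^ 5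

/-- Bounded weight approximating `x²` as `e → 0`. -/
noncomputable def sqCutoff (e x : ℝ) : ℝ := x ^ 2 / (1 - e * x) ^ 2

section Cutoff

variable {e x : ℝ}

theorem one_le_one_sub_mul (he : 0 ≤ e) (hx : x ≤ 0) : 1 ≤ 1 - e * x := by nlinarith

theorem hasDerivAt_cutoff (he : 0 ≤ e) (hx : x ≤ 0) :
    HasDerivAt (cutoff e) (cutoffDeriv e x) x := by
  have h1 := one_le_one_sub_mul he hx
  have h0 : 1 - e * x ≠ 0 := by linarith
  have h2 := (hasDerivAt_id x).neg.div ((((hasDerivAt_id x).const_mul e).const_sub 1).pow 3)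
    (pow_ne_zero 3 h0)
  refine h2.congr_deriv ?_
  simp only [cutoffDeriv, id, Pi.neg_apply, Pi.pow_apply, Nat.cast_ofNat]
  field_simp
  ring

theorem hasDerivAt_cutoffDeriv (he : 0 ≤ e) (hx : x ≤ 0) :
    HasDerivAt (cutoffDeriv e) (cutoffDeriv₂ e x) x := by
  have h1 := one_le_one_sub_mul he hx
  have h0 : 1 - e * x ≠ 0 := by linarith
  have h2 := ((((hasDerivAt_id x).const_mul e).const_mul 2).const_add 1).neg.div
    ((((hasDerivAt_id x).const_mul e).const_sub 1).pow 4) (pow_ne_zero 4 h0)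
  refine h2.congr_deriv ?_
  simp only [cutoffDeriv₂, id, Pi.neg_apply, Pi.pow_apply, Nat.cast_ofNat]
  field_simp
  ring

theorem hasDerivAt_sqCutoff (he : 0 ≤ e) (hx : x ≤ 0) :
    HasDerivAt (sqCutoff e) (-2 * cutoff e x) x := by
  have h1 := one_le_one_sub_mul he hx
  have h0 : 1 - e * x ≠ 0 := by linarith
  have h2 := ((hasDerivAt_id x).pow 2).div
    ((((hasDerivAt_id x).const_mul e).const_sub 1).pow 2) (pow_ne_zero 2 h0)
  refine h2.congr_deriv ?_
  simp only [cutoff, id, Pi.pow_apply, Nat.cast_ofNat]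
  field_simp
  ring

theorem continuousOn_cutoffDeriv₂ (he : 0 ≤ e) : ContinuousOn (cutoffDeriv₂ e) (Iic 0) := by
  unfold cutoffDeriv₂
  refine ContinuousOn.div (by fun_prop) (by fun_prop) fun x hx => ?_
  have h1 := one_le_one_sub_mul he hx
  positivity

theorem cutoff_nonneg (he : 0 ≤ e) (hx : x ≤ 0) : 0 ≤ cutoff e x := by
  have h1 := one_le_one_sub_mul he hx
  exact div_nonneg (by linarith) (by positivity)

theorem sqCutoff_nonneg (e x : ℝ) : 0 ≤ sqCutoff e x := by
  unfold sqCutoff; positivity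

theorem cutoff_le (he : 0 ≤ e) (hx : x ≤ 0) : cutoff e x ≤ -x := by
  have h1 := one_le_one_sub_mul he hx
  exact div_le_self (by linarith) (one_le_pow₀ h1)

theorem sqCutoff_le (he : 0 ≤ e) (hx : x ≤ 0) : sqCutoff e x ≤ x ^ 2 := by
  have h1 := one_le_one_sub_mul he hx
  exact div_le_self (by positivity) (one_le_pow₀ h1)

theorem cutoff_le_inv (he : 0 < e) (hx : x ≤ 0) : cutoff e x ≤ e⁻¹ := by
  have h1 := one_le_one_sub_mul he.le hx
  rw [cutoff, div_le_iff₀ (by positivity), ← div_eq_inv_mul, le_div_iff₀ he]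
  have h2 : 1 - e * x ≤ (1 - e * x) ^ 3 := le_self_pow₀ h1 (by norm_num)
  nlinarith

theorem sqCutoff_le_inv (he : 0 < e) (hx : x ≤ 0) : sqCutoff e x ≤ (e⁻¹) ^ 2 := by
  have h1 := one_le_one_sub_mul he.le hx
  rw [sqCutoff, div_le_iff₀ (by positivity), ← mul_pow, ← sq_abs x, abs_of_nonpos hx]
  refine pow_le_pow_left₀ (by linarith) ?_ 2
  rw [← div_eq_inv_mul, le_div_iff₀ he]
  nlinarith

theorem abs_cutoffDeriv_le (he : 0 ≤ e) (hx : x ≤ 0) : |cutoffDeriv e x| ≤ 1 := by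
  have h1 := one_le_one_sub_mul he hx
  rw [cutoffDeriv, abs_div, abs_of_nonneg (a := (1 - e * x) ^ 4) (by positivity),
    div_le_one (by positivity)]
  have h2 : (1 - e * x) ^ 2 ≤ (1 - e * x) ^ 4 := pow_le_pow_right₀ h1 (by norm_num)
  have h3 : e * x ≤ 0 := mul_nonpos_of_nonneg_of_nonpos he hx
  rw [abs_le]
  constructor <;> nlinarith [sq_nonneg (e * x)]

theorem abs_cutoffDeriv₂_le (he : 0 ≤ e) (hx : x ≤ 0) : |cutoffDeriv₂ e x| ≤ 6 * e := by
  have h1 := one_le_one_sub_mul he hx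
  rw [cutoffDeriv₂, abs_div, abs_of_nonneg (a := (1 - e * x) ^ 5) (by positivity),
    div_le_iff₀ (by positivity), abs_neg, abs_mul, abs_of_nonneg (a := 6 * e) (by positivity)]
  have h2 : 1 - e * x ≤ (1 - e * x) ^ 5 := le_self_pow₀ h1 (by norm_num)
  have h3 : e * x ≤ 0 := mul_nonpos_of_nonneg_of_nonpos he hx
  refine mul_le_mul_of_nonneg_left ?_ (by positivity)
  rw [abs_le]
  constructor <;> nlinarith

theorem memLp_top_of_hasACDeriv {F f : ℝ → ℝ} (h : HasACDeriv F f) {C : ℝ}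
    (hC : ∀ x ≤ 0, |F x| ≤ C) : MemLp F ∞ leftMeasure :=
  memLp_top_of_bound h.aestronglyMeasurable C (ae_leftMeasure_of_forall fun x hx => hC x hx.le)

theorem isWeight_cutoff (he : 0 < e) :
    IsWeight (cutoff e) (cutoffDeriv e) (cutoffDeriv₂ e) := by
  have h1 : HasACDeriv (cutoff e) (cutoffDeriv e) :=
    .of_hasDerivAt (fun x hx => hasDerivAt_cutoff he.le hx) fun x hx =>
      (hasDerivAt_cutoffDeriv he.le hx).continuousAt.continuousWithinAt
  have h2 : HasACDeriv (cutoffDeriv e) (cutoffDeriv₂ e) :=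
    .of_hasDerivAt (fun x hx => hasDerivAt_cutoffDeriv he.le hx) (continuousOn_cutoffDeriv₂ he.le)
  refine ⟨h1, h2, memLp_top_of_hasACDeriv h1 (C := e⁻¹) fun x hx => ?_,
    memLp_top_of_hasACDeriv h2 fun x hx => abs_cutoffDeriv_le he.le hx, ?_⟩
  · rw [abs_of_nonneg (cutoff_nonneg he.le hx)]
    exact cutoff_le_inv he hx
  · refine memLp_top_of_bound (((continuousOn_cutoffDeriv₂ he.le).mono
      Iio_subset_Iic_self).aestronglyMeasurable measurableSet_Iio) (6 * e)
      (ae_leftMeasure_of_forall fun x hx => abs_cutoffDeriv₂_le he.le hx.le)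

theorem isWeight_sqCutoff (he : 0 < e) :
    IsWeight (sqCutoff e) (fun x => -2 * cutoff e x) (fun x => -2 * cutoffDeriv e x) := by
  have hw := isWeight_cutoff he
  have h1 : HasACDeriv (sqCutoff e) (fun x => -2 * cutoff e x) :=
    .of_hasDerivAt (fun x hx => hasDerivAt_sqCutoff he.le hx) (hw.ac.const_mul (-2)).continuousOn
  refine ⟨h1, hw.ac.const_mul (-2), memLp_top_of_hasACDeriv h1 (C := (e⁻¹) ^ 2) fun x hx => ?_,
    hw.bdd.const_mul (-2), hw.bdd₁.const_mul (-2)⟩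
  rw [abs_of_nonneg (sqCutoff_nonneg e x)]
  exact sqCutoff_le_inv he hx

end Cutoff

/-- The sequence of parameters along which the weights are relaxed. -/
noncomputable def cutoffParam (n : ℕ) : ℝ := 1 / ((n : ℝ) + 1)

theorem cutoffParam_pos (n : ℕ) : 0 < cutoffParam n := Nat.one_div_pos_of_nat

theorem cutoffParam_le_one (n : ℕ) : cutoffParam n ≤ 1 := by
  rw [cutoffParam, div_le_one (by positivity)]
  simp

theorem tendsto_cutoffParam : Tendsto cutoffParam atTop (𝓝 0) :=
  tendsto_one_div_add_atTop_nhds_zero_nat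

theorem tendsto_cutoff (x : ℝ) : Tendsto (fun n => cutoff (cutoffParam n) x) atTop (𝓝 (-x)) := by
  have h : ContinuousAt (fun e => cutoff e x) 0 := by
    unfold cutoff
    exact ContinuousAt.div (by fun_prop) (by fun_prop) (by simp)
  simpa [cutoff, Function.comp_def] using h.tendsto.comp tendsto_cutoffParam

theorem tendsto_cutoffDeriv (x : ℝ) :
    Tendsto (fun n => cutoffDeriv (cutoffParam n) x) atTop (𝓝 (-1)) := by
  have h : ContinuousAt (fun e => cutoffDeriv e x) 0 := by
    unfold cutoffDeriv
    exact ContinuousAt.div (by fun_prop) (by fun_prop) (by simp)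
  simpa [cutoffDeriv, Function.comp_def] using h.tendsto.comp tendsto_cutoffParam

theorem tendsto_cutoffDeriv₂ (x : ℝ) :
    Tendsto (fun n => cutoffDeriv₂ (cutoffParam n) x) atTop (𝓝 0) := by
  have h : ContinuousAt (fun e => cutoffDeriv₂ e x) 0 := by
    unfold cutoffDeriv₂
    exact ContinuousAt.div (by fun_prop) (by fun_prop) (by simp)
  simpa [cutoffDeriv₂, Function.comp_def] using h.tendsto.comp tendsto_cutoffParam

/-! ### Passing to the limit in the weights -/

theorem tendsto_integral_weight {m : ℕ → ℝ → ℝ} {m' f : ℝ → ℝ} {C : ℝ}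
    (hf : Integrable f leftMeasure) (hm : ∀ n, AEStronglyMeasurable (m n) leftMeasure)
    (hC : ∀ n, ∀ x < 0, |m n x| ≤ C) (hlim : ∀ x, Tendsto (fun n => m n x) atTop (𝓝 (m' x))) :
    Tendsto (fun n => ∫ x, m n x * f x ∂leftMeasure) atTop (𝓝 (∫ x, m' x * f x ∂leftMeasure)) := by
  refine tendsto_integral_of_dominated_convergence (fun x => C * |f x|)
    (fun n => (hm n).mul hf.1) (hf.abs.const_mul C) (fun n => ?_)
    (Eventually.of_forall fun x => (hlim x).mul_const _)
  refine ae_leftMeasure_of_forall fun x hx => ?_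
  rw [norm_mul]
  exact mul_le_mul_of_nonneg_right (hC n x hx) (abs_nonneg _)

theorem tendsto_integral_cutoff {f : ℝ → ℝ} (hf : Integrable f leftMeasure)
    (hxf : Integrable (fun x => -x * f x) leftMeasure) :
    Tendsto (fun n => ∫ x, cutoff (cutoffParam n) x * f x ∂leftMeasure) atTop
      (𝓝 (∫ x, -x * f x ∂leftMeasure)) := by
  refine tendsto_integral_of_dominated_convergence (fun x => |-x * f x|)
    (fun n => (isWeight_cutoff (cutoffParam_pos n)).bdd.1.mul hf.1) hxf.abs (fun n => ?_)
    (Eventually.of_forall fun x => (tendsto_cutoff x).mul_const _)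
  refine ae_leftMeasure_of_forall fun x hx => ?_
  rw [norm_mul, abs_mul, abs_of_pos (neg_pos.2 hx), Real.norm_of_nonneg
    (cutoff_nonneg (cutoffParam_pos n).le hx.le)]
  exact mul_le_mul_of_nonneg_right (cutoff_le (cutoffParam_pos n).le hx.le) (abs_nonneg _)

theorem tendsto_integral_cutoffDeriv {f : ℝ → ℝ} (hf : Integrable f leftMeasure) :
    Tendsto (fun n => ∫ x, cutoffDeriv (cutoffParam n) x * f x ∂leftMeasure) atTop
      (𝓝 (-∫ x, f x ∂leftMeasure)) := by
  have := tendsto_integral_weight (m' := fun _ => -1) hf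
    (fun n => (isWeight_cutoff (cutoffParam_pos n)).bdd₁.1)
    (fun n x hx => abs_cutoffDeriv_le (cutoffParam_pos n).le hx.le) tendsto_cutoffDeriv
  simpa only [neg_one_mul, integral_neg] using this

theorem tendsto_integral_cutoffDeriv₂ {f : ℝ → ℝ} (hf : Integrable f leftMeasure) :
    Tendsto (fun n => ∫ x, cutoffDeriv₂ (cutoffParam n) x * f x ∂leftMeasure) atTop (𝓝 0) := by
  have := tendsto_integral_weight (m' := fun _ => 0) (C := 6) hf
    (fun n => (isWeight_cutoff (cutoffParam_pos n)).bdd₂.1)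
    (fun n x hx => (abs_cutoffDeriv₂_le (cutoffParam_pos n).le hx.le).trans
      (by linarith [cutoffParam_le_one n])) tendsto_cutoffDeriv₂
  simpa only [zero_mul, integral_zero] using this

theorem abs_integral_weight_mul_le {m f : ℝ → ℝ} {C : ℝ} (hf : Integrable f leftMeasure)
    (hC : ∀ x < 0, |m x| ≤ C) :
    |∫ x, m x * f x ∂leftMeasure| ≤ C * ∫ x, |f x| ∂leftMeasure := by
  rw [← integral_const_mul, ← Real.norm_eq_abs]
  refine norm_integral_le_of_norm_le (hf.abs.const_mul C) (ae_leftMeasure_of_forall fun x hx => ?_)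
  rw [norm_mul]
  exact mul_le_mul_of_nonneg_right (hC x hx) (abs_nonneg _)

theorem integral_cutoff_le {f : ℝ → ℝ} (hf0 : ∀ x, 0 ≤ f x)
    (hxf : Integrable (fun x => -x * f x) leftMeasure) {e : ℝ} (he : 0 ≤ e) :
    ∫ x, cutoff e x * f x ∂leftMeasure ≤ ∫ x, -x * f x ∂leftMeasure := by
  refine integral_mono_of_nonneg (ae_leftMeasure_of_forall fun x hx => ?_) hxf
    (ae_leftMeasure_of_forall fun x hx => ?_)
  · exact mul_nonneg (cutoff_nonneg he hx.le) (hf0 x)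
  · exact mul_le_mul_of_nonneg_right (cutoff_le he hx.le) (hf0 x)

/-- Fatou's lemma: bounds that are uniform in the truncation pass to the weight `|x|`. -/
theorem integrable_of_integral_cutoff_le {f : ℝ → ℝ} (hf : Integrable f leftMeasure)
    (hf0 : ∀ x, 0 ≤ f x) {K : ℝ}
    (hK : ∀ n, ∫ x, cutoff (cutoffParam n) x * f x ∂leftMeasure ≤ K) :
    Integrable (fun x => -x * f x) leftMeasure ∧ ∫ x, -x * f x ∂leftMeasure ≤ K := by
  have hint : ∀ n, Integrable (fun x => cutoff (cutoffParam n) x * f x) leftMeasure := fun n =>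
    memLp_one_iff_integrable.1 ((LpTendsto.const (l := ⊥)
      (isWeight_cutoff (cutoffParam_pos n)).bdd).top_mul_one
        (LpTendsto.const (memLp_one_iff_integrable.2 hf))).2
  have hmeas : AEStronglyMeasurable (fun x => -x * f x) leftMeasure :=
    (continuous_neg.aestronglyMeasurable).mul hf.1
  have h1 : ∫⁻ x, ENNReal.ofReal (-x * f x) ∂leftMeasure ≤ ENNReal.ofReal K := by
    calc ∫⁻ x, ENNReal.ofReal (-x * f x) ∂leftMeasure
        = ∫⁻ x, liminf (fun n => ENNReal.ofReal (cutoff (cutoffParam n) x * f x)) atTop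
            ∂leftMeasure := by
          refine lintegral_congr fun x => ?_
          exact ((ENNReal.continuous_ofReal.tendsto _).comp
            ((tendsto_cutoff x).mul_const (f x))).liminf_eq.symm
      _ ≤ liminf (fun n => ∫⁻ x, ENNReal.ofReal (cutoff (cutoffParam n) x * f x) ∂leftMeasure)
            atTop := lintegral_liminf_le' fun n => (hint n).1.aemeasurable.ennreal_ofReal
      _ ≤ liminf (fun _ : ℕ => ENNReal.ofReal K) atTop := by
          refine liminf_le_liminf (Eventually.of_forall fun n => ?_)
          rw [← ofReal_integral_eq_lintegral_ofReal (hint n) (ae_leftMeasure_of_forall fun x hx =>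
            mul_nonneg (cutoff_nonneg (cutoffParam_pos n).le hx.le) (hf0 x))]
          exact ENNReal.ofReal_le_ofReal (hK n)
      _ = ENNReal.ofReal K := liminf_const _
  have h2 : 0 ≤ᵐ[leftMeasure] fun x => -x * f x :=
    ae_leftMeasure_of_forall fun x hx => mul_nonneg (by linarith) (hf0 x)
  have h3 : Integrable (fun x => -x * f x) leftMeasure :=
    ⟨hmeas, (hasFiniteIntegral_iff_ofReal h2).2 (h1.trans_lt ENNReal.ofReal_lt_top)⟩
  exact ⟨h3, le_of_tendsto (tendsto_integral_cutoff hf h3) (Eventually.of_forall hK)⟩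

/-! ### Integration in time -/

theorem eq_add_integral_of_hasDerivAt {Φ g : ℝ → ℝ} (hΦ : ContinuousOn Φ (Ici 0))
    (hg : ContinuousOn g (Ici 0)) (hd : ∀ s, 0 < s → HasDerivAt Φ (g s) s) {t : ℝ} (ht : 0 ≤ t) :
    Φ t = Φ 0 + ∫ s in (0 : ℝ)..t, g s := by
  rw [intervalIntegral.integral_eq_sub_of_hasDerivAt_of_le ht (hΦ.mono Icc_subset_Ici_self)
    (fun s hs => hd s hs.1)]
  · ring
  · exact (hg.mono (by rw [Set.uIcc_of_le ht]; exact Icc_subset_Ici_self)).intervalIntegrable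

theorem tendsto_time_integral {G : ℕ → ℝ → ℝ} {G' : ℝ → ℝ} {t C : ℝ} (ht : 0 ≤ t)
    (hG : ∀ n, ContinuousOn (G n) (Icc 0 t)) (hC : ∀ n, ∀ s ∈ Icc 0 t, |G n s| ≤ C)
    (hlim : ∀ s ∈ Icc 0 t, Tendsto (fun n => G n s) atTop (𝓝 (G' s))) :
    Tendsto (fun n => ∫ s in (0 : ℝ)..t, G n s) atTop (𝓝 (∫ s in (0 : ℝ)..t, G' s)) := by
  have hsub : ∀ s, s ∈ Set.uIoc 0 t → s ∈ Icc 0 t := fun s hs => by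
    rw [Set.uIoc_of_le ht] at hs
    exact ⟨hs.1.le, hs.2⟩
  refine intervalIntegral.tendsto_integral_filter_of_dominated_convergence (fun _ => C)
    (Eventually.of_forall fun n => ?_)
    (Eventually.of_forall fun n => Eventually.of_forall fun s hs => hC n s (hsub s hs))
    intervalIntegrable_const (Eventually.of_forall fun s hs => hlim s (hsub s hs))
  exact ((hG n).mono hsub).aestronglyMeasurable measurableSet_uIoc

theorem continuousOn_integral {f : ℝ → ℝ → ℝ}
    (h : ∀ t, 0 ≤ t → LpTendsto 1 (𝓝[Ici 0] t) f (f t)) :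
    ContinuousOn (fun s => ∫ x, f s x ∂leftMeasure) (Ici 0) :=
  fun t ht => (h t ht).tendsto_integral

theorem LpTendsto.abs {l : Filter ℝ} {p : ℝ≥0∞} {F : ℝ → ℝ → ℝ} {f : ℝ → ℝ} (h : LpTendsto p l F f) :
    LpTendsto p l (fun s x => |F s x|) (fun x => |f x|) := by
  refine ⟨h.1.mono fun s hs => hs.abs, h.2.abs, ?_⟩
  refine tendsto_of_tendsto_of_tendsto_of_le_of_le tendsto_const_nhds h.3 (fun _ => zero_le)
    fun s => eLpNorm_mono fun x => ?_
  exact abs_abs_sub_abs_le _ _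

theorem exists_bound_of_continuousOn {g : ℝ → ℝ} (hg : ContinuousOn g (Ici 0)) (T : ℝ) :
    ∃ C, 0 ≤ C ∧ ∀ s ∈ Icc 0 T, |g s| ≤ C := by
  obtain ⟨C, hC⟩ := (isCompact_Icc (a := 0) (b := T)).exists_bound_of_continuousOn
    (hg.mono Icc_subset_Ici_self)
  exact ⟨max C 0, le_max_right _ _, fun s hs => (hC s hs).trans (le_max_left _ _)⟩

/-- Gronwall's inequality with a derivative in the interior of the interval only. -/
theorem le_exp_mul_of_hasDerivAt_le {y y' : ℝ → ℝ} {C K T : ℝ} (hC : 0 ≤ C) (hK : 0 ≤ K)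
    (hy : ContinuousOn y (Icc 0 T)) (hd : ∀ s ∈ Ioo 0 T, HasDerivAt y (y' s) s)
    (hle : ∀ s ∈ Ioo 0 T, y' s ≤ C + K * y s) {t : ℝ} (ht : t ∈ Icc 0 T) :
    y t ≤ Real.exp (K * t) * (y 0 + C * t) := by
  have hz : AntitoneOn (fun s => Real.exp (-(K * s)) * y s - C * s) (Icc 0 T) := by
    refine antitoneOn_of_hasDerivWithinAt_nonpos (convex_Icc 0 T)
      (f' := fun s => -(K * Real.exp (-(K * s))) * y s + Real.exp (-(K * s)) * y' s - C)
      (ContinuousOn.sub (ContinuousOn.mul (by fun_prop) hy) (by fun_prop)) (fun s hs => ?_)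
      fun s hs => ?_
    · rw [interior_Icc] at hs ⊢
      have h1 : HasDerivAt (fun s => Real.exp (-(K * s))) (-(K * Real.exp (-(K * s)))) s := by
        have := ((hasDerivAt_id s).const_mul K).neg.exp
        refine this.congr_deriv ?_
        simp only [Pi.neg_apply, id]; ring
      have h2 := (h1.mul (hd s hs)).sub ((hasDerivAt_id s).const_mul C)
      refine (h2.congr_deriv ?_).hasDerivWithinAt
      ring
    · rw [interior_Icc] at hs
      have h1 : Real.exp (-(K * s)) ≤ 1 := Real.exp_le_one_iff.2 (by
        have := mul_nonneg hK hs.1.le; linarith)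
      have h2 := mul_le_mul_of_nonneg_left (hle s hs) (Real.exp_pos (-(K * s))).le
      nlinarith [mul_le_mul_of_nonneg_right h1 hC]
  have h0 := hz (left_mem_Icc.2 (ht.1.trans ht.2)) ht ht.1
  simp only [mul_zero, neg_zero, Real.exp_zero, one_mul, sub_zero] at h0
  have h3 : Real.exp (K * t) * Real.exp (-(K * t)) = 1 := by rw [← Real.exp_add]; simp
  calc y t = Real.exp (K * t) * (Real.exp (-(K * t)) * y t) := by rw [← mul_assoc, h3, one_mul]
    _ ≤ _ := mul_le_mul_of_nonneg_left (by linarith) (Real.exp_pos _).le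

theorem H1Curve.exists_bound {w w' : ℝ → ℝ → ℝ} (h : H1Curve w w') (T : ℝ) :
    ∃ C, 0 ≤ C ∧ ∀ s ∈ Icc 0 T, ∀ x ≤ 0, |w s x| ≤ C := by
  have hc : ContinuousOn (fun s => ∫ x, (w s x * w s x + w' s x * w' s x) ∂leftMeasure) (Ici 0) :=
    continuousOn_integral fun t ht => ((h.cont t ht).two_mul_two (h.cont t ht)).add
      ((h.cont_deriv t ht).two_mul_two (h.cont_deriv t ht))
  obtain ⟨C, hC0, hC⟩ := exists_bound_of_continuousOn hc T
  refine ⟨C + 1, by linarith, fun s hs x hx => ?_⟩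
  have h1 := (h.ac s hs.1).sq_le (h.cont s hs.1).2 (h.cont_deriv s hs.1).2 hx
  have h2 := (le_abs_self _).trans (hC s hs)
  simp only [← pow_two] at h2
  have h3 := h1.trans h2
  rw [← sq_abs] at h3
  nlinarith [sq_nonneg (|w s x| - 1), abs_nonneg (w s x)]

namespace RealSolution

variable {α β γ : ℝ} {a a₁ a₂ b b₁ b₂ v v₁ v₂ v₃ : ℝ → ℝ → ℝ} {w w₁ w₂ : ℝ → ℝ} {t : ℝ}

theorem tendsto_mass_one (h : RealSolution α β γ a a₁ a₂ b b₁ b₂ v v₁ v₂ v₃) (ht : 0 ≤ t) :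
    LpTendsto 1 (𝓝[Ici 0] t) (fun s x => a s x * a s x + b s x * b s x)
      (fun x => a t x * a t x + b t x * b t x) := by
  simpa only [one_mul] using h.tendsto_mass isWeight_one.bdd ht

theorem tendsto_kdvMass_one (h : RealSolution α β γ a a₁ a₂ b b₁ b₂ v v₁ v₂ v₃) (ht : 0 ≤ t) :
    LpTendsto 1 (𝓝[Ici 0] t) (fun s x => v s x * v s x) (fun x => v t x * v t x) := by
  simpa only [one_mul] using h.tendsto_kdvMass isWeight_one.bdd ht

theorem tendsto_current_one (h : RealSolution α β γ a a₁ a₂ b b₁ b₂ v v₁ v₂ v₃) (ht : 0 ≤ t) :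
    LpTendsto 1 (𝓝[Ici 0] t) (fun s x => a s x * b₁ s x - b s x * a₁ s x)
      (fun x => a t x * b₁ t x - b t x * a₁ t x) := by
  simpa only [one_mul] using h.tendsto_current isWeight_one.bdd ht

/-! ### Propagation of the weighted norms -/

theorem mass_eq_add (h : RealSolution α β γ a a₁ a₂ b b₁ b₂ v v₁ v₂ v₃)
    (hw : IsWeight w w₁ w₂) (ht : 0 ≤ t) :
    ∫ x, w x * (a t x * a t x + b t x * b t x) ∂leftMeasure
      = ∫ x, w x * (a 0 x * a 0 x + b 0 x * b 0 x) ∂leftMeasure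
        + ∫ s in (0 : ℝ)..t, 2 * ∫ x, w₁ x * (a s x * b₁ s x - b s x * a₁ s x) ∂leftMeasure :=
  eq_add_integral_of_hasDerivAt (continuousOn_integral fun _ hs => h.tendsto_mass hw.bdd hs)
    (continuousOn_const.mul (continuousOn_integral fun _ hs => h.tendsto_current hw.bdd₁ hs))
    (fun _ hs => h.hasDerivAt_mass hw hs) ht

/-- The first moment of `|u|²` stays finite, and its time derivative is the total momentum of `u`. -/
theorem firstMoment_eq (h : RealSolution α β γ a a₁ a₂ b b₁ b₂ v v₁ v₂ v₃)
    (h0 : Integrable (fun x => -x * (a 0 x * a 0 x + b 0 x * b 0 x)) leftMeasure) (ht : 0 ≤ t) :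
    Integrable (fun x => -x * (a t x * a t x + b t x * b t x)) leftMeasure ∧
    ∫ x, -x * (a t x * a t x + b t x * b t x) ∂leftMeasure
      = ∫ x, -x * (a 0 x * a 0 x + b 0 x * b 0 x) ∂leftMeasure
        + ∫ s in (0 : ℝ)..t, -2 * ∫ x, (a s x * b₁ s x - b s x * a₁ s x) ∂leftMeasure := by
  have hr : ∀ s, 0 ≤ s → Integrable (fun x => a s x * a s x + b s x * b s x) leftMeasure :=
    fun s hs => (h.tendsto_mass_one hs).integrable
  obtain ⟨C, -, hC⟩ := exists_bound_of_continuousOn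
    (continuousOn_integral fun s hs => (h.tendsto_current_one hs).abs) t
  have hlim := (tendsto_integral_cutoff (hr 0 le_rfl) h0).add
    (tendsto_time_integral (C := 2 * C) ht
      (G := fun n s => 2 * ∫ x, cutoffDeriv (cutoffParam n) x * (a s x * b₁ s x - b s x * a₁ s x)
        ∂leftMeasure)
      (G' := fun s => -2 * ∫ x, (a s x * b₁ s x - b s x * a₁ s x) ∂leftMeasure)
      (fun n => (continuousOn_const.mul (continuousOn_integral fun s hs =>
        h.tendsto_current (isWeight_cutoff (cutoffParam_pos n)).bdd₁ hs)).mono Icc_subset_Ici_self)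
      (fun n s hs => ?_) fun s hs => ?_)
  · simp only [← h.mass_eq_add (isWeight_cutoff (cutoffParam_pos _)) ht] at hlim
    obtain ⟨K, hK⟩ := hlim.bddAbove_range
    have hfin := (integrable_of_integral_cutoff_le (hr t ht)
      (fun x => add_nonneg (mul_self_nonneg _) (mul_self_nonneg _))
      fun n => hK (mem_range_self n)).1
    exact ⟨hfin, tendsto_nhds_unique (tendsto_integral_cutoff (hr t ht) hfin) hlim⟩
  · have h1 := abs_integral_weight_mul_le (C := 1) (h.tendsto_current_one hs.1).integrable
      (fun x hx => abs_cutoffDeriv_le (cutoffParam_pos n).le (le_of_lt hx))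
    have h2 := (le_abs_self _).trans (hC s hs)
    rw [abs_mul, abs_two]
    linarith
  · have h1 := (tendsto_integral_cutoffDeriv (h.tendsto_current_one hs.1).integrable).const_mul 2
    convert h1 using 2
    ring

theorem exists_firstMoment_bound (h : RealSolution α β γ a a₁ a₂ b b₁ b₂ v v₁ v₂ v₃)
    (h0 : Integrable (fun x => -x * (a 0 x * a 0 x + b 0 x * b 0 x)) leftMeasure) (T : ℝ) :
    ∃ K, 0 ≤ K ∧ ∀ t ∈ Icc 0 T, ∫ x, -x * (a t x * a t x + b t x * b t x) ∂leftMeasure ≤ K := by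
  have hc := continuousOn_integral fun s hs => (h.tendsto_current_one hs)
  obtain ⟨C, hC0, hC⟩ := exists_bound_of_continuousOn hc T
  have hP0 : 0 ≤ ∫ x, -x * (a 0 x * a 0 x + b 0 x * b 0 x) ∂leftMeasure :=
    integral_nonneg_of_ae (ae_leftMeasure_of_forall fun x hx =>
      mul_nonneg (by linarith) (add_nonneg (mul_self_nonneg _) (mul_self_nonneg _)))
  refine ⟨(∫ x, -x * (a 0 x * a 0 x + b 0 x * b 0 x) ∂leftMeasure) + 2 * C * |T|, by positivity,
    fun t ht => ?_⟩
  rw [(h.firstMoment_eq h0 ht.1).2]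
  have h1 : ‖∫ s in (0 : ℝ)..t, -2 * ∫ x, (a s x * b₁ s x - b s x * a₁ s x) ∂leftMeasure‖
      ≤ 2 * C * |t - 0| := by
    refine intervalIntegral.norm_integral_le_of_norm_le_const fun s hs => ?_
    rw [Set.uIoc_of_le ht.1] at hs
    rw [norm_mul]
    have := hC s ⟨hs.1.le, hs.2.trans ht.2⟩
    rw [Real.norm_eq_abs, Real.norm_eq_abs, abs_neg, abs_two]
    linarith
  have h2 := (le_abs_self _).trans h1
  have h3 : |t - 0| ≤ |T| := by
    rw [sub_zero, abs_of_nonneg ht.1]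
    exact ht.2.trans (le_abs_self T)
  nlinarith

/-- Pointwise bound of the production of `∫ m v²`, for a weight `m ≥ 0` with `p = m'`, `q = m''`. -/
theorem kdvMass_density_le {γ m p q v v₁ a b a₁ b₁ A B D : ℝ} (hm : 0 ≤ m) (hp : |p| ≤ 1)
    (hq : |q| ≤ 6) (ha₁ : |a₁| ≤ A) (hb₁ : |b₁| ≤ B) (hv : |v| ≤ D) :
    4 * γ * (m * v * (a * a₁ + b * b₁)) - 3 * (p * (v₁ * v₁)) - 2 * (q * (v * v₁))
        + 2 / 3 * (p * v * (v * v))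
      ≤ 4 * |γ| * (A + B) * (m * (v * v) + m * (a * a + b * b))
        + (9 + D) * (v * v + v₁ * v₁) := by
  have hA : 0 ≤ A := (abs_nonneg _).trans ha₁
  have hB : 0 ≤ B := (abs_nonneg _).trans hb₁
  have hD : 0 ≤ D := (abs_nonneg _).trans hv
  have prod : ∀ y z : ℝ, |y * z| ≤ (y * y + z * z) / 2 := fun y z => by
    rw [abs_le]; constructor <;> nlinarith [sq_nonneg (y + z), sq_nonneg (y - z)]
  have e1 : |v * (a * a₁ + b * b₁)| ≤ (A + B) * (v * v + (a * a + b * b)) := by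
    calc |v * (a * a₁ + b * b₁)| = |v * a * a₁ + v * b * b₁| := by congr 1; ring
      _ ≤ |v * a| * |a₁| + |v * b| * |b₁| := by
          rw [← abs_mul, ← abs_mul]; exact abs_add_le _ _
      _ ≤ (v * v + a * a) / 2 * A + (v * v + b * b) / 2 * B := by
          exact add_le_add (mul_le_mul (prod _ _) ha₁ (abs_nonneg _) ((abs_nonneg _).trans (prod _ _)))
            (mul_le_mul (prod _ _) hb₁ (abs_nonneg _) ((abs_nonneg _).trans (prod _ _)))
      _ ≤ _ := by nlinarith [mul_nonneg hA (mul_self_nonneg v), mul_nonneg hB (mul_self_nonneg v),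
          mul_nonneg hA (mul_self_nonneg b), mul_nonneg hB (mul_self_nonneg a),
          mul_nonneg hA (mul_self_nonneg a), mul_nonneg hB (mul_self_nonneg b)]
  have e2 : 4 * γ * (m * v * (a * a₁ + b * b₁))
      ≤ 4 * |γ| * (A + B) * (m * (v * v) + m * (a * a + b * b)) := by
    calc 4 * γ * (m * v * (a * a₁ + b * b₁)) ≤ |4 * γ * (m * v * (a * a₁ + b * b₁))| := le_abs_self _
      _ = 4 * |γ| * (m * |v * (a * a₁ + b * b₁)|) := by
          rw [mul_assoc m, abs_mul, abs_mul, abs_mul m, abs_of_nonneg hm]; norm_num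
      _ ≤ 4 * |γ| * (m * ((A + B) * (v * v + (a * a + b * b)))) := by gcongr
      _ = _ := by ring
  have e3 : -3 * (p * (v₁ * v₁)) ≤ 3 * (v₁ * v₁) := by
    nlinarith [mul_self_nonneg v₁, (abs_le.1 hp).1, (abs_le.1 hp).2]
  have e4 : -2 * (q * (v * v₁)) ≤ 6 * (v * v + v₁ * v₁) := by
    have : |q * (v * v₁)| ≤ 6 * ((v * v + v₁ * v₁) / 2) := by
      rw [abs_mul]; gcongr; exact prod _ _
    linarith [(abs_le.1 this).1]
  have e5 : p * v * (v * v) ≤ D * (v * v) := by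
    refine mul_le_mul_of_nonneg_right ?_ (mul_self_nonneg v)
    calc p * v ≤ |p * v| := le_abs_self _
      _ ≤ 1 * D := by rw [abs_mul]; gcongr
      _ = D := one_mul D
  have e6 := mul_nonneg hD (mul_self_nonneg v)
  have e7 := mul_nonneg hD (mul_self_nonneg v₁)
  nlinarith [mul_self_nonneg v, mul_self_nonneg v₁]

/-- The first moment of `v²` stays finite, locally uniformly in time. -/
theorem exists_kdvFirstMoment_bound (h : RealSolution α β γ a a₁ a₂ b b₁ b₂ v v₁ v₂ v₃)
    (h0 : Integrable (fun x => -x * (a 0 x * a 0 x + b 0 x * b 0 x)) leftMeasure)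
    (h0' : Integrable (fun x => -x * (v 0 x * v 0 x)) leftMeasure) (T : ℝ) :
    ∃ K, ∀ t ∈ Icc 0 T, Integrable (fun x => -x * (v t x * v t x)) leftMeasure ∧
      ∫ x, -x * (v t x * v t x) ∂leftMeasure ≤ K := by
  obtain ⟨A, hA0, hA⟩ := h.ha₁.exists_bound T
  obtain ⟨B, hB0, hB⟩ := h.hb₁.exists_bound T
  obtain ⟨D, hD0, hD⟩ := h.hv.exists_bound T
  obtain ⟨M, hM0, hM⟩ := h.exists_firstMoment_bound h0 T
  have hvv : ∀ s, 0 ≤ s → LpTendsto 1 (𝓝[Ici 0] s) (fun s x => v s x * v s x + v₁ s x * v₁ s x)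
      (fun x => v s x * v s x + v₁ s x * v₁ s x) := fun s hs =>
    ((h.hv.cont s hs).two_mul_two (h.hv.cont s hs)).add
      ((h.hv₁.cont s hs).two_mul_two (h.hv₁.cont s hs))
  obtain ⟨R, hR0, hR⟩ := exists_bound_of_continuousOn (continuousOn_integral hvv) T
  set κ := 4 * |γ| * (A + B) with hκ
  have hκ0 : 0 ≤ κ := by positivity
  set C := κ * M + (9 + D) * R with hCdef
  have hC0 : 0 ≤ C := by positivity
  set V0 := ∫ x, -x * (v 0 x * v 0 x) ∂leftMeasure with hV0
  have hV00 : 0 ≤ V0 := integral_nonneg_of_ae (ae_leftMeasure_of_forall fun x hx =>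
      mul_nonneg (by linarith) (mul_self_nonneg _))
  refine ⟨Real.exp (κ * T) * (V0 + C * T), fun t ht => ?_⟩
  refine integrable_of_integral_cutoff_le (h.tendsto_kdvMass_one ht.1).integrable
    (fun x => mul_self_nonneg _) fun n => ?_
  have he := cutoffParam_pos n
  have hw := isWeight_cutoff he
  have hgr := le_exp_mul_of_hasDerivAt_le hC0 hκ0
    ((continuousOn_integral fun s hs => h.tendsto_kdvMass hw.bdd hs).mono
      fun _ hx => hx.1)
    (fun s hs => (h.hasDerivAt_kdvMass hw hs.1).2) (fun s hs => ?_) ht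
  · refine hgr.trans ?_
    have h1 : ∫ x, cutoff (cutoffParam n) x * (v 0 x * v 0 x) ∂leftMeasure ≤ V0 :=
      integral_cutoff_le (fun x => mul_self_nonneg _) h0' he.le
    have h2 : κ * t ≤ κ * T := mul_le_mul_of_nonneg_left ht.2 hκ0
    have h3 : C * t ≤ C * T := mul_le_mul_of_nonneg_left ht.2 hC0
    have h4 : 0 ≤ C * t := mul_nonneg hC0 ht.1
    calc _ ≤ Real.exp (κ * t) * (V0 + C * T) := by gcongr
      _ ≤ _ := by
        refine mul_le_mul_of_nonneg_right (Real.exp_le_exp.2 h2) (by linarith)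
  · have hs' : s ∈ Icc 0 T := ⟨hs.1.le, hs.2.le⟩
    have i1 := (h.tendsto_kdvMass hw.bdd hs'.1).integrable
    have i2 := (h.tendsto_mass hw.bdd hs'.1).integrable
    have i3 := (hvv s hs'.1).integrable
    have i4 : Integrable (fun x => κ * (cutoff (cutoffParam n) x * (v s x * v s x)
        + cutoff (cutoffParam n) x * (a s x * a s x + b s x * b s x))) leftMeasure :=
      (i1.add i2).const_mul κ
    have h1 : ∫ x, cutoff (cutoffParam n) x * (a s x * a s x + b s x * b s x) ∂leftMeasure ≤ M :=
      (integral_cutoff_le (fun x => add_nonneg (mul_self_nonneg _) (mul_self_nonneg _))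
        (h.firstMoment_eq h0 hs'.1).1 he.le).trans (hM s hs')
    have h2 := (le_abs_self _).trans (hR s hs')
    calc _ ≤ ∫ x, (κ * (cutoff (cutoffParam n) x * (v s x * v s x)
            + cutoff (cutoffParam n) x * (a s x * a s x + b s x * b s x))
            + (9 + D) * (v s x * v s x + v₁ s x * v₁ s x)) ∂leftMeasure := by
          refine integral_mono_ae (h.hasDerivAt_kdvMass hw hs.1).1
            (i4.add (i3.const_mul (9 + D)))
            (ae_leftMeasure_of_forall fun x hx => ?_)
          exact kdvMass_density_le (cutoff_nonneg he.le hx.le) (abs_cutoffDeriv_le he.le hx.le)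
            ((abs_cutoffDeriv₂_le he.le hx.le).trans (by linarith [cutoffParam_le_one n]))
            (hA s hs' x hx.le) (hB s hs' x hx.le) (hD s hs' x hx.le)
      _ = κ * (∫ x, cutoff (cutoffParam n) x * (v s x * v s x) ∂leftMeasure
            + ∫ x, cutoff (cutoffParam n) x * (a s x * a s x + b s x * b s x) ∂leftMeasure)
            + (9 + D) * ∫ x, (v s x * v s x + v₁ s x * v₁ s x) ∂leftMeasure := by
          rw [integral_add i4 (i3.const_mul (9 + D)), integral_const_mul,
            integral_const_mul, integral_add i1 i2]
      _ ≤ _ := by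
          have h3 := mul_le_mul_of_nonneg_left h1 hκ0
          have h4 := mul_le_mul_of_nonneg_left h2 (show 0 ≤ 9 + D by linarith)
          rw [hCdef]
          linarith

/-! ### Monotonicity of momentum and energy -/

/-- The momentum is nondecreasing: its time derivative is the boundary term `2 |u_x(0)|²`. -/
theorem momentum_le (h : RealSolution α β γ a a₁ a₂ b b₁ b₂ v v₁ v₂ v₃) (hγ : γ ≠ 0)
    (ht : 0 ≤ t) :
    α / γ * ∫ x, v 0 x * v 0 x ∂leftMeasure - 2 * ∫ x, (a 0 x * b₁ 0 x - b 0 x * a₁ 0 x) ∂leftMeasure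
      ≤ α / γ * ∫ x, v t x * v t x ∂leftMeasure
        - 2 * ∫ x, (a t x * b₁ t x - b t x * a₁ t x) ∂leftMeasure := by
  have hm : MonotoneOn (fun s => α / γ * ∫ x, v s x * v s x ∂leftMeasure
      - 2 * ∫ x, (a s x * b₁ s x - b s x * a₁ s x) ∂leftMeasure) (Ici 0) := by
    refine monotoneOn_of_hasDerivWithinAt_nonneg (convex_Ici 0)
      (f' := fun s => 2 * (a₁ s 0 ^ 2 + b₁ s 0 ^ 2))
      ((continuousOn_const.mul (continuousOn_integral fun s hs => h.tendsto_kdvMass_one hs)).sub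
        (continuousOn_const.mul (continuousOn_integral fun s hs => h.tendsto_current_one hs)))
      (fun s hs => ?_) fun s _ => by positivity
    rw [interior_Ici] at hs
    have h1 := (h.hasDerivAt_kdvMass isWeight_one hs).2
    have h2 := (h.hasDerivAt_current isWeight_one hs).2
    simp only [one_mul, zero_mul, mul_zero, sub_zero, add_zero, zero_add, integral_const_mul]
      at h1 h2
    refine (((h1.const_mul (α / γ)).sub (h2.const_mul 2)).congr_deriv ?_).hasDerivWithinAt
    field_simp
    ring
  exact hm self_mem_Ici ht ht

/-- The energy is nonincreasing: its time derivative is `α/(2γ) v_xx(0)²`. -/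
theorem energy_le (h : RealSolution α β γ a a₁ a₂ b b₁ b₂ v v₁ v₂ v₃) (hαγ : α * γ < 0)
    (ht : 0 ≤ t) :
    ∫ x, (α * (v t x * (a t x * a t x + b t x * b t x)) - α / (6 * γ) * (v t x * (v t x * v t x))
        + β / 2 * ((a t x * a t x + b t x * b t x) * (a t x * a t x + b t x * b t x))
        + α / (2 * γ) * (v₁ t x * v₁ t x) + (a₁ t x * a₁ t x + b₁ t x * b₁ t x)) ∂leftMeasure
      ≤ ∫ x, (α * (v 0 x * (a 0 x * a 0 x + b 0 x * b 0 x))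
        - α / (6 * γ) * (v 0 x * (v 0 x * v 0 x))
        + β / 2 * ((a 0 x * a 0 x + b 0 x * b 0 x) * (a 0 x * a 0 x + b 0 x * b 0 x))
        + α / (2 * γ) * (v₁ 0 x * v₁ 0 x) + (a₁ 0 x * a₁ 0 x + b₁ 0 x * b₁ 0 x)) ∂leftMeasure := by
  have hγ : γ ≠ 0 := fun h0 => by simp [h0] at hαγ
  have hκ : α / (2 * γ) ≤ 0 := by
    have : α / (2 * γ) = α * γ / (2 * γ ^ 2) := by field_simp
    rw [this]
    exact div_nonpos_of_nonpos_of_nonneg hαγ.le (by positivity)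
  have hm := antitoneOn_of_hasDerivWithinAt_nonpos (convex_Ici (0 : ℝ))
    (continuousOn_integral fun s hs => h.tendsto_energy hs)
    (f' := fun s => α / (2 * γ) * v₂ s 0 ^ 2) (fun s hs => ?_)
    fun s _ => mul_nonpos_of_nonpos_of_nonneg hκ (sq_nonneg _)
  · exact hm self_mem_Ici ht ht
  · rw [interior_Ici] at hs
    exact (h.hasDerivAt_energy hγ hs).hasDerivWithinAt

end RealSolution
namespace RealSolution

variable {α β γ : ℝ} {a a₁ a₂ b b₁ b₂ v v₁ v₂ v₃ : ℝ → ℝ → ℝ} {w w₁ w₂ : ℝ → ℝ} {t : ℝ}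

/-! ### The virial inequality -/

theorem tendsto_virial (h : RealSolution α β γ a a₁ a₂ b b₁ b₂ v v₁ v₂ v₃) (ht : 0 ≤ t) :
    LpTendsto 1 (𝓝[Ici 0] t)
      (fun s x => 2 * (a₁ s x * a₁ s x + b₁ s x * b₁ s x)
        + α * (v s x * (a s x * a s x + b s x * b s x))
        + β / 2 * ((a s x * a s x + b s x * b s x) * (a s x * a s x + b s x * b s x))
        + α / (2 * γ) * (3 * (v₁ s x * v₁ s x) - 2 / 3 * (v s x * (v s x * v s x))))
      (fun x => 2 * (a₁ t x * a₁ t x + b₁ t x * b₁ t x)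
        + α * (v t x * (a t x * a t x + b t x * b t x))
        + β / 2 * ((a t x * a t x + b t x * b t x) * (a t x * a t x + b t x * b t x))
        + α / (2 * γ) * (3 * (v₁ t x * v₁ t x) - 2 / 3 * (v t x * (v t x * v t x)))) := by
  obtain ⟨q1, q2, q3, q4, q5, q6, q7, q8, q9, q10, q11, q12, q13, q14, q15, q16, q17⟩ :=
    h.tendsto ht
  solve_by_elim (maxDepth := 200) only [LpTendsto.add, LpTendsto.sub, LpTendsto.const_mul,
    LpTendsto.two_mul_two, LpTendsto.top_mul_two, *]

/-- The density multiplied by the second derivative of the weight; it disappears in the limit. -/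
theorem tendsto_virialError (h : RealSolution α β γ a a₁ a₂ b b₁ b₂ v v₁ v₂ v₃) (ht : 0 ≤ t) :
    LpTendsto 1 (𝓝[Ici 0] t)
      (fun s x => a s x * a₁ s x + b s x * b₁ s x + α / γ * (v s x * v₁ s x))
      (fun x => a t x * a₁ t x + b t x * b₁ t x + α / γ * (v t x * v₁ t x)) := by
  obtain ⟨q1, q2, q3, q4, q5, q6, q7, q8, q9, q10, q11, q12, q13, q14, q15, q16, q17⟩ :=
    h.tendsto ht
  solve_by_elim (maxDepth := 200) only [LpTendsto.add, LpTendsto.const_mul,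
    LpTendsto.two_mul_two, *]

/-- The combination of the two balance laws in which the exchange terms `w v (|u|²)_x` cancel. A weight
with `w 0 = 0` removes the boundary term. -/
theorem hasDerivAt_virial (h : RealSolution α β γ a a₁ a₂ b b₁ b₂ v v₁ v₂ v₃) (hγ : γ ≠ 0)
    (hw : IsWeight w w₁ w₂) (hw0 : w 0 = 0) (ht : 0 < t) :
    HasDerivAt (fun s => ∫ x, w x * (a s x * b₁ s x - b s x * a₁ s x) ∂leftMeasure
        - α / (2 * γ) * ∫ x, w x * (v s x * v s x) ∂leftMeasure)
      (∫ x, w₁ x * (2 * (a₁ t x * a₁ t x + b₁ t x * b₁ t x)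
        + α * (v t x * (a t x * a t x + b t x * b t x))
        + β / 2 * ((a t x * a t x + b t x * b t x) * (a t x * a t x + b t x * b t x))
        + α / (2 * γ) * (3 * (v₁ t x * v₁ t x) - 2 / 3 * (v t x * (v t x * v t x)))) ∂leftMeasure
      + ∫ x, w₂ x * (a t x * a₁ t x + b t x * b₁ t x + α / γ * (v t x * v₁ t x)) ∂leftMeasure)
      t := by
  obtain ⟨i1, h1⟩ := h.hasDerivAt_kdvMass hw ht
  obtain ⟨i2, h2⟩ := h.hasDerivAt_current hw ht
  have i3 := ((LpTendsto.const (l := 𝓝[Ici 0] t) hw.bdd₁).top_mul_one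
    (h.tendsto_virial ht.le)).integrable
  have i4 := ((LpTendsto.const (l := 𝓝[Ici 0] t) hw.bdd₂).top_mul_one
    (h.tendsto_virialError ht.le)).integrable
  refine (h2.sub (h1.const_mul (α / (2 * γ)))).congr_deriv ?_
  rw [hw0, zero_mul, sub_zero, ← integral_const_mul, ← integral_sub i2 (i1.const_mul _),
    ← integral_add i3 i4]
  refine integral_congr_ae (Eventually.of_forall fun x => ?_)
  simp only
  field_simp
  ring

/-- The virial density is controlled by twice the energy density, up to a quarter of the quantity by
which the momentum of `u` exceeds the total momentum. Here `r = |u|²` and `q = |u_x|²`; the condition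
`2 |α γ| ≤ β` makes the remaining quadratic form in `(r, v)` nonpositive. -/
theorem virial_density_le {q r v v₁ : ℝ} (hαγ : α * γ < 0) (hβ : 2 * |α * γ| ≤ β) :
    2 * q + α * (v * r) + β / 2 * (r * r) + α / (2 * γ) * (3 * (v₁ * v₁) - 2 / 3 * (v * (v * v)))
      ≤ 2 * (α * (v * r) - α / (6 * γ) * (v * (v * v)) + β / 2 * (r * r)
        + α / (2 * γ) * (v₁ * v₁) + q) - α / γ / 4 * (v * v) := by
  have hγ : γ ≠ 0 := fun h0 => by simp [h0] at hαγ
  obtain ⟨k, hk⟩ : ∃ k, k = -(α / γ) := ⟨_, rfl⟩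
  have hα : α = -k * γ := by rw [hk]; field_simp
  have hk0 : 0 ≤ k := by
    have h1 : 0 < k * γ ^ 2 := by rw [hα] at hαγ; nlinarith
    exact (pos_of_mul_pos_left h1 (sq_nonneg γ)).le
  have e1 : α / (2 * γ) = -k / 2 := by rw [hα]; field_simp
  have e2 : α / (6 * γ) = -k / 6 := by rw [hα]; field_simp
  have e3 : α / γ = -k := by rw [hα]; field_simp
  have hβ' : 2 * (k * γ ^ 2) ≤ β := by
    rwa [abs_of_neg hαγ, hα, show -(-k * γ * γ) = k * γ ^ 2 by ring] at hβ
  rw [e1, e2, e3, hα]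
  have h1 : 0 ≤ k * (γ * r - v / 2) ^ 2 := by positivity
  have h2 : 0 ≤ k * (v₁ * v₁) := mul_nonneg hk0 (mul_self_nonneg _)
  have h3 := mul_le_mul_of_nonneg_right hβ' (mul_self_nonneg r)
  nlinarith

/-- The virial production dominates `(Q - 8 E)/4` minus a quarter of the time derivative
`-2 ∫ Im (ū u_x)` of the first moment of `|u|²`. -/
theorem virial_integral_le (h : RealSolution α β γ a a₁ a₂ b b₁ b₂ v v₁ v₂ v₃)
    (hαγ : α * γ < 0) (hβ : 2 * |α * γ| ≤ β) {Q E : ℝ} (ht : 0 ≤ t)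
    (hQ : Q ≤ α / γ * ∫ x, v t x * v t x ∂leftMeasure
      - 2 * ∫ x, (a t x * b₁ t x - b t x * a₁ t x) ∂leftMeasure)
    (hE : ∫ x, (α * (v t x * (a t x * a t x + b t x * b t x))
        - α / (6 * γ) * (v t x * (v t x * v t x))
        + β / 2 * ((a t x * a t x + b t x * b t x) * (a t x * a t x + b t x * b t x))
        + α / (2 * γ) * (v₁ t x * v₁ t x) + (a₁ t x * a₁ t x + b₁ t x * b₁ t x)) ∂leftMeasure ≤ E) :
    ∫ x, (2 * (a₁ t x * a₁ t x + b₁ t x * b₁ t x)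
        + α * (v t x * (a t x * a t x + b t x * b t x))
        + β / 2 * ((a t x * a t x + b t x * b t x) * (a t x * a t x + b t x * b t x))
        + α / (2 * γ) * (3 * (v₁ t x * v₁ t x) - 2 / 3 * (v t x * (v t x * v t x)))) ∂leftMeasure
      ≤ -((Q - 8 * E) / 4)
        + (-2 * ∫ x, (a t x * b₁ t x - b t x * a₁ t x) ∂leftMeasure) / 4 := by
  have i1 := (h.tendsto_virial ht).integrable
  have i2 := (h.tendsto_energy ht).integrable
  have i3 := (h.tendsto_kdvMass_one ht).integrable
  have h1 := integral_mono i1 ((i2.const_mul 2).sub (i3.const_mul (α / γ / 4)))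
    fun x => virial_density_le hαγ hβ
  simp only [Pi.sub_apply] at h1
  rw [integral_sub (i2.const_mul 2) (i3.const_mul (α / γ / 4)), integral_const_mul,
    integral_const_mul] at h1
  linarith

/-- Bound from below for the momentum of the initial datum with respect to the truncated weights,
uniform in the truncation. -/
theorem neg_le_integral_cutoff_current {e : ℝ} (he : 0 ≤ e) {a a₁ b b₁ : ℝ → ℝ}
    (h2 : Integrable (fun x => x ^ 2 * (a x * a x + b x * b x)) leftMeasure)
    (hq : Integrable (fun x => a₁ x * a₁ x + b₁ x * b₁ x) leftMeasure)
    (hi : Integrable (fun x => cutoff e x * (a x * b₁ x - b x * a₁ x)) leftMeasure) :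
    -∫ x, (x ^ 2 * (a x * a x + b x * b x) + (a₁ x * a₁ x + b₁ x * b₁ x)) ∂leftMeasure
      ≤ ∫ x, cutoff e x * (a x * b₁ x - b x * a₁ x) ∂leftMeasure := by
  rw [← integral_neg]
  refine integral_mono_ae (h2.add hq).neg hi (ae_leftMeasure_of_forall fun x hx => ?_)
  have h3 := cutoff_nonneg he hx.le
  have h4 := cutoff_le he hx.le
  have h5 : cutoff e x ^ 2 ≤ x ^ 2 := by nlinarith
  have h6 := mul_le_mul_of_nonneg_right h5
    (add_nonneg (mul_self_nonneg (a x)) (mul_self_nonneg (b x)))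
  simp only
  nlinarith [sq_nonneg (cutoff e x * a x + b₁ x), sq_nonneg (cutoff e x * b x - a₁ x),
    sq_nonneg (a₁ x), sq_nonneg (b₁ x), mul_nonneg (sq_nonneg x)
    (add_nonneg (mul_self_nonneg (a x)) (mul_self_nonneg (b x)))]

/-- The virial inequality: since `∫ x² |u|²` stays nonnegative, the first moments, bounded by `S` on
`[0, t]`, have to compensate a quadratic decay of rate `Q - 8 E`. -/
theorem virial_inequality (h : RealSolution α β γ a a₁ a₂ b b₁ b₂ v v₁ v₂ v₃)
    (hαγ : α * γ < 0) (hβ : 2 * |α * γ| ≤ β) {Q E S : ℝ} (ht : 0 ≤ t)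
    (hQ : ∀ s, 0 ≤ s → Q ≤ α / γ * ∫ x, v s x * v s x ∂leftMeasure
      - 2 * ∫ x, (a s x * b₁ s x - b s x * a₁ s x) ∂leftMeasure)
    (hE : ∀ s, 0 ≤ s → ∫ x, (α * (v s x * (a s x * a s x + b s x * b s x))
        - α / (6 * γ) * (v s x * (v s x * v s x))
        + β / 2 * ((a s x * a s x + b s x * b s x) * (a s x * a s x + b s x * b s x))
        + α / (2 * γ) * (v₁ s x * v₁ s x) + (a₁ s x * a₁ s x + b₁ s x * b₁ s x)) ∂leftMeasure ≤ E)
    (h1 : Integrable (fun x => -x * (a 0 x * a 0 x + b 0 x * b 0 x)) leftMeasure)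
    (h2 : Integrable (fun x => x ^ 2 * (a 0 x * a 0 x + b 0 x * b 0 x)) leftMeasure)
    (hS : ∀ s ∈ Icc 0 t, ∫ x, -x * (a s x * a s x + b s x * b s x) ∂leftMeasure ≤ S)
    (hS' : ∀ s ∈ Icc 0 t, Integrable (fun x => -x * (v s x * v s x)) leftMeasure ∧
      ∫ x, -x * (v s x * v s x) ∂leftMeasure ≤ S) :
    (Q - 8 * E) / 2 * t ^ 2 ≤ ∫ x, x ^ 2 * (a 0 x * a 0 x + b 0 x * b 0 x) ∂leftMeasure
      + 4 * (∫ x, (x ^ 2 * (a 0 x * a 0 x + b 0 x * b 0 x)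
          + (a₁ 0 x * a₁ 0 x + b₁ 0 x * b₁ 0 x)) ∂leftMeasure) * t
      + (1 - 2 * (α / γ)) * S * t := by
  have hγ : γ ≠ 0 := fun h0 => by simp [h0] at hαγ
  have hκ : α / (2 * γ) ≤ 0 := by
    have : α / (2 * γ) = α * γ / (2 * γ ^ 2) := by field_simp
    rw [this]
    exact div_nonpos_of_nonpos_of_nonneg hαγ.le (by positivity)
  set X : ℝ → ℝ → ℝ := fun s x => 2 * (a₁ s x * a₁ s x + b₁ s x * b₁ s x)
        + α * (v s x * (a s x * a s x + b s x * b s x))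
        + β / 2 * ((a s x * a s x + b s x * b s x) * (a s x * a s x + b s x * b s x))
        + α / (2 * γ) * (3 * (v₁ s x * v₁ s x) - 2 / 3 * (v s x * (v s x * v s x))) with hX
  set Y : ℝ → ℝ → ℝ := fun s x => a s x * a₁ s x + b s x * b₁ s x + α / γ * (v s x * v₁ s x)
    with hY
  have tX : ∀ s, 0 ≤ s → LpTendsto 1 (𝓝[Ici 0] s) X (X s) := fun s hs => h.tendsto_virial hs
  have tY : ∀ s, 0 ≤ s → LpTendsto 1 (𝓝[Ici 0] s) Y (Y s) := fun s hs => h.tendsto_virialError hs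
  set C0 := ∫ x, x ^ 2 * (a 0 x * a 0 x + b 0 x * b 0 x) ∂leftMeasure with hC0
  set C1 := ∫ x, (x ^ 2 * (a 0 x * a 0 x + b 0 x * b 0 x)
    + (a₁ 0 x * a₁ 0 x + b₁ 0 x * b₁ 0 x)) ∂leftMeasure with hC1
  set P : ℝ → ℝ := fun s => ∫ x, (a s x * b₁ s x - b s x * a₁ s x) ∂leftMeasure with hP
  -- the production of the truncated virial, and its primitive in time
  set G : ℕ → ℝ → ℝ := fun n s => ∫ x, cutoffDeriv (cutoffParam n) x * X s x ∂leftMeasure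
    + ∫ x, cutoffDeriv₂ (cutoffParam n) x * Y s x ∂leftMeasure with hG
  set H : ℕ → ℝ → ℝ := fun n s => ∫ s' in (0 : ℝ)..s, G n s' with hH
  set G' : ℝ → ℝ := fun s => -∫ x, X s x ∂leftMeasure with hG'
  set H' : ℝ → ℝ := fun s => ∫ s' in (0 : ℝ)..s, G' s' with hH'
  have cG : ∀ n, ContinuousOn (G n) (Ici 0) := fun n =>
    (continuousOn_integral (f := fun s x => cutoffDeriv (cutoffParam n) x * X s x) fun s hs =>
      (LpTendsto.const (isWeight_cutoff (cutoffParam_pos n)).bdd₁).top_mul_one (tX s hs)).add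
    (continuousOn_integral (f := fun s x => cutoffDeriv₂ (cutoffParam n) x * Y s x) fun s hs =>
      (LpTendsto.const (isWeight_cutoff (cutoffParam_pos n)).bdd₂).top_mul_one (tY s hs))
  have cG' : ContinuousOn G' (Ici 0) := (continuousOn_integral tX).neg
  have cP : ContinuousOn P (Ici 0) := continuousOn_integral fun s hs => h.tendsto_current_one hs
  have cP4 : ContinuousOn (fun s => -2 * P s / 4) (Ici 0) :=
    (continuousOn_const.mul cP).div_const 4
  have ii : ∀ {g : ℝ → ℝ}, ContinuousOn g (Ici 0) → ∀ {s : ℝ}, 0 ≤ s →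
      IntervalIntegrable g volume 0 s := fun hg s hs =>
    (hg.mono (by rw [Set.uIcc_of_le hs]; exact fun _ hx => hx.1)).intervalIntegrable
  have cprim : ∀ {g : ℝ → ℝ}, ContinuousOn g (Ici 0) →
      ContinuousOn (fun s => ∫ s' in (0 : ℝ)..s, g s') (Icc 0 t) := fun hg => by
    have := intervalIntegral.continuousOn_primitive_interval (a := 0) (b := t)
      ((intervalIntegrable_iff').1 (ii hg ht))
    rwa [Set.uIcc_of_le ht] at this
  obtain ⟨CX, hCX0, hCX⟩ := exists_bound_of_continuousOn
    (continuousOn_integral fun s hs => (tX s hs).abs) t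
  obtain ⟨CY, hCY0, hCY⟩ := exists_bound_of_continuousOn
    (continuousOn_integral fun s hs => (tY s hs).abs) t
  have bG : ∀ n, ∀ s ∈ Icc 0 t, |G n s| ≤ CX + 6 * CY := fun n s hs => by
    have e1 := abs_integral_weight_mul_le (C := 1) (tX s hs.1).integrable
      fun x hx => abs_cutoffDeriv_le (cutoffParam_pos n).le (le_of_lt hx)
    have e2 := abs_integral_weight_mul_le (C := 6) (tY s hs.1).integrable
      fun x hx => (abs_cutoffDeriv₂_le (cutoffParam_pos n).le (le_of_lt hx)).trans
        (by linarith [cutoffParam_le_one n])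
    have e3 := (le_abs_self _).trans (hCX s hs)
    have e4 := (le_abs_self _).trans (hCY s hs)
    refine (abs_add_le _ _).trans ?_
    linarith
  have lG : ∀ s, 0 ≤ s → Tendsto (fun n => G n s) atTop (𝓝 (G' s)) := fun s hs => by
    have := (tendsto_integral_cutoffDeriv (tX s hs).integrable).add
      (tendsto_integral_cutoffDeriv₂ (tY s hs).integrable)
    rwa [add_zero] at this
  have lH : ∀ s ∈ Icc 0 t, Tendsto (fun n => H n s) atTop (𝓝 (H' s)) := fun s hs =>
    tendsto_time_integral hs.1 (fun n => (cG n).mono fun _ hx => hx.1)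
      (fun n s' hs' => bG n s' ⟨hs'.1, hs'.2.trans hs.2⟩) fun s' hs' => lG s' hs'.1
  have lHH : Tendsto (fun n => ∫ s in (0 : ℝ)..t, H n s) atTop (𝓝 (∫ s in (0 : ℝ)..t, H' s)) := by
    refine tendsto_time_integral (C := (CX + 6 * CY) * t) ht (fun n => cprim (cG n))
      (fun n s hs => ?_) lH
    have e1 : ‖H n s‖ ≤ (CX + 6 * CY) * |s - 0| := by
      refine intervalIntegral.norm_integral_le_of_norm_le_const fun s' hs' => ?_
      rw [Set.uIoc_of_le hs.1] at hs'
      exact bG n s' ⟨hs'.1.le, hs'.2.trans hs.2⟩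
    rw [sub_zero, abs_of_nonneg hs.1] at e1
    exact e1.trans (mul_le_mul_of_nonneg_left hs.2 (by positivity))
  -- lower bound of the limit production
  have bH : ∀ s ∈ Icc 0 t, (Q - 8 * E) / 4 * s - S / 4 ≤ H' s := fun s hs => by
    have e1 : ∫ s' in (0 : ℝ)..s, ((Q - 8 * E) / 4 - (-2 * P s') / 4) ≤ H' s := by
      refine intervalIntegral.integral_mono_on hs.1
        (ii (continuousOn_const.sub cP4) hs.1)
        (ii cG' hs.1) fun s' hs' => ?_
      have := h.virial_integral_le hαγ hβ hs'.1 (hQ s' hs'.1) (hE s' hs'.1)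
      simp only [hG', hP, hX]
      linarith
    have e2 := (h.firstMoment_eq h1 hs.1).2
    have e3 := hS s hs
    have e4 : 0 ≤ ∫ x, -x * (a 0 x * a 0 x + b 0 x * b 0 x) ∂leftMeasure :=
      integral_nonneg_of_ae (ae_leftMeasure_of_forall fun x hx =>
        mul_nonneg (by linarith) (add_nonneg (mul_self_nonneg _) (mul_self_nonneg _)))
    have e6 : ∫ s' in (0 : ℝ)..s, -2 * P s' / 4 = (∫ s' in (0 : ℝ)..s, -2 * P s') / 4 :=
      intervalIntegral.integral_div _ _
    rw [intervalIntegral.integral_sub intervalIntegrable_const (ii cP4 hs.1), e6,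
      intervalIntegral.integral_const, sub_zero, smul_eq_mul] at e1
    have e5 : ∫ x, -x * (a s x * a s x + b s x * b s x) ∂leftMeasure
        = ∫ x, -x * (a 0 x * a 0 x + b 0 x * b 0 x) ∂leftMeasure
          + ∫ s' in (0 : ℝ)..s, -2 * P s' := e2
    linarith
  have bHH : (Q - 8 * E) / 8 * t ^ 2 - S / 4 * t ≤ ∫ s in (0 : ℝ)..t, H' s := by
    have e1 : ∫ s in (0 : ℝ)..t, ((Q - 8 * E) / 4 * s - S / 4)
        = (Q - 8 * E) / 8 * t ^ 2 - S / 4 * t := by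
      rw [intervalIntegral.integral_sub
        (Continuous.intervalIntegrable (by fun_prop) _ _) intervalIntegrable_const, intervalIntegral.integral_const_mul, integral_id,
        intervalIntegral.integral_const, smul_eq_mul]
      ring
    rw [← e1]
    refine intervalIntegral.integral_mono_on ht
      (Continuous.intervalIntegrable (by fun_prop) _ _) ?_ bH
    exact (by rw [Set.uIcc_of_le ht]; exact cprim cG' :
      ContinuousOn H' (Set.uIcc 0 t)).intervalIntegrable
  -- mass balance with the weight `sqCutoff`, whose derivative is `-2 cutoff`, after bounding
  -- `∫ cutoff J` from below by the primitive of the virial production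
  have fin : ∀ n, 0 ≤ C0 - 4 * ((∫ s in (0 : ℝ)..t, H n s) - (C1 - α / (2 * γ) * S) * t) := by
    intro n
    have he := cutoffParam_pos n
    have hw := isWeight_cutoff he
    have hw0 : cutoff (cutoffParam n) 0 = 0 := by simp [cutoff]
    have cM := continuousOn_integral fun s hs => h.tendsto_current hw.bdd hs
    have e1 : ∀ s, 0 ≤ s →
        ∫ x, cutoff (cutoffParam n) x * (a s x * b₁ s x - b s x * a₁ s x) ∂leftMeasure
            - α / (2 * γ) * ∫ x, cutoff (cutoffParam n) x * (v s x * v s x) ∂leftMeasure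
          = ∫ x, cutoff (cutoffParam n) x * (a 0 x * b₁ 0 x - b 0 x * a₁ 0 x) ∂leftMeasure
            - α / (2 * γ) * ∫ x, cutoff (cutoffParam n) x * (v 0 x * v 0 x) ∂leftMeasure
            + H n s := fun s hs =>
      eq_add_integral_of_hasDerivAt (cM.sub (continuousOn_const.mul (continuousOn_integral
        fun s hs => h.tendsto_kdvMass hw.bdd hs))) (cG n)
        (fun s hs => h.hasDerivAt_virial hγ hw hw0 hs) hs
    have e2 := neg_le_integral_cutoff_current he.le h2
      (((h.ha₁.cont 0 le_rfl).two_mul_two (h.ha₁.cont 0 le_rfl)).add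
        ((h.hb₁.cont 0 le_rfl).two_mul_two (h.hb₁.cont 0 le_rfl))).integrable
      (h.tendsto_current hw.bdd le_rfl).integrable
    have e3 : 0 ≤ ∫ x, cutoff (cutoffParam n) x * (v 0 x * v 0 x) ∂leftMeasure :=
      integral_nonneg_of_ae (ae_leftMeasure_of_forall fun x hx =>
        mul_nonneg (cutoff_nonneg he.le hx.le) (mul_self_nonneg _))
    have e4 : ∀ s ∈ Icc 0 t, H n s - (C1 - α / (2 * γ) * S)
        ≤ ∫ x, cutoff (cutoffParam n) x * (a s x * b₁ s x - b s x * a₁ s x) ∂leftMeasure := by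
      intro s hs
      have f1 := e1 s hs.1
      have f2 := (integral_cutoff_le (fun x => mul_self_nonneg (v s x)) (hS' s hs).1 he.le).trans
        (hS' s hs).2
      have f3 := mul_le_mul_of_nonpos_left f2 hκ
      have f4 := mul_nonpos_of_nonpos_of_nonneg hκ e3
      linarith
    have e5 : (∫ s in (0 : ℝ)..t, H n s) - (C1 - α / (2 * γ) * S) * t
        ≤ ∫ s in (0 : ℝ)..t, ∫ x, cutoff (cutoffParam n) x * (a s x * b₁ s x - b s x * a₁ s x)
          ∂leftMeasure := by
      have iH : IntervalIntegrable (H n) volume 0 t :=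
        (by rw [Set.uIcc_of_le ht]; exact cprim (cG n) :
          ContinuousOn (H n) (Set.uIcc 0 t)).intervalIntegrable
      have := intervalIntegral.integral_mono_on ht (iH.sub intervalIntegrable_const) (ii cM ht) e4
      rw [intervalIntegral.integral_sub iH intervalIntegrable_const,
        intervalIntegral.integral_const, sub_zero, smul_eq_mul] at this
      linarith
    have e6 := h.mass_eq_add (isWeight_sqCutoff he) ht
    have e7 : 0 ≤ ∫ x, sqCutoff (cutoffParam n) x * (a t x * a t x + b t x * b t x) ∂leftMeasure :=
      integral_nonneg fun x => mul_nonneg (sqCutoff_nonneg _ _)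
        (add_nonneg (mul_self_nonneg _) (mul_self_nonneg _))
    have e8 : ∫ x, sqCutoff (cutoffParam n) x * (a 0 x * a 0 x + b 0 x * b 0 x) ∂leftMeasure
        ≤ C0 := by
      refine integral_mono_of_nonneg (Eventually.of_forall fun x => mul_nonneg (sqCutoff_nonneg _ _)
        (add_nonneg (mul_self_nonneg _) (mul_self_nonneg _))) h2
        (ae_leftMeasure_of_forall fun x hx => ?_)
      exact mul_le_mul_of_nonneg_right (sqCutoff_le he.le hx.le)
        (add_nonneg (mul_self_nonneg _) (mul_self_nonneg _))
    simp only [mul_assoc, integral_const_mul, intervalIntegral.integral_const_mul] at e6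
    linarith
  have hlim := ge_of_tendsto' (((lHH.sub_const ((C1 - α / (2 * γ) * S) * t)).const_mul 4).const_sub
    C0) fin
  have hfin : α / (2 * γ) = α / γ / 2 := by field_simp
  rw [hfin] at hlim
  linarith

end RealSolution
/-! ### Weighted norms and conserved quantities of the original solution -/

section WeightedNorm

variable {E : Type*} [NormedAddCommGroup E] {f : ℝ → E} {g m : ℝ → ℝ} {p : ℝ}

theorem weightedNorm_sq [NormedSpace ℝ E] (hm : ∀ x < 0, (|x| ^ p) ^ 2 = m x)
    (hfg : ∀ᵐ x ∂leftMeasure, ‖f x‖ ^ 2 = g x) :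
    weightedNorm p f ^ 2 = ∫⁻ x, ENNReal.ofReal (m x * g x) ∂leftMeasure := by
  rw [weightedNorm, eLpNorm_eq_lintegral_rpow_enorm_toReal (by simp) (by simp),
    ← ENNReal.rpow_natCast, ← ENNReal.rpow_mul]
  simp only [ENNReal.toReal_ofNat, Nat.cast_ofNat, one_div]
  norm_num
  refine lintegral_congr_ae ?_
  filter_upwards [hfg, ae_lt_zero] with x h1 hx
  rw [← hm x hx, ← h1, ← mul_pow, ← ofReal_norm, norm_smul, ← ENNReal.ofReal_pow (by positivity),
    Real.norm_of_nonneg (by positivity)]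

theorem ae_weight_mul_nonneg (hm : ∀ x < 0, (|x| ^ p) ^ 2 = m x)
    (hfg : ∀ᵐ x ∂leftMeasure, ‖f x‖ ^ 2 = g x) : 0 ≤ᵐ[leftMeasure] fun x => m x * g x := by
  filter_upwards [hfg, ae_lt_zero] with x h1 hx
  rw [← hm x hx, ← h1]
  positivity

theorem integrable_of_weightedNorm_lt_top [NormedSpace ℝ E] (hm : ∀ x < 0, (|x| ^ p) ^ 2 = m x)
    (hfg : ∀ᵐ x ∂leftMeasure, ‖f x‖ ^ 2 = g x) (hmc : Continuous m)
    (hg : AEStronglyMeasurable g leftMeasure) (h : weightedNorm p f < ⊤) :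
    Integrable (fun x => m x * g x) leftMeasure := by
  refine (lintegral_ofReal_ne_top_iff_integrable (hmc.aestronglyMeasurable.mul hg)
    (ae_weight_mul_nonneg hm hfg)).1 ?_
  exact (weightedNorm_sq hm hfg).symm.trans_ne (ENNReal.pow_ne_top h.ne)

theorem weightedNorm_sq_eq_ofReal [NormedSpace ℝ E] (hm : ∀ x < 0, (|x| ^ p) ^ 2 = m x)
    (hfg : ∀ᵐ x ∂leftMeasure, ‖f x‖ ^ 2 = g x)
    (hi : Integrable (fun x => m x * g x) leftMeasure) :
    weightedNorm p f ^ 2 = ENNReal.ofReal (∫ x, m x * g x ∂leftMeasure) := by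
  rw [weightedNorm_sq hm hfg, ofReal_integral_eq_lintegral_ofReal hi (ae_weight_mul_nonneg hm hfg)]

theorem abs_rpow_half_sq {x : ℝ} (hx : x < 0) : (|x| ^ (1 / 2 : ℝ)) ^ 2 = -x := by
  rw [← Real.sqrt_eq_rpow, Real.sq_sqrt (abs_nonneg x), abs_of_neg hx]

end WeightedNorm

theorem moment_eq {α γ : ℝ} {u : ℝ → ℂ} {v : ℝ → ℝ} {a a₁ b b₁ V : ℝ → ℝ}
    (hu : ∀ᵐ x ∂leftMeasure, (u x).re = a x ∧ (u x).im = b x ∧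
      (wderiv u x).re = a₁ x ∧ (wderiv u x).im = b₁ x) (hv : v =ᵐ[leftMeasure] V)
    (h1 : Integrable (fun x => V x * V x) leftMeasure)
    (h2 : Integrable (fun x => a x * b₁ x - b x * a₁ x) leftMeasure) :
    moment α γ u v = α / γ * ∫ x, V x * V x ∂leftMeasure
      - 2 * ∫ x, (a x * b₁ x - b x * a₁ x) ∂leftMeasure := by
  rw [moment, ← integral_const_mul, ← integral_const_mul,
    ← integral_sub (h1.const_mul _) (h2.const_mul _)]
  refine integral_congr_ae ?_
  filter_upwards [hu, hv] with x ⟨e1, e2, e3, e4⟩ e5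
  rw [e5, Complex.mul_im, Complex.conj_re, Complex.conj_im, e1, e2, e3, e4]
  ring

theorem energy_eq {α β γ : ℝ} {u : ℝ → ℂ} {v : ℝ → ℝ} {a a₁ b b₁ V V₁ : ℝ → ℝ}
    (hu : ∀ᵐ x ∂leftMeasure, (u x).re = a x ∧ (u x).im = b x ∧
      (wderiv u x).re = a₁ x ∧ (wderiv u x).im = b₁ x) (hv : v =ᵐ[leftMeasure] V)
    (hv₁ : wderiv v =ᵐ[leftMeasure] V₁) :
    energy α β γ u v = ∫ x, (α * (V x * (a x * a x + b x * b x))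
        - α / (6 * γ) * (V x * (V x * V x))
        + β / 2 * ((a x * a x + b x * b x) * (a x * a x + b x * b x))
        + α / (2 * γ) * (V₁ x * V₁ x) + (a₁ x * a₁ x + b₁ x * b₁ x)) ∂leftMeasure := by
  rw [energy]
  refine integral_congr_ae ?_
  filter_upwards [hu, hv, hv₁] with x ⟨e1, e2, e3, e4⟩ e5 e6
  rw [e5, e6, show ‖u x‖ ^ 4 = (‖u x‖ ^ 2) ^ 2 by ring, norm_sq_eq_of_re_im e1 e2,
    norm_sq_eq_of_re_im e3 e4]
  ring

theorem HasWeakDeriv.wderiv_congr {E : Type*} [NormedAddCommGroup E] [NormedSpace ℝ E]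
    [CompleteSpace E] {f f' g : ℝ → E} (h : HasWeakDeriv f g) (hf : f =ᵐ[leftMeasure] f') :
    wderiv f' =ᵐ[leftMeasure] wderiv f :=
  (h.congr hf .rfl).wderiv_ae_eq.trans h.wderiv_ae_eq.symm

/-- The real form of a solution, with all data of the original problem expressed through it. -/
theorem IsGlobalRegularSolution.exists_realSolution_of_initial {α β γ : ℝ} {u₀ : ℝ → ℂ}
    {v₀ : ℝ → ℝ} {u : ℝ → ℝ → ℂ} {v : ℝ → ℝ → ℝ} (h : IsGlobalRegularSolution α β γ u₀ v₀ u v) :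
    ∃ a a₁ a₂ b b₁ b₂ V V₁ V₂ V₃ : ℝ → ℝ → ℝ,
      RealSolution α β γ a a₁ a₂ b b₁ b₂ V V₁ V₂ V₃ ∧
      (∀ t, 0 ≤ t → ∀ᵐ x ∂leftMeasure, ‖u t x‖ ^ 2 = a t x * a t x + b t x * b t x) ∧
      (∀ t, 0 ≤ t → ∀ᵐ x ∂leftMeasure, ‖v t x‖ ^ 2 = V t x * V t x) ∧
      (∀ᵐ x ∂leftMeasure, ‖u₀ x‖ ^ 2 = a 0 x * a 0 x + b 0 x * b 0 x) ∧
      (∀ᵐ x ∂leftMeasure, ‖v₀ x‖ ^ 2 = V 0 x * V 0 x) ∧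
      moment α γ u₀ v₀ = α / γ * ∫ x, V 0 x * V 0 x ∂leftMeasure
        - 2 * ∫ x, (a 0 x * b₁ 0 x - b 0 x * a₁ 0 x) ∂leftMeasure ∧
      energy α β γ u₀ v₀ = ∫ x, (α * (V 0 x * (a 0 x * a 0 x + b 0 x * b 0 x))
        - α / (6 * γ) * (V 0 x * (V 0 x * V 0 x))
        + β / 2 * ((a 0 x * a 0 x + b 0 x * b 0 x) * (a 0 x * a 0 x + b 0 x * b 0 x))
        + α / (2 * γ) * (V₁ 0 x * V₁ 0 x) + (a₁ 0 x * a₁ 0 x + b₁ 0 x * b₁ 0 x)) ∂leftMeasure := by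
  obtain ⟨a, a₁, a₂, b, b₁, b₂, V, V₁, V₂, V₃, hR, hae⟩ := h.exists_realSolution
  have sq : ∀ {y z : ℝ}, y = z → ‖y‖ ^ 2 = z * z := fun e => by
    rw [e, Real.norm_eq_abs, sq_abs, sq]
  have du : wderiv u₀ =ᵐ[leftMeasure] wderiv (u 0) :=
    ((h.u_cont.1 0 le_rfl).2 0 (by norm_num)).wderiv_congr h.u_initial
  have dv : wderiv v₀ =ᵐ[leftMeasure] wderiv (v 0) :=
    ((h.v_cont.1 0 le_rfl).2 0 (by norm_num)).wderiv_congr h.v_initial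
  have hu : ∀ᵐ x ∂leftMeasure, (u₀ x).re = a 0 x ∧ (u₀ x).im = b 0 x ∧
      (wderiv u₀ x).re = a₁ 0 x ∧ (wderiv u₀ x).im = b₁ 0 x := by
    filter_upwards [hae 0 le_rfl, h.u_initial, du] with x e1 e2 e3
    rw [← e2, e3]
    exact e1.1
  have hv : v₀ =ᵐ[leftMeasure] V 0 := by
    filter_upwards [hae 0 le_rfl, h.v_initial] with x e1 e2
    rw [← e2, e1.2.1]
  have hv₁ : wderiv v₀ =ᵐ[leftMeasure] V₁ 0 := by
    filter_upwards [hae 0 le_rfl, dv] with x e1 e2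
    rw [e2, e1.2.2]
  refine ⟨a, a₁, a₂, b, b₁, b₂, V, V₁, V₂, V₃, hR, fun t ht => ?_, fun t ht => ?_, ?_, ?_,
    moment_eq hu hv (hR.tendsto_kdvMass_one le_rfl).integrable
      (hR.tendsto_current_one le_rfl).integrable, energy_eq hu hv hv₁⟩
  · filter_upwards [hae t ht] with x e
    exact norm_sq_eq_of_re_im e.1.1 e.1.2.1
  · filter_upwards [hae t ht] with x e
    exact sq e.2.1
  · filter_upwards [hu] with x e
    exact norm_sq_eq_of_re_im e.1 e.2.1
  · filter_upwards [hv] with x e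
    exact sq e

/-- A quantity that dominates a multiple of `t` for large `t` dominates every smaller power. -/
theorem tendsto_div_rpow_top {F : ℝ → ℝ≥0∞} {c : ℝ} (hc : 0 < c)
    (h : ∀ᶠ t in atTop, ENNReal.ofReal (c * t) ≤ F t) {ε : ℝ} (hε : 0 < ε) :
    Tendsto (fun t : ℝ => F t / ENNReal.ofReal (t ^ (1 - ε))) atTop (𝓝 ⊤) := by
  refine tendsto_nhds_top_mono
    (ENNReal.tendsto_ofReal_atTop.comp ((tendsto_rpow_atTop hε).const_mul_atTop hc)) ?_
  filter_upwards [h, eventually_gt_atTop 0] with t ht h0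
  have e : c * t ^ ε = c * t / t ^ (1 - ε) := by
    rw [eq_div_iff (Real.rpow_pos_of_pos h0 _).ne', mul_assoc, ← Real.rpow_add h0,
      add_sub_cancel, Real.rpow_one]
  simp only [Function.comp]
  rw [e, ENNReal.ofReal_div_of_pos (Real.rpow_pos_of_pos h0 _)]
  exact ENNReal.div_le_div_right ht _

end NLSKdV

theorem theorem1p4 (α β γ : ℝ) (hαγ : α * γ < 0)
    (u₀ : ℝ → ℂ) (v₀ : ℝ → ℝ) (u : ℝ → ℝ → ℂ) (v : ℝ → ℝ → ℝ)
    (hsol : NLSKdV.IsGlobalRegularSolution α β γ u₀ v₀ u v)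
    (hu₀ : NLSKdV.weightedNorm (1 / 2) u₀ < ⊤) (hv₀ : NLSKdV.weightedNorm (1 / 2) v₀ < ⊤) :
    (∀ t, 0 ≤ t → NLSKdV.weightedSup u v t < ⊤) ∧
    (0 < NLSKdV.moment α γ u₀ v₀ → ∀ t, 0 ≤ t →
      ENNReal.ofReal (NLSKdV.moment α γ u₀ v₀ * t) + NLSKdV.weightedNorm (1 / 2) u₀ ^ 2
        ≤ NLSKdV.weightedNorm (1 / 2) (u t) ^ 2) ∧
    (NLSKdV.weightedNorm 1 u₀ < ⊤ →
      8 * NLSKdV.energy α β γ u₀ v₀ < NLSKdV.moment α γ u₀ v₀ → 2 * |α * γ| ≤ β →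
      ∀ ε : ℝ, 0 < ε →
        Tendsto (fun t : ℝ => NLSKdV.weightedSup u v t / ENNReal.ofReal (t ^ (1 - ε)))
          atTop (𝓝 ⊤)) := by
  open NLSKdV in
  have hγ : γ ≠ 0 := fun h0 => by simp [h0] at hαγ
  have hκ : α / γ < 0 := by
    have : α / γ = α * γ / γ ^ 2 := by field_simp
    rw [this]
    exact div_neg_of_neg_of_pos hαγ (by positivity)
  obtain ⟨a, a₁, a₂, b, b₁, b₂, V, V₁, V₂, V₃, hR, hu, hv, hu0, hv0, hmom, hen⟩ :=
    hsol.exists_realSolution_of_initial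
  have half : ∀ x < (0 : ℝ), (|x| ^ (1 / 2 : ℝ)) ^ 2 = -x := fun x hx => abs_rpow_half_sq hx
  have full : ∀ x < (0 : ℝ), (|x| ^ (1 : ℝ)) ^ 2 = x ^ 2 := fun x _ => by simp
  have mr := (hR.tendsto_mass_one (le_refl (0 : ℝ))).integrable.aestronglyMeasurable
  have mv := (hR.tendsto_kdvMass_one (le_refl (0 : ℝ))).integrable.aestronglyMeasurable
  have hP0 := integrable_of_weightedNorm_lt_top half hu0 continuous_neg mr hu₀
  have hW0 := integrable_of_weightedNorm_lt_top half hv0 continuous_neg mv hv₀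
  have nu : ∀ t, 0 ≤ t → weightedNorm (1 / 2) (u t) ^ 2
      = ENNReal.ofReal (∫ x, -x * (a t x * a t x + b t x * b t x) ∂leftMeasure) := fun t ht =>
    weightedNorm_sq_eq_ofReal half (hu t ht) (hR.firstMoment_eq hP0 ht).1
  have hfin : ∀ t, 0 ≤ t → weightedSup u v t < ⊤ := by
    intro t ht
    obtain ⟨K, hK0, hK⟩ := hR.exists_firstMoment_bound hP0 t
    obtain ⟨L, hL⟩ := hR.exists_kdvFirstMoment_bound hP0 hW0 t
    refine lt_of_le_of_lt (b := ENNReal.ofReal K + ENNReal.ofReal L)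
      (iSup₂_le fun s hs => add_le_add ?_ ?_) (by simp)
    · rw [nu s hs.1]
      exact ENNReal.ofReal_le_ofReal (hK s hs)
    · rw [weightedNorm_sq_eq_ofReal half (hv s hs.1) (hL s hs).1]
      exact ENNReal.ofReal_le_ofReal (hL s hs).2
  have hmass : ∀ s, 0 ≤ s → 0 ≤ ∫ x, V s x * V s x ∂leftMeasure := fun s _ =>
    integral_nonneg fun x => mul_self_nonneg _
  refine ⟨hfin, fun hQ t ht => ?_, fun hx hQE hβ ε hε => ?_⟩
  · rw [nu t ht, weightedNorm_sq_eq_ofReal half hu0 hP0,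
      ← ENNReal.ofReal_add (by positivity) (integral_nonneg_of_ae (ae_weight_mul_nonneg half hu0))]
    refine ENNReal.ofReal_le_ofReal ?_
    rw [(hR.firstMoment_eq hP0 ht).2, add_comm]
    gcongr
    have hc : ContinuousOn (fun s => -2 * ∫ x, (a s x * b₁ s x - b s x * a₁ s x) ∂leftMeasure)
        (Set.uIcc 0 t) :=
      (continuousOn_const.mul (continuousOn_integral fun s hs => hR.tendsto_current_one hs)).mono
        (by rw [Set.uIcc_of_le ht]; exact fun _ hs => hs.1)
    have h1 := intervalIntegral.integral_mono_on (f := fun _ => moment α γ u₀ v₀) (μ := volume) ht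
      intervalIntegrable_const hc.intervalIntegrable fun s hs => by
        have h2 := hR.momentum_le hγ hs.1
        have h3 := mul_nonpos_of_nonpos_of_nonneg hκ.le (hmass s hs.1)
        linarith
    rwa [intervalIntegral.integral_const, sub_zero, smul_eq_mul, mul_comm] at h1
  · have h2 := integrable_of_weightedNorm_lt_top full hu0 (continuous_pow 2) mr hx
    obtain ⟨D, hD⟩ : ∃ D, D = (moment α γ u₀ v₀ - 8 * energy α β γ u₀ v₀) / 2 := ⟨_, rfl⟩
    obtain ⟨K, hK⟩ : ∃ K, K = 1 - 2 * (α / γ) := ⟨_, rfl⟩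
    obtain ⟨C₀, hC₀⟩ : ∃ C, C = ∫ x, x ^ 2 * (a 0 x * a 0 x + b 0 x * b 0 x) ∂leftMeasure :=
      ⟨_, rfl⟩
    obtain ⟨C₁, hC₁⟩ : ∃ C, C = ∫ x, (x ^ 2 * (a 0 x * a 0 x + b 0 x * b 0 x)
      + (a₁ 0 x * a₁ 0 x + b₁ 0 x * b₁ 0 x)) ∂leftMeasure := ⟨_, rfl⟩
    have hD0 : 0 < D := by linarith
    have hK0 : 0 < K := by linarith
    have hC0 : 0 ≤ C₀ := hC₀ ▸ integral_nonneg_of_ae (ae_weight_mul_nonneg full hu0)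
    refine tendsto_div_rpow_top (c := D / (2 * K)) (by positivity) ?_ hε
    filter_upwards [eventually_ge_atTop 1, eventually_ge_atTop ((C₀ + 4 * C₁) * 2 / D)]
      with t ht1 ht2
    have ht : 0 ≤ t := zero_le_one.trans ht1
    have hsup := (hfin t ht).ne
    have hle : ∀ s ∈ Icc 0 t, weightedNorm (1 / 2) (u s) ^ 2 + weightedNorm (1 / 2) (v s) ^ 2
        ≤ weightedSup u v t := fun s hs => le_iSup₂_of_le s hs le_rfl
    obtain ⟨L, hL⟩ := hR.exists_kdvFirstMoment_bound hP0 hW0 t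
    have hvir := hR.virial_inequality hαγ hβ (Q := moment α γ u₀ v₀) (E := energy α β γ u₀ v₀)
      (S := (weightedSup u v t).toReal) ht
      (fun s hs => hmom ▸ hR.momentum_le hγ hs) (fun s hs => hen ▸ hR.energy_le hαγ hs) hP0 h2
      (fun s hs => (ENNReal.ofReal_le_iff_le_toReal hsup).1 (by
        rw [← nu s hs.1]
        exact le_self_add.trans (hle s hs)))
      (fun s hs => ⟨(hL s hs).1, (ENNReal.ofReal_le_iff_le_toReal hsup).1 (by
        rw [← weightedNorm_sq_eq_ofReal half (hv s hs.1) (hL s hs).1]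
        exact le_add_self.trans (hle s hs))⟩)
    rw [← hC₀, ← hC₁, ← hD, ← hK] at hvir
    -- for `t ≥ 1` and `D t ≥ 2 (C₀ + 4 C₁)`, half of `D t²` absorbs `C₀ + 4 C₁ t`
    refine (ENNReal.ofReal_le_iff_le_toReal hsup).2 ?_
    rw [div_le_iff₀ hD0] at ht2
    obtain ⟨S, hS⟩ : ∃ S, S = (weightedSup u v t).toReal := ⟨_, rfl⟩
    rw [← hS] at hvir ⊢
    rw [div_mul_eq_mul_div, div_le_iff₀ (by positivity)]
    have h3 : t * (D * t) ≤ t * (S * (2 * K)) := by nlinarith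
    exact le_of_mul_le_mul_left h3 (by linarith)
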